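/- **Setting.** For $n\in\mathbb N$, $0\le l<n$, $|m|\le l$ let $$H_{nlm}(r,\vartheta,\varphi)=N_{nl}\,R_{nl}(r)\,Q_{lm}P_{lm}(\cos\vartheta)\,\mathrm e^{\mathrm im\varphi},\quad N_{nl}=\sqrt{\tfrac{2(n-l-1)!}{\Gamma(n+1/2)}},\quad R_{nl}(r)=L^{(l+1/2)}_{n-l-1}(r^2)\,r^l,$$ with the generalized Laguerre polynomials $L_k^{(\alpha)}$, the associated Legendre functions $P_{lm}(\xi)=\frac{(-1)^m}{2^l l!}(1-\xi^2)^{m/2}\frac{\mathrm d^{l+m}}{\mathrm d\xi^{l+m}}(\xi^2-1)^l$ and $Q_{lm}=\sqrt{\frac{2l+1}{4\pi}\frac{(l-m)!}{(l+m)!}}$. Let $B\ge2$ be an integer bandwidth, $\rho>0$, let $x_i=[r_i,\vartheta_i,\varphi_i]$, $i=0,\dots,M-1$, be points in spherical coordinates ($0\le r_i\le\rho$, $\vartheta_i\in[0,\pi]$, $\varphi_i\in[0,2\pi)$), let $\hat f=[\hat f_{nlm}]_{|m|\le l<n\le B}$ be complex coefficients, $f=\sum_{|m|\le l<n\le B}\hat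 f_{nlm}H_{nlm}$, and $\|\hat f\|_1=\sum|\hat f_{nlm}|$. **NFSGLFT.** Put $\omega_j=(2j+1)\pi/4B$, $0\le j<2B$. For samples $y_0,\dots,y_{2B-1}$ let $\mathcal T y$ be the vector of Chebyshev coefficients $(\mathcal Ty)_0=\frac1{2B}\sum_jy_j$, $(\mathcal Ty)_\kappa=\frac1B\sum_j y_j\cos(\kappa\omega_j)$, $0<\kappa<2B$ (computed by the discrete cosine transform). Compute $\alpha_{\cdot lm}=\mathcal T\big[\sum_{n=l+1}^B\hat f_{nlm}N_{nl}R_{nl}(\tfrac\rho2(1+\cos\omega_j))\big]_j$ and rewrite $\sum_\kappa\alpha_{\kappa lm}\cos\kappa\omega=\sum_{\kappa=-2B}^{2B-1}\beta_{\kappa lm}\mathrm e^{\mathrm i\kappa\omega}$. For $|m|<B$ put $h_{\kappa_0,m}(\cos\omega_j)=\sum_{l=|m|}^{B-1}\beta_{\kappa_0lm}Q_{lm}P_{lm}(\cos\omega_j)$. If $m$ is even, compute $\varepsilon_{\kappa_0,\cdot,m}=\mathcal T[h_{\kappa_0,m}(\cos\omega_j)]_j$ and rewrite $\sum_\kappa\varepsilon_{\kappa_0,\kappa,m}\cos\kappa\omega=\sum_{\kappa=-2B}^{2B-1}\zeta_{\kappa_0,\kappa,m}\mathrm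 e^{\mathrm i\kappa\omega}$; if $m$ is odd, compute $\varepsilon_{\kappa_0,\cdot,m}=\mathcal T[h_{\kappa_0,m}(\cos\omega_j)/\sin\omega_j]_j$ and rewrite $\sin\omega\sum_\kappa\varepsilon_{\kappa_0,\kappa,m}\cos\kappa\omega=\sum_{\kappa=-2B}^{2B-1}\zeta_{\kappa_0,\kappa,m}\mathrm e^{\mathrm i\kappa\omega}$ (here $\varepsilon_{\kappa_0,2B-1,m}=0$). Let $\eta_{k}=\zeta_{k_0,k_1,k_2}$ if $|k_2|<B$ and $\eta_k=0$ otherwise, $k\in\{-2B,\dots,2B-1\}^3$. The output $\tilde f(x_i)$ is the output at $\tilde x_i=[\arccos\frac{2r_i-\rho}{\rho},\vartheta_i,\varphi_i]$ of the following three-dimensional NFFT with degree $4B$ and coefficients $\eta_k$. **Gaussian NFFT.** Let $I_n^d=\{k\in\mathbb Z^d:-n/2\le k_j<n/2\}$, $n$ even, let $\sigma\ge2$ (oversampling factor) and $q\ge1$ (cutoff parameter) be integers, $\lambda=\frac{\sigma q}{(2\sigma-1)\pi}$, $\varphi(x)=\prod_{j}\frac{1}{\sqrt{2\pi\lambda}}\frac{\sigma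 n}{2\pi}\mathrm e^{-(\sigma n/2\pi)^2x_j^2/2\lambda}$ on $\mathbb R^d$, and let $\psi$ equal $\varphi$ on $[-\frac{2\pi q}{\sigma n},\frac{2\pi q}{\sigma n}]^d$ and $0$ elsewhere. A tilde denotes $2\pi$-periodization, and $\tilde\varphi_k=(2\pi)^{-d}\int_{[0,2\pi)^d}\tilde\varphi(t)\mathrm e^{-\mathrm i\langle k,t\rangle}\mathrm dt$. With coefficients $\omega_k$, $k\in I_n^d$, the output at $t$ is $$s(t)=\sum_{l\in I^d_{\sigma n}}\alpha_l\,\tilde\psi\Big(t-\frac{2\pi}{\sigma n}l\Big),\qquad \alpha_l=(\sigma n)^{-d}\sum_{k\in I^d_n}\frac{\omega_k}{\tilde\varphi_k}\,\mathrm e^{2\pi\mathrm i\langle k,l\rangle/\sigma n}.$$ **Theorem.** Let $E_\infty=\max_i|f(x_i)-\tilde f(x_i)|$ be the maximum absolute error of the NFSGLFT. There is an absolute constant $C>0$ such that for all $B\ge2$, $\sigma\ge2$, $q\ge1$, $\rho>0$, all $M$, all points with $r_i\le\rho$, and all $\hat f$, $$E_\infty\le C\,B^{7/2}\,a_{\rho,B}\,\exp\Big(b_{\rho,B}\big(B+\tfrac12\big)^{1-1/\mathrm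 e}+\frac{\rho^2}2-\frac{q\pi}2\Big)\,\|\hat f\|_1 ,$$ where $$a_{\rho,B}=\begin{cases}1&\text{if }\rho<1\text{ and }B\le\Omega(\rho),\\\rho^{-1}&\text{otherwise,}\end{cases}\qquad b_{\rho,B}=\frac{\mathrm e^{2/\mathrm e}}2\begin{cases}1&\text{if }\rho<1\text{ and }B\le\Omega(\rho),\\\rho^{2/\mathrm e}&\text{otherwise,}\end{cases}$$ $$\Omega(\rho)=\Big(\frac{\mathrm e^{2/\mathrm e}(\rho^{2/\mathrm e}-1)}{2\ln\rho}\Big)^{1-1/\mathrm e}-\frac12 .$$ Moreover, for $\rho<1$ the same estimate (with the same $C$) holds for every $B\ge 2$ with $a_{\rho,B}$ and $b_{\rho,B}$ replaced by their values $1$ and $\mathrm e^{2/\mathrm e}/2$ of the first case. Consequently the error decays exponentially in $q$: for all $B\ge2$ and $\rho>0$ there is $K>0$ such that $E_\infty\le K\mathrm e^{-q\pi/2}\|\hat f\|_1$ for all $\sigma\ge2$, $q\ge1$, $M$, all points with $r_i\le\rho$, and all $\hat f$. And it grows at most subexponentially in $B$: for all $\rho>0$ and $\varepsilon>0$ there is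 $K>0$ such that $E_\infty\le K\mathrm e^{\varepsilon B}\|\hat f\|_1$ for all $B\ge2$, $\sigma\ge2$, $q\ge1$, $M$, all points with $r_i\le\rho$, and all $\hat f$. -/

import Mathlib

open MeasureTheory

noncomputable section

namespace SGL

/-! ### Spherical Gauss-Laguerre basis functions -/

/-- A point of three-dimensional space given by spherical coordinates. -/
structure SphericalPoint where
  /-- radius -/
  r : ℝ
  /-- polar angle -/
  θ : ℝ
  /-- azimuthal angle -/
  φ : ℝ
  r_nonneg : 0 ≤ r
  θ_mem : θ ∈ Set.Icc 0 Real.pi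
  φ_mem : φ ∈ Set.Ico 0 (2 * Real.pi)

/-- The generalized Laguerre polynomial
`L_k^(α)(x) = ∑_{i ≤ k} binom(k + α, k - i) (-x)^i / i!`, the generalized binomial coefficient
being written through the Gamma function (it is used for `α > 0` only). -/
def laguerre (k : ℕ) (α x : ℝ) : ℝ :=
  ∑ i ∈ Finset.range (k + 1),
    Real.Gamma (k + α + 1) / (Real.Gamma (α + i + 1) * (Nat.factorial (k - i) : ℝ)) *
      ((-x) ^ i / (Nat.factorial i : ℝ))

/-- Radial normalization constant `N_{nl}` (for `l < n`). -/
def radialNorm (n l : ℕ) : ℝ :=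
  Real.sqrt (2 * (Nat.factorial (n - l - 1) : ℝ) / Real.Gamma ((n : ℝ) + 1 / 2))

/-- Radial part `R_{nl}(r) = L_{n-l-1}^{(l+1/2)}(r²) r^l` (for `l < n`). -/
def radialPart (n l : ℕ) (r : ℝ) : ℝ :=
  laguerre (n - l - 1) ((l : ℝ) + 1 / 2) (r ^ 2) * r ^ l

/-- Associated Legendre function `P_{lm}` (for `|m| ≤ l`):
`P_{lm}(ξ) = (-1)^m / (2^l l!) (1 - ξ²)^{m/2} (d/dξ)^{l+m} (ξ² - 1)^l`. -/
def assocLegendre (l : ℕ) (m : ℤ) (ξ : ℝ) : ℝ :=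
  (-1 : ℝ) ^ m / (2 ^ l * (Nat.factorial l : ℝ)) * (1 - ξ ^ 2) ^ ((m : ℝ) / 2) *
    (Polynomial.derivative^[((l : ℤ) + m).toNat]
      ((Polynomial.X ^ 2 - 1 : Polynomial ℝ) ^ l)).eval ξ

/-- Normalization constant `Q_{lm}` of the spherical harmonic `Y_{lm}` (for `|m| ≤ l`). -/
def sphericalNorm (l : ℕ) (m : ℤ) : ℝ :=
  Real.sqrt ((2 * (l : ℝ) + 1) / (4 * Real.pi) *
    ((Nat.factorial ((l : ℤ) - m).toNat : ℝ) / (Nat.factorial ((l : ℤ) + m).toNat : ℝ)))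

/-- Spherical harmonic `Y_{lm}(ϑ, φ) = Q_{lm} P_{lm}(cos ϑ) e^{imφ}`. -/
def sphericalHarmonic (l : ℕ) (m : ℤ) (θ φ : ℝ) : ℂ :=
  (sphericalNorm l m : ℂ) * (assocLegendre l m (Real.cos θ) : ℂ) *
    Complex.exp (Complex.I * (m : ℂ) * (φ : ℂ))

/-- SGL basis function `H_{nlm}` (for `|m| ≤ l < n`). -/
def sglBasis (n l : ℕ) (m : ℤ) (x : SphericalPoint) : ℂ :=
  (radialNorm n l : ℂ) * (radialPart n l x.r : ℂ) * sphericalHarmonic l m x.θ x.φ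

/-- The bandlimited function `f = ∑_{|m| ≤ l < n ≤ B} f̂_{nlm} H_{nlm}`; its values at given points
are the output of the exact transform (NDSGLFT). Only the coefficients with
`|m| ≤ l < n ≤ B` matter. -/
def bandlimited (B : ℕ) (fhat : ℕ → ℕ → ℤ → ℂ) (x : SphericalPoint) : ℂ :=
  ∑ n ∈ Finset.Icc 1 B, ∑ l ∈ Finset.range n, ∑ m ∈ Finset.Icc (-(l : ℤ)) l,
    fhat n l m * sglBasis n l m x

/-- The 1-norm `‖f̂‖₁` of the vector of Fourier coefficients, `|m| ≤ l < n ≤ B`. -/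
def coeffNorm (B : ℕ) (fhat : ℕ → ℕ → ℤ → ℂ) : ℝ :=
  ∑ n ∈ Finset.Icc 1 B, ∑ l ∈ Finset.range n, ∑ m ∈ Finset.Icc (-(l : ℤ)) l, ‖fhat n l m‖

/-! ### The non-equispaced fast Fourier transform (NFFT) with Gaussian ansatz function -/

/-- The grid `I_n^d = {z ∈ ℤ^d : -n/2 ≤ z_i < n/2}`, for `n` even. -/
def grid (d n : ℕ) : Finset (Fin d → ℤ) :=
  Fintype.piFinset fun _ => Finset.Ico (-((n : ℤ) / 2)) ((n : ℤ) / 2)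

/-- The standard inner product `⟨k, t⟩₂` of a multi-index with a vector. -/
def dot {d : ℕ} (k : Fin d → ℤ) (t : Fin d → ℝ) : ℝ := ∑ j, (k j : ℝ) * t j

/-- The `2π`-periodization `t ↦ ∑_{z ∈ ℤ^d} g(t - 2πz)`. -/
def periodize {d : ℕ} (g : (Fin d → ℝ) → ℝ) (t : Fin d → ℝ) : ℝ :=
  ∑' z : Fin d → ℤ, g (fun j => t j - 2 * Real.pi * (z j : ℝ))

/-- The special choice `λ = σ q / ((2σ - 1) π)` of the shape parameter. -/
def shape (σ q : ℕ) : ℝ := (σ : ℝ) * q / ((2 * (σ : ℝ) - 1) * Real.pi)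

/-- The Gaussian ansatz function `φ` with shape parameter `lam`. -/
def gaussAnsatz {d : ℕ} (n σ : ℕ) (lam : ℝ) (x : Fin d → ℝ) : ℝ :=
  ∏ j, (1 / Real.sqrt (2 * Real.pi * lam) * ((σ : ℝ) * n / (2 * Real.pi)) *
    Real.exp (-(((σ : ℝ) * n / (2 * Real.pi)) ^ 2 * (x j) ^ 2 / (2 * lam))))

open Classical in
/-- The truncation `ψ` of `φ` to the cube `[-2πq/(σn), 2πq/(σn)]^d`. -/
def gaussTrunc {d : ℕ} (n σ q : ℕ) (lam : ℝ) (x : Fin d → ℝ) : ℝ :=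
  if ∀ j, |x j| ≤ 2 * Real.pi * q / ((σ : ℝ) * n) then gaussAnsatz n σ lam x else 0

/-- The Fourier coefficient `(2π)^{-d} ∫_{𝕋^d} g(t) e^{-i⟨k,t⟩} dt` of a `2π`-periodic function,
the torus being identified with `[0, 2π)^d`. -/
def torusCoeff {d : ℕ} (g : (Fin d → ℝ) → ℝ) (k : Fin d → ℤ) : ℂ :=
  ((2 * Real.pi : ℝ) : ℂ)⁻¹ ^ d *
    ∫ t in Set.univ.pi (fun _ : Fin d => Set.Ico (0 : ℝ) (2 * Real.pi)),
      (g t : ℂ) * Complex.exp (-(Complex.I * (dot k t : ℂ)))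

/-- The scaling coefficients `α_l`: the inverse discrete Fourier transform of size `(σn)^d` of
`β_k = ω_k / φ̃_k` for `k ∈ I_n^d`, and `β_k = 0` for `k ∈ I_{σn}^d \ I_n^d`. -/
def scalingCoeff {d : ℕ} (n σ : ℕ) (lam : ℝ) (ω : (Fin d → ℤ) → ℂ) (l : Fin d → ℤ) : ℂ :=
  (((σ : ℂ) * (n : ℂ)) ^ d)⁻¹ *
    ∑ k ∈ grid d n, ω k / torusCoeff (periodize (gaussAnsatz n σ lam)) k *
      Complex.exp (2 * Real.pi * Complex.I * (∑ j, (k j : ℂ) * (l j : ℂ)) / ((σ : ℂ) * (n : ℂ)))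

/-- The output at `t` of the `d`-dimensional NFFT with Gaussian ansatz function applied to the
trigonometric polynomial `∑_{k ∈ I_n^d} ω_k e^{i⟨k,t⟩}`, with oversampling factor `σ` and
cutoff parameter `q`: the approximant `s(t) = ∑_{l ∈ I_{σn}^d} α_l ψ̃(t - 2πl/(σn))`. -/
def nfft {d : ℕ} (n σ q : ℕ) (ω : (Fin d → ℤ) → ℂ) (t : Fin d → ℝ) : ℂ :=
  ∑ l ∈ grid d (σ * n), scalingCoeff n σ (shape σ q) ω l *
    (periodize (gaussTrunc n σ q (shape σ q))
      (fun j => t j - 2 * Real.pi / ((σ : ℝ) * n) * (l j : ℝ)) : ℂ)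

/-! ### Discrete cosine transform -/

/-- The nodes `ω_j = (2j + 1)π / (2N)`. -/
def chebNode (N j : ℕ) : ℝ := (2 * (j : ℝ) + 1) * Real.pi / (2 * N)

/-- The diagonal entries of `D_N`. -/
def dctDiag (N k : ℕ) : ℝ := if k = 0 then 1 / Real.sqrt N else Real.sqrt (2 / N)

/-- The discrete cosine transform `D_N C_N x` of a vector `x` of length `N`. -/
def dct (N : ℕ) (x : ℕ → ℂ) (k : ℕ) : ℂ :=
  (dctDiag N k : ℂ) * ∑ j ∈ Finset.range N, (Real.cos (k * chebNode N j) : ℂ) * x j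

/-- The Chebyshev coefficients of a polynomial of degree less than `N` from its values at
`cos ω_j`, obtained by the discrete cosine transform. -/
def chebCoeff (N : ℕ) (x : ℕ → ℂ) (k : ℕ) : ℂ := (dctDiag N k : ℂ) * dct N x k

/-! ### The non-lattice fast SGL Fourier transform (NFSGLFT) -/

/-- Radial samples `∑_{n = l+1}^{B} f̂_{nlm} N_{nl} R_{nl}(ρ(1 + cos ω_j)/2)`, `j < 2B`. -/
def radialSample (B : ℕ) (ρ : ℝ) (fhat : ℕ → ℕ → ℤ → ℂ) (l : ℕ) (m : ℤ) (j : ℕ) : ℂ :=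
  ∑ n ∈ Finset.Icc (l + 1) B, fhat n l m *
    ((radialNorm n l * radialPart n l (ρ / 2 * (1 + Real.cos (chebNode (2 * B) j))) : ℝ) : ℂ)

/-- From Chebyshev coefficients to the coefficients of a trigonometric polynomial on
`κ = -2B, …, 2B - 1`: `∑_κ a_κ cos(κω) = ∑_κ b_κ e^{iκω}`. -/
def cosToExp (B : ℕ) (a : ℕ → ℂ) (κ : ℤ) : ℂ :=
  if κ = 0 then a 0 else if κ.natAbs < 2 * B then a κ.natAbs / 2 else 0

/-- The same for `∑_κ a_κ sin(ω) cos(κω)`. -/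
def sinCosToExp (B : ℕ) (a : ℕ → ℂ) (κ : ℤ) : ℂ :=
  ((Int.sign κ : ℤ) : ℂ) / (4 * Complex.I) *
    (if κ = 0 then 0
     else if κ.natAbs = 1 then 2 * a 0 - a 2
     else if κ.natAbs < 2 * B - 2 then a (κ.natAbs - 1) - a (κ.natAbs + 1)
     else if κ.natAbs < 2 * B then a (κ.natAbs - 1)
     else 0)

/-- The coefficients `β_{κlm}` resulting from the radial subtransform. -/
def radialCoeff (B : ℕ) (ρ : ℝ) (fhat : ℕ → ℕ → ℤ → ℂ) (κ : ℤ) (l : ℕ) (m : ℤ) : ℂ :=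
  cosToExp B (chebCoeff (2 * B) (radialSample B ρ fhat l m)) κ

/-- The samples `h_{κ₀,m}(cos ω_j) = ∑_{l = |m|}^{B-1} β_{κ₀,l,m} Q_{lm} P_{lm}(cos ω_j)`. -/
def polarSample (B : ℕ) (ρ : ℝ) (fhat : ℕ → ℕ → ℤ → ℂ) (κ₀ m : ℤ) (j : ℕ) : ℂ :=
  ∑ l ∈ Finset.Ico m.natAbs B, radialCoeff B ρ fhat κ₀ l m *
    ((sphericalNorm l m * assocLegendre l m (Real.cos (chebNode (2 * B) j)) : ℝ) : ℂ)

/-- The coefficients `ζ_{κ₀,κ₁,m}` resulting from the spherical subtransform. For odd `m` the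
samples are weighted by `1 / sin ω_j`. -/
def polarCoeff (B : ℕ) (ρ : ℝ) (fhat : ℕ → ℕ → ℤ → ℂ) (κ₀ κ₁ m : ℤ) : ℂ :=
  if Even m then
    cosToExp B (chebCoeff (2 * B) (polarSample B ρ fhat κ₀ m)) κ₁
  else
    sinCosToExp B (chebCoeff (2 * B) fun j =>
      ((Real.sin (chebNode (2 * B) j) : ℝ) : ℂ)⁻¹ * polarSample B ρ fhat κ₀ m j) κ₁

/-- The coefficients `η_k`, `k ∈ I_{4B}^3`, handed to the three-dimensional NFFT. -/
def nfftInput (B : ℕ) (ρ : ℝ) (fhat : ℕ → ℕ → ℤ → ℂ) (k : Fin 3 → ℤ) : ℂ :=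
  if (k 2).natAbs < B then polarCoeff B ρ fhat (k 0) (k 1) (k 2) else 0

/-- The transformed point `x̃ = [arccos((2r - ρ)/ρ), ϑ, φ]`. -/
def transformedPoint (ρ : ℝ) (x : SphericalPoint) : Fin 3 → ℝ :=
  ![Real.arccos ((2 * x.r - ρ) / ρ), x.θ, x.φ]

/-- The output of the NFSGLFT at the point `x`. -/
def nfsglft (B σ q : ℕ) (ρ : ℝ) (fhat : ℕ → ℕ → ℤ → ℂ) (x : SphericalPoint) : ℂ :=
  nfft (4 * B) σ q (nfftInput B ρ fhat) (transformedPoint ρ x)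

/-- The maximum absolute error `E_∞ = max_i |f(x_i) - f̃(x_i)|` of the NFSGLFT. -/
def maxError (B σ q : ℕ) (ρ : ℝ) {M : ℕ} (x : Fin M → SphericalPoint)
    (fhat : ℕ → ℕ → ℤ → ℂ) : ℝ :=
  ⨆ i : Fin M, ‖bandlimited B fhat (x i) - nfsglft B σ q ρ fhat (x i)‖

/-! ### The constants of the error bound -/

/-- `Ω(ρ) = (e^{2/e} (ρ^{2/e} - 1) / (2 ln ρ))^{1 - 1/e} - 1/2`. -/
def Ω (ρ : ℝ) : ℝ :=
  (Real.exp (2 / Real.exp 1) * (ρ ^ (2 / Real.exp 1) - 1) / (2 * Real.log ρ)) ^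
    (1 - 1 / Real.exp 1) - 1 / 2

open Classical in
/-- `a_{ρ,B}`. -/
def aCoeff (ρ : ℝ) (B : ℕ) : ℝ := if ρ < 1 ∧ (B : ℝ) ≤ Ω ρ then 1 else ρ⁻¹

open Classical in
/-- `b_{ρ,B}`. -/
def bCoeff (ρ : ℝ) (B : ℕ) : ℝ :=
  Real.exp (2 / Real.exp 1) / 2 *
    (if ρ < 1 ∧ (B : ℝ) ≤ Ω ρ then 1 else ρ ^ (2 / Real.exp 1))

/-- `B^{7/2} a exp(b (B + 1/2)^{1 - 1/e} + ρ²/2 - qπ/2)`. -/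
def errorFactor (B q : ℕ) (ρ a b : ℝ) : ℝ :=
  (B : ℝ) ^ (7 / 2 : ℝ) * a *
    Real.exp (b * ((B : ℝ) + 1 / 2) ^ (1 - 1 / Real.exp 1) + ρ ^ 2 / 2 - q * Real.pi / 2)

end SGL

end

/-!
The error of the transform splits into an approximation error of the NFFT and the size of the
coefficients handed to it, since everything before the NFFT is exact.

*Exactness.* After the substitution `r = ρ(1 + cos ω)/2` the radial part of a basis function is a
polynomial in `cos ω` of degree below `2B`. The polar part is `sin^|m| ω` times a polynomial in
`cos ω`, hence, up to one factor `sin ω` when `m` is odd, again such a polynomial. The discrete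
cosine transform of length `2B` recovers the cosine coefficients of both, so the NFFT receives the
exact Fourier coefficients of a trigonometric polynomial with value `f(x)` at `x̃`
(`sum_nfftInput_eq_bandlimited`).

*NFFT.* The Gaussian ansatz function is a product, so the NFFT of an exponential is a product of
one-dimensional ones. In one dimension, Poisson summation turns the untruncated approximant into
`e^{ikt}` plus aliasing terms, and truncation discards a Gaussian tail. With the prescribed shape
parameter both errors are at most an absolute constant times `e^{-qπ/2}`
(`norm_exp_sub_nfftExp_le`), so the output errs by at most that factor times the 1-norm of the
coefficients (`norm_trigPoly_sub_nfft_le`).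

*Coefficients.* The coefficients of a trigonometric polynomial are bounded by its supremum, so the
`4B` radial and the `4B` polar coefficients of a basis function contribute `16 B²` times the suprema
of the two factors (`sum_norm_nfftInput_le`). The polar factor is at most `√B`, because the
normalized associated Legendre functions of degree `l` have constant square sum: a telescoping
computation with the Legendre equation shows that its derivative vanishes
(`eval_legendreSquareSum`). For the radial factor, an energy argument for the Laguerre equation
bounds `|L_k^(α)(x)| e^{-x/2}` by `O(√B)` times its value at the origin (`abs_laguerre_le`). The
remaining quotient of Gamma functions is, up to a factor `√B`, at most `X^{L/2}` with `L = l + 1` and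
`X = e² ρ² n / L²`, up to the factor `ρ⁻¹` which compensates for `ρ^L` in place of `ρ^l`. The
inequality `X ≤ exp(X^{1/e})` and the monotonicity of `L^{1 - 2/e}` turn this into
`exp(b (B + 1/2)^{1 - 1/e})` (`abs_radial_le`). If `ρ < 1`, the powers of `ρ` may simply be bounded
by one, which gives the other values of `a` and `b`. In total the power of `B` is
`B² · √B · B = B^{7/2}`, the radial factor contributing `√B · √B`.
-/

namespace SGL

/-! ### Gaussian sums over the integers -/

lemma summable_exp_neg_sq {lam : ℝ} (hl : 0 < lam) (τ : ℝ) :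
    Summable fun j : ℤ => Real.exp (-(((j : ℝ) - τ) ^ 2 / (2 * lam))) := by
  have h := (summable_jacobiTheta₂_term_iff
    (-Complex.I * (τ / (2 * Real.pi * lam) : ℝ)) (Complex.I * (1 / (2 * Real.pi * lam) : ℝ))).2 (by
      simp only [Complex.mul_im, Complex.I_re, Complex.I_im, Complex.ofReal_re, Complex.ofReal_im]
      simp only [zero_mul, one_mul, zero_add]
      positivity)
  refine (h.norm.mul_left (Real.exp (-(τ ^ 2 / (2 * lam))))).congr fun j => ?_
  rw [jacobiTheta₂_term, Complex.norm_exp, ← Real.exp_add]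
  congr 1
  have hpi := Real.pi_pos
  have e : (2 * (Real.pi : ℂ) * Complex.I * j * (-Complex.I * (τ / (2 * Real.pi * lam) : ℝ)) +
      Real.pi * Complex.I * (j : ℂ) ^ 2 * (Complex.I * (1 / (2 * Real.pi * lam) : ℝ)))
      = ((2 * Real.pi * j * (τ / (2 * Real.pi * lam))
        - Real.pi * (j : ℝ) ^ 2 * (1 / (2 * Real.pi * lam)) : ℝ) : ℂ) := by
    push_cast
    linear_combination (-2 * (Real.pi : ℂ) * j * (τ / (2 * Real.pi * lam)) +
      Real.pi * (j : ℂ) ^ 2 * (1 / (2 * Real.pi * lam))) * Complex.I_sq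
  rw [e, Complex.ofReal_re]
  field_simp
  ring

/-- Poisson summation for a modulated and shifted Gaussian. -/
lemma tsum_exp_mul_gaussian {lam : ℝ} (hl : 0 < lam) (x τ : ℝ) :
    ∑' j : ℤ, Complex.exp (2 * Real.pi * Complex.I * x * j) *
        (Real.exp (-(((j : ℝ) - τ) ^ 2 / (2 * lam))) : ℂ) =
      (Real.sqrt (2 * Real.pi * lam) : ℂ) *
        ∑' r : ℤ, (Real.exp (-(2 * Real.pi ^ 2 * lam * (x + r) ^ 2)) : ℂ) *
          Complex.exp (2 * Real.pi * Complex.I * (x + r) * τ) := by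
  have hpi := Real.pi_pos
  have hpc : (Real.pi : ℂ) ≠ 0 := by exact_mod_cast hpi.ne'
  have hlc : (lam : ℂ) ≠ 0 := by exact_mod_cast hl.ne'
  have h := Complex.tsum_exp_neg_quadratic (a := ((1 / (2 * Real.pi * lam) : ℝ) : ℂ))
    (by rw [Complex.ofReal_re]; positivity) (Complex.I * x + (τ / (2 * Real.pi * lam) : ℝ))
  have hL : ∀ j : ℤ, Complex.exp (2 * Real.pi * Complex.I * x * j) *
        (Real.exp (-(((j : ℝ) - τ) ^ 2 / (2 * lam))) : ℂ) =
      Complex.exp (-(τ ^ 2 / (2 * lam))) *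
        Complex.exp (-Real.pi * ((1 / (2 * Real.pi * lam) : ℝ) : ℂ) * (j : ℂ) ^ 2 +
          2 * Real.pi * (Complex.I * x + (τ / (2 * Real.pi * lam) : ℝ)) * j) := by
    intro j
    push_cast
    rw [← Complex.exp_add, ← Complex.exp_add]
    congr 1
    field_simp
    ring
  simp_rw [hL]
  rw [tsum_mul_left, h]
  have hs : (1 : ℂ) / ((1 / (2 * Real.pi * lam) : ℝ) : ℂ) ^ (1 / 2 : ℂ) =
      (Real.sqrt (2 * Real.pi * lam) : ℂ) := by
    rw [show (1 / 2 : ℂ) = ((1 / 2 : ℝ) : ℂ) by push_cast; rfl,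
      ← Complex.ofReal_cpow (by positivity), ← Real.sqrt_eq_rpow, Real.sqrt_div (by norm_num),
      Real.sqrt_one]
    push_cast
    rw [one_div_one_div]
  rw [hs, mul_left_comm, ← tsum_mul_left,
    ← (Equiv.neg ℤ).tsum_eq (fun r : ℤ => (Real.exp (-(2 * Real.pi ^ 2 * lam * (x + r) ^ 2)) : ℂ) *
          Complex.exp (2 * Real.pi * Complex.I * (x + r) * τ))]
  congr 2
  ext r
  simp only [Equiv.neg_apply]
  push_cast
  rw [← Complex.exp_add, ← Complex.exp_add]
  congr 1
  field_simp
  ring_nf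
  simp only [Complex.I_sq, Complex.I_pow_four, show Complex.I ^ 3 = -Complex.I by
    rw [pow_succ, Complex.I_sq]; ring]
  ring

/-- The absolute constant dominating all exponential tails in the error analysis. -/
noncomputable def tailConst : ℝ := ∑' r : ℤ, Real.exp (-(Real.pi / 6 * |(r : ℝ)|))

lemma summable_exp_neg_abs : Summable fun r : ℤ => Real.exp (-(Real.pi / 6 * |(r : ℝ)|)) := by
  have hpi := Real.pi_pos
  have h : Summable fun n : ℕ => Real.exp (-(Real.pi / 6 * (n : ℝ))) := by
    have := Real.summable_exp_nat_mul_iff (a := -(Real.pi / 6)) |>.2 (by linarith)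
    refine this.congr fun n => ?_
    congr 1; ring
  refine Summable.of_nat_of_neg ?_ ?_
  · simpa using h
  · simpa using h

lemma tailConst_nonneg : 0 ≤ tailConst := tsum_nonneg fun _ => (Real.exp_pos _).le

lemma exp_neg_abs_shift_le (τ : ℝ) (j : ℤ) :
    Real.exp (-(Real.pi / 6 * |(j : ℝ) - τ|)) ≤
      Real.exp (Real.pi / 6) * Real.exp (-(Real.pi / 6 * |((j - ⌊τ⌋ : ℤ) : ℝ)|)) := by
  rw [← Real.exp_add]
  apply Real.exp_le_exp.2
  have hpi := Real.pi_pos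
  have h1 : |((j - ⌊τ⌋ : ℤ) : ℝ)| ≤ |(j : ℝ) - τ| + 1 := by
    push_cast
    calc |(j : ℝ) - ⌊τ⌋| = |((j : ℝ) - τ) + (τ - ⌊τ⌋)| := by ring_nf
      _ ≤ |(j : ℝ) - τ| + |τ - ⌊τ⌋| := abs_add_le _ _
      _ ≤ _ := by
        gcongr
        rw [abs_le]
        constructor <;> linarith [Int.floor_le τ, Int.lt_floor_add_one τ]
  nlinarith

/-- The shifted exponential is dominated, with a total mass independent of the shift. -/
lemma hasSum_exp_neg_abs_floor (τ : ℝ) :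
    HasSum (fun j : ℤ => Real.exp (Real.pi / 6) *
      Real.exp (-(Real.pi / 6 * |((j - ⌊τ⌋ : ℤ) : ℝ)|))) (Real.exp (Real.pi / 6) * tailConst) := by
  apply HasSum.mul_left
  exact (Equiv.subRight ⌊τ⌋).hasSum_iff.2 summable_exp_neg_abs.hasSum

/-- Summation over `ℤ` by residue classes modulo `2h`, represented by `[-h, h)`. -/
lemma sum_Ico_tsum_residue {h : ℕ} (hh : 0 < h) {F : ℤ → ℂ} (hF : Summable F) :
    ∑ l ∈ Finset.Ico (-(h : ℤ)) h, ∑' z : ℤ, F (l + ((2 * h : ℕ) : ℤ) * z) = ∑' j : ℤ, F j := by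
  have : NeZero (2 * h) := ⟨by omega⟩
  let e : Fin (2 * h) × ℤ ≃ ℤ :=
    ((Equiv.prodComm _ _).trans (Int.divModEquiv (2 * h)).symm).trans (Equiv.subRight (h : ℤ))
  have he : ∀ p, e p = ((p.1 : ℕ) : ℤ) - h + ((2 * h : ℕ) : ℤ) * p.2 := by
    intro p
    have : e p = p.2 * ((2 * h : ℕ) : ℤ) + ((p.1 : ℕ) : ℤ) - h := rfl
    rw [this]; ring
  have hS : Summable fun p : Fin (2 * h) × ℤ =>
      F (((p.1 : ℕ) : ℤ) - h + ((2 * h : ℕ) : ℤ) * p.2) :=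
    (e.summable_iff.2 hF).congr fun p => congrArg F (he p)
  rw [← e.tsum_eq F, tsum_congr fun p => congrArg F (he p), hS.tsum_prod, tsum_fintype,
    Fin.sum_univ_eq_sum_range
      (fun b : ℕ => ∑' z : ℤ, F ((b : ℤ) - h + ((2 * h : ℕ) : ℤ) * z)) (2 * h)]
  refine Finset.sum_bij' (fun l _ => (l + h).toNat) (fun b _ => (b : ℤ) - h)
    (fun l hl => by rw [Finset.mem_Ico] at hl; rw [Finset.mem_range]; omega)
    (fun b hb => by rw [Finset.mem_range] at hb; rw [Finset.mem_Ico]; omega)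
    (fun l hl => by rw [Finset.mem_Ico] at hl; omega)
    (fun b _ => by omega) (fun l hl => ?_)
  rw [Finset.mem_Ico] at hl
  rw [show (((l + h).toNat : ℕ) : ℤ) - h = l by omega]

/-- A sum over `ℤ^d` of a product of nonnegative one-dimensional terms factorizes. -/
lemma hasSum_prod_fin {d : ℕ} (f : Fin d → ℤ → ℝ) (h0 : ∀ j z, 0 ≤ f j z)
    (hf : ∀ j, Summable (f j)) :
    HasSum (fun z : Fin d → ℤ => ∏ j, f j (z j)) (∏ j, ∑' z, f j z) := by
  induction d with
  | zero => simp
  | succ d ih =>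
    have ih' := ih (fun j => f j.succ) (fun j z => h0 _ _) (fun j => hf _)
    rw [← (Fin.consEquiv fun _ : Fin (d + 1) => ℤ).hasSum_iff, Fin.prod_univ_succ]
    have hs := (hf 0).mul_of_nonneg ih'.summable (fun z => h0 0 z)
      (fun z => Finset.prod_nonneg fun j _ => h0 _ _)
    have h := (hf 0).hasSum.mul ih' hs
    refine (congrArg (fun g => HasSum g _) (funext fun p => ?_)).mp h
    simp [Fin.consEquiv, Fin.prod_univ_succ]

/-! ### Fourier coefficients of the periodized Gaussian -/

/-- The one-dimensional factor of the Gaussian ansatz function, with `N = σn`. -/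
noncomputable def gaussFactor (N lam x : ℝ) : ℝ :=
  1 / Real.sqrt (2 * Real.pi * lam) * (N / (2 * Real.pi)) *
    Real.exp (-((N / (2 * Real.pi)) ^ 2 * x ^ 2 / (2 * lam)))

open Classical in
/-- The one-dimensional factor of the truncated ansatz function, with `N = σn`. -/
noncomputable def truncFactor (N : ℝ) (q : ℕ) (lam x : ℝ) : ℝ :=
  if |x| ≤ 2 * Real.pi * q / N then gaussFactor N lam x else 0

/-- The `k`-th Fourier coefficient of the periodization of `gaussFactor N lam`. -/
noncomputable def gaussCoeff (N lam : ℝ) (k : ℤ) : ℝ :=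
  (2 * Real.pi)⁻¹ * Real.exp (-(2 * Real.pi ^ 2 * lam * ((k : ℝ) / N) ^ 2))

lemma gaussFactor_nonneg {N lam : ℝ} (hN : 0 < N) (x : ℝ) : 0 ≤ gaussFactor N lam x := by
  have := Real.pi_pos
  unfold gaussFactor; positivity

lemma truncFactor_nonneg {N lam : ℝ} (hN : 0 < N) (q : ℕ) (x : ℝ) :
    0 ≤ truncFactor N q lam x := by
  unfold truncFactor; split_ifs
  exacts [gaussFactor_nonneg hN x, le_rfl]

lemma truncFactor_le {N lam : ℝ} (hN : 0 < N) (q : ℕ) (x : ℝ) :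
    truncFactor N q lam x ≤ gaussFactor N lam x := by
  unfold truncFactor; split_ifs
  exacts [le_rfl, gaussFactor_nonneg hN x]

lemma gaussCoeff_pos (N lam : ℝ) (k : ℤ) : 0 < gaussCoeff N lam k := by
  have := Real.pi_pos
  unfold gaussCoeff; positivity

/-- On a grid of step `2πs` the Gaussian factor is a Gaussian in the grid index. -/
lemma gaussFactor_grid {N lam : ℝ} {s : ℝ} (hs : s ≠ 0) (hN : N ≠ 0) (t : ℝ) (z : ℤ) :
    gaussFactor N lam (t - 2 * Real.pi * s * z) =
      1 / Real.sqrt (2 * Real.pi * lam) * (N / (2 * Real.pi)) *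
        Real.exp (-(((z : ℝ) - t / (2 * Real.pi * s)) ^ 2 / (2 * (lam / (N * s) ^ 2)))) := by
  have := Real.pi_pos.ne'
  unfold gaussFactor
  congr 3
  by_cases hl : lam = 0
  · simp [hl]
  field_simp
  ring

lemma summable_gaussFactor_grid {N lam : ℝ} (hl : 0 < lam) {s : ℝ} (hs : 0 < s) (hN : 0 < N)
    (t : ℝ) : Summable fun z : ℤ => gaussFactor N lam (t - 2 * Real.pi * s * z) := by
  simp_rw [gaussFactor_grid hs.ne' hN.ne']
  exact (summable_exp_neg_sq (by positivity) _).mul_left _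

lemma summable_gaussFactor_period {N lam : ℝ} (hl : 0 < lam) (hN : 0 < N) (t : ℝ) :
    Summable fun z : ℤ => gaussFactor N lam (t - 2 * Real.pi * z) := by
  simpa using summable_gaussFactor_grid hl one_pos hN t

lemma summable_truncFactor_period {N lam : ℝ} (hl : 0 < lam) (hN : 0 < N) (q : ℕ) (t : ℝ) :
    Summable fun z : ℤ => truncFactor N q lam (t - 2 * Real.pi * z) :=
  (summable_gaussFactor_period hl hN t).of_nonneg_of_le (fun _ => truncFactor_nonneg hN q _)
    fun _ => truncFactor_le hN q _

lemma summable_exp_neg_mul_sq_int {c : ℝ} (hc : 0 < c) (x : ℝ) :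
    Summable fun r : ℤ => Real.exp (-(c * (x + r) ^ 2)) := by
  refine (summable_exp_neg_sq (lam := 1 / (2 * c)) (by positivity) (-x)).congr fun r => ?_
  congr 2
  field_simp
  ring

/-- The Fourier series of the periodized Gaussian. -/
lemma tsum_gaussFactor_period {N lam : ℝ} (hl : 0 < lam) (hN : 0 < N) (t : ℝ) :
    ((∑' z : ℤ, gaussFactor N lam (t - 2 * Real.pi * z) : ℝ) : ℂ) =
      ∑' r : ℤ, (gaussCoeff N lam r : ℂ) * Complex.exp (Complex.I * r * t) := by
  have hpi := Real.pi_pos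
  have hpc : (Real.pi : ℂ) ≠ 0 := by exact_mod_cast hpi.ne'
  have h := tsum_exp_mul_gaussian (lam := lam / N ^ 2) (by positivity) 0 (t / (2 * Real.pi))
  simp only [Complex.ofReal_zero, mul_zero, zero_mul, Complex.exp_zero, one_mul, zero_add] at h
  have h1 : ∀ z : ℤ, gaussFactor N lam (t - 2 * Real.pi * z) =
      1 / Real.sqrt (2 * Real.pi * lam) * (N / (2 * Real.pi)) *
        Real.exp (-(((z : ℝ) - t / (2 * Real.pi)) ^ 2 / (2 * (lam / N ^ 2)))) := by
    intro z
    simpa using gaussFactor_grid (lam := lam) one_ne_zero hN.ne' t z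
  simp_rw [h1]
  rw [tsum_mul_left]
  push_cast at h ⊢
  rw [h, ← mul_assoc, ← tsum_mul_left]
  refine tsum_congr fun r => ?_
  have hs : Real.sqrt (2 * Real.pi * (lam / N ^ 2)) = Real.sqrt (2 * Real.pi * lam) / N := by
    rw [← mul_div_assoc, Real.sqrt_div (by positivity), Real.sqrt_sq hN.le]
  have hq : (Real.sqrt (2 * Real.pi * lam) : ℂ) ≠ 0 := by
    exact_mod_cast (Real.sqrt_pos.2 (by positivity)).ne'
  have hNc : (N : ℂ) ≠ 0 := by exact_mod_cast hN.ne'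
  rw [hs, gaussCoeff]
  push_cast
  rw [show 2 * (Real.pi : ℂ) * Complex.I * r * (t / (2 * Real.pi)) = Complex.I * r * t by
    field_simp, show -(2 * (Real.pi : ℂ) ^ 2 * (lam / N ^ 2) * (r : ℂ) ^ 2) =
      -(2 * (Real.pi : ℂ) ^ 2 * lam * (r / N) ^ 2) by field_simp]
  field_simp

lemma integral_exp_int (r : ℤ) :
    ∫ t in (0 : ℝ)..2 * Real.pi, Complex.exp (Complex.I * r * t) =
      if r = 0 then 2 * Real.pi else 0 := by
  split_ifs with h
  · simp [h]
  · have hc : Complex.I * r ≠ 0 := mul_ne_zero Complex.I_ne_zero (by exact_mod_cast h)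
    rw [integral_exp_mul_complex hc]
    have : Complex.exp (Complex.I * r * ((2 * Real.pi : ℝ) : ℂ)) = 1 := by
      rw [Complex.exp_eq_one_iff]
      exact ⟨r, by push_cast; ring⟩
    rw [this]; simp

lemma torus_integral_gaussFactor {N lam : ℝ} (hl : 0 < lam) (hN : 0 < N) (k : ℤ) :
    ∫ t in Set.Ico (0 : ℝ) (2 * Real.pi),
      ((∑' z : ℤ, gaussFactor N lam (t - 2 * Real.pi * z) : ℝ) : ℂ) *
        Complex.exp (-(Complex.I * k * t)) = 2 * Real.pi * gaussCoeff N lam k := by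
  have hpi := Real.pi_pos
  have hF : ∀ r : ℤ, Continuous fun t : ℝ =>
      (gaussCoeff N lam r : ℂ) * Complex.exp (Complex.I * (r - k : ℤ) * t) := fun r => by fun_prop
  have hsum : Summable fun r : ℤ => ∫ t in Set.Ico (0 : ℝ) (2 * Real.pi),
      ‖(gaussCoeff N lam r : ℂ) * Complex.exp (Complex.I * (r - k : ℤ) * t)‖ := by
    have : Summable fun r : ℤ => 2 * Real.pi * gaussCoeff N lam r := by
      have h := (summable_exp_neg_mul_sq_int (c := 2 * Real.pi ^ 2 * lam / N ^ 2) (by positivity)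
        0).mul_left (2 * Real.pi * (2 * Real.pi)⁻¹)
      refine h.congr fun r => ?_
      rw [gaussCoeff, ← mul_assoc]
      congr 3
      rw [zero_add]; ring
    refine this.congr fun r => ?_
    have hn : ∀ t : ℝ, ‖(gaussCoeff N lam r : ℂ) * Complex.exp (Complex.I * (r - k : ℤ) * t)‖ =
        gaussCoeff N lam r := by
      intro t
      rw [norm_mul, Complex.norm_real, Real.norm_of_nonneg (gaussCoeff_pos _ _ _).le,
        show Complex.I * ((r - k : ℤ) : ℂ) * t = Complex.I * (((r - k : ℤ) * t : ℝ) : ℂ) by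
          push_cast; ring, Complex.norm_exp_I_mul_ofReal, mul_one]
    simp_rw [hn]
    simp [hpi.le]
  have h := hasSum_integral_of_summable_integral_norm
    (fun r => ((hF r).integrableOn_Icc.mono_set Set.Ico_subset_Icc_self :
      IntegrableOn _ (Set.Ico (0 : ℝ) (2 * Real.pi)) volume)) hsum
  have h2 : ∀ r : ℤ, ∫ t in Set.Ico (0 : ℝ) (2 * Real.pi),
      (gaussCoeff N lam r : ℂ) * Complex.exp (Complex.I * (r - k : ℤ) * t) =
      if r = k then 2 * Real.pi * (gaussCoeff N lam k : ℂ) else 0 := by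
    intro r
    rw [integral_const_mul, integral_Ico_eq_integral_Ioc,
      ← intervalIntegral.integral_of_le (by positivity), integral_exp_int]
    by_cases hr : r = k
    · simp [hr, mul_comm]
    · simp [hr, sub_eq_zero]
  simp_rw [h2] at h
  have h3 := h.unique (hasSum_ite_eq k (2 * Real.pi * (gaussCoeff N lam k : ℂ)))
  rw [← h3]
  refine integral_congr_ae (Filter.Eventually.of_forall fun t => ?_)
  simp only
  rw [tsum_gaussFactor_period hl hN, ← tsum_mul_right]
  refine tsum_congr fun r => ?_
  rw [mul_assoc, ← Complex.exp_add]
  congr 2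
  push_cast; ring

/-! ### Factorization of the multivariate transform -/

lemma gaussAnsatz_eq_prod {d : ℕ} (n σ : ℕ) (lam : ℝ) (x : Fin d → ℝ) :
    gaussAnsatz n σ lam x = ∏ j, gaussFactor ((σ : ℝ) * n) lam (x j) := rfl

lemma gaussTrunc_eq_prod {d : ℕ} (n σ q : ℕ) (lam : ℝ) (x : Fin d → ℝ) :
    gaussTrunc n σ q lam x = ∏ j, truncFactor ((σ : ℝ) * n) q lam (x j) := by
  unfold gaussTrunc truncFactor
  split_ifs with h
  · rw [gaussAnsatz_eq_prod]
    exact Finset.prod_congr rfl fun j _ => (if_pos (h j)).symm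
  · push Not at h
    obtain ⟨j, hj⟩ := h
    exact (Finset.prod_eq_zero (Finset.mem_univ j) (if_neg (not_le.2 hj))).symm

lemma periodize_gaussAnsatz {d : ℕ} {n σ : ℕ} {lam : ℝ} (hl : 0 < lam) (hN : 0 < (σ : ℝ) * n)
    (t : Fin d → ℝ) : periodize (gaussAnsatz n σ lam) t =
      ∏ j, ∑' z : ℤ, gaussFactor ((σ : ℝ) * n) lam (t j - 2 * Real.pi * z) :=
  (hasSum_prod_fin (fun j (z : ℤ) => gaussFactor ((σ : ℝ) * n) lam (t j - 2 * Real.pi * z))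
    (fun _ _ => gaussFactor_nonneg hN _)
    (fun _ => summable_gaussFactor_period hl hN _)).tsum_eq

lemma periodize_gaussTrunc {d : ℕ} {n σ : ℕ} (q : ℕ) {lam : ℝ} (hl : 0 < lam)
    (hN : 0 < (σ : ℝ) * n) (t : Fin d → ℝ) : periodize (gaussTrunc n σ q lam) t =
      ∏ j, ∑' z : ℤ, truncFactor ((σ : ℝ) * n) q lam (t j - 2 * Real.pi * z) := by
  have h : periodize (gaussTrunc n σ q lam) t = ∑' z : Fin d → ℤ,
      ∏ j, truncFactor ((σ : ℝ) * n) q lam (t j - 2 * Real.pi * (z j)) :=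
    tsum_congr fun z => gaussTrunc_eq_prod _ _ _ _ _
  rw [h]
  exact (hasSum_prod_fin
    (fun j (z : ℤ) => truncFactor ((σ : ℝ) * n) q lam (t j - 2 * Real.pi * z))
    (fun _ _ => truncFactor_nonneg hN q _)
    (fun _ => summable_truncFactor_period hl hN q _)).tsum_eq

lemma torusCoeff_periodize_gaussAnsatz {d : ℕ} {n σ : ℕ} {lam : ℝ} (hl : 0 < lam)
    (hN : 0 < (σ : ℝ) * n) (k : Fin d → ℤ) :
    torusCoeff (periodize (gaussAnsatz n σ lam)) k =
      ∏ j, (gaussCoeff ((σ : ℝ) * n) lam (k j) : ℂ) := by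
  have hpc : (Real.pi : ℂ) ≠ 0 := by exact_mod_cast Real.pi_pos.ne'
  have h1 : ∀ t : Fin d → ℝ, (periodize (gaussAnsatz n σ lam) t : ℂ) *
      Complex.exp (-(Complex.I * (dot k t : ℂ))) =
      ∏ j, (((∑' z : ℤ, gaussFactor ((σ : ℝ) * n) lam (t j - 2 * Real.pi * z) : ℝ) : ℂ) *
        Complex.exp (-(Complex.I * k j * t j))) := by
    intro t
    rw [periodize_gaussAnsatz hl hN, Finset.prod_mul_distrib, ← Complex.exp_sum, dot]
    push_cast
    congr 2
    rw [Finset.mul_sum, ← Finset.sum_neg_distrib]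
    exact Finset.sum_congr rfl fun j _ => by ring
  unfold torusCoeff
  simp_rw [h1]
  rw [volume_pi, Measure.restrict_pi_pi, integral_fintype_prod_eq_prod
    (f := fun j (s : ℝ) =>
      (((∑' z : ℤ, gaussFactor ((σ : ℝ) * n) lam (s - 2 * Real.pi * z) : ℝ) : ℂ) *
        Complex.exp (-(Complex.I * k j * s))))]
  simp_rw [torus_integral_gaussFactor hl hN]
  rw [Finset.prod_mul_distrib]
  simp only [Finset.prod_const, Finset.card_univ, Fintype.card_fin]
  push_cast
  rw [← mul_assoc, ← mul_pow, inv_mul_cancel₀ (by simp [hpc]), one_pow, one_mul]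

/-- The output at `t` of the one-dimensional NFFT applied to `e^{ikt}`. -/
noncomputable def nfftExp (n σ q : ℕ) (k : ℤ) (t : ℝ) : ℂ :=
  ∑ l ∈ Finset.Ico (-(((σ * n : ℕ) : ℤ) / 2)) (((σ * n : ℕ) : ℤ) / 2),
    ((σ : ℂ) * n)⁻¹ * (gaussCoeff ((σ : ℝ) * n) (shape σ q) k : ℂ)⁻¹ *
      Complex.exp (2 * Real.pi * Complex.I * (k * l) / ((σ : ℂ) * n)) *
      ((∑' z : ℤ, truncFactor ((σ : ℝ) * n) q (shape σ q)
        (t - 2 * Real.pi / ((σ : ℝ) * n) * l - 2 * Real.pi * z) : ℝ) : ℂ)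

lemma shape_pos {σ q : ℕ} (hσ : 2 ≤ σ) (hq : 1 ≤ q) : 0 < shape σ q := by
  have h1 : (2 : ℝ) ≤ σ := by exact_mod_cast hσ
  have h2 : (1 : ℝ) ≤ q := by exact_mod_cast hq
  have := Real.pi_pos
  unfold shape
  have : 0 < 2 * (σ : ℝ) - 1 := by linarith
  positivity

/-- The multivariate NFFT is the linear extension of products of one-dimensional ones. -/
lemma nfft_eq_sum_prod {d n σ q : ℕ} (hn : 0 < n) (hσ : 2 ≤ σ) (hq : 1 ≤ q)
    (ω : (Fin d → ℤ) → ℂ) (t : Fin d → ℝ) :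
    nfft n σ q ω t = ∑ k ∈ grid d n, ω k * ∏ j, nfftExp n σ q (k j) (t j) := by
  have hN : 0 < (σ : ℝ) * n := by
    have : 0 < σ := by omega
    positivity
  have hl := shape_pos hσ hq
  unfold nfft scalingCoeff
  simp_rw [Finset.mul_sum, Finset.sum_mul]
  rw [Finset.sum_comm]
  refine Finset.sum_congr rfl fun k _ => ?_
  unfold nfftExp grid
  rw [Finset.prod_univ_sum, Finset.mul_sum]
  refine Finset.sum_congr rfl fun l _ => ?_
  rw [periodize_gaussTrunc q hl hN, torusCoeff_periodize_gaussAnsatz hl hN]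
  simp only [Finset.prod_mul_distrib, Finset.prod_const, Finset.card_univ, Fintype.card_fin]
  rw [← Complex.exp_sum, Finset.sum_div, inv_pow]
  push_cast
  rw [Finset.prod_inv_distrib]
  ring

/-! ### The error of the Gaussian NFFT -/

/-- The decay of the aliasing terms `r ≠ 0`, for the frequency `x = k/(σn)`. -/
lemma aliasing_exponent {σ q : ℕ} (hσ : 2 ≤ σ) (hq : 1 ≤ q) {x : ℝ}
    (hx : |x| ≤ 1 / (2 * σ)) {r : ℤ} (hr : r ≠ 0) :
    q * Real.pi / 2 + Real.pi / 6 * |(r : ℝ)| ≤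
      2 * Real.pi ^ 2 * shape σ q * ((x + r) ^ 2 - x ^ 2) := by
  have hpi := Real.pi_pos
  have h1 : (2 : ℝ) ≤ σ := by exact_mod_cast hσ
  have h2 : (1 : ℝ) ≤ q := by exact_mod_cast hq
  have h3 : 0 < 2 * (σ : ℝ) - 1 := by linarith
  have hr1 : (1 : ℝ) ≤ |(r : ℝ)| := by exact_mod_cast Int.one_le_abs hr
  have hD : 2 * Real.pi ^ 2 * shape σ q = 2 * Real.pi * q * (σ / (2 * σ - 1)) := by
    unfold shape; field_simp
  have hxr : -(|(r : ℝ)| * (1 / (2 * σ))) ≤ x * r := by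
    have := neg_abs_le (x * r)
    rw [abs_mul] at this
    nlinarith [abs_nonneg (r : ℝ)]
  have hlow : |(r : ℝ)| * (1 - 1 / σ) ≤ (x + r) ^ 2 - x ^ 2 := by
    have e : (x + r) ^ 2 - x ^ 2 = |(r : ℝ)| ^ 2 + 2 * (x * r) := by rw [sq_abs]; ring
    have e2 : (1 : ℝ) / (2 * σ) = 1 / σ / 2 := by field_simp
    rw [e2] at hxr
    rw [e]
    nlinarith
  have hfrac : (2 / 3 : ℝ) ≤ 2 * (σ / (2 * σ - 1)) * (1 - 1 / σ) := by
    have : 2 * ((σ : ℝ) / (2 * σ - 1)) * (1 - 1 / σ) = 2 * (σ - 1) / (2 * σ - 1) := by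
      field_simp
    rw [this, le_div_iff₀ h3]; linarith
  rw [hD]
  calc q * Real.pi / 2 + Real.pi / 6 * |(r : ℝ)|
      ≤ q * Real.pi * |(r : ℝ)| * (2 / 3) := by
        have a : (q : ℝ) * Real.pi ≤ q * Real.pi * |(r : ℝ)| :=
          le_mul_of_one_le_right (by positivity) hr1
        have b : Real.pi * |(r : ℝ)| ≤ q * (Real.pi * |(r : ℝ)|) :=
          le_mul_of_one_le_left (by positivity) h2
        nlinarith
    _ ≤ q * Real.pi * |(r : ℝ)| * (2 * (σ / (2 * σ - 1)) * (1 - 1 / σ)) := by gcongr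
    _ = 2 * Real.pi * q * (σ / (2 * σ - 1)) * (|(r : ℝ)| * (1 - 1 / σ)) := by ring
    _ ≤ _ := by gcongr

/-- The decay of the discarded Gaussian terms at distance `|y| ≥ q`, divided by the Fourier
coefficient of frequency `x = k/(σn)`. -/
lemma truncation_exponent {σ q : ℕ} (hσ : 2 ≤ σ) (hq : 1 ≤ q) {x y : ℝ}
    (hx : |x| ≤ 1 / (2 * σ)) (hy : (q : ℝ) ≤ |y|) :
    2 * Real.pi ^ 2 * shape σ q * x ^ 2 - y ^ 2 / (2 * shape σ q) ≤
      -(q * Real.pi / 2) - Real.pi / 6 * |y| := by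
  have hpi := Real.pi_pos
  have h1 : (2 : ℝ) ≤ σ := by exact_mod_cast hσ
  have h2 : (1 : ℝ) ≤ q := by exact_mod_cast hq
  have h3 : 0 < 2 * (σ : ℝ) - 1 := by linarith
  have hl := shape_pos hσ hq
  have hx2 : x ^ 2 ≤ (1 / (2 * σ)) ^ 2 := by
    rw [← sq_abs]; gcongr
  have a : 2 * Real.pi ^ 2 * shape σ q * x ^ 2 ≤ Real.pi * q / 12 := by
    calc _ ≤ 2 * Real.pi ^ 2 * shape σ q * (1 / (2 * σ)) ^ 2 := by gcongr
      _ = Real.pi * q * (1 / (2 * σ * (2 * σ - 1))) := by unfold shape; field_simp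
      _ ≤ Real.pi * q * (1 / 12) := by
        gcongr
        nlinarith
      _ = _ := by ring
  have b : 3 * Real.pi / 4 * |y| ≤ y ^ 2 / (2 * shape σ q) := by
    have e : (q : ℝ) / (2 * shape σ q) = Real.pi * ((2 * σ - 1) / (2 * σ)) := by
      unfold shape; field_simp
    have f : (3 / 4 : ℝ) ≤ (2 * σ - 1) / (2 * σ) := by
      rw [le_div_iff₀ (by positivity)]; linarith
    calc 3 * Real.pi / 4 * |y| = |y| * (Real.pi * (3 / 4)) := by ring
      _ ≤ |y| * (q / (2 * shape σ q)) := by rw [e]; gcongr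
      _ = |y| * q / (2 * shape σ q) := by ring
      _ ≤ |y| * |y| / (2 * shape σ q) := by gcongr
      _ = _ := by rw [abs_mul_abs_self, sq]
  nlinarith

lemma gaussFactor_sub_truncFactor {N lam : ℝ} (hN : 0 < N) (q : ℕ) (t : ℝ) (j : ℤ) :
    gaussFactor N lam (t - 2 * Real.pi / N * j) - truncFactor N q lam (t - 2 * Real.pi / N * j) =
      if (q : ℝ) < |(j : ℝ) - t * N / (2 * Real.pi)| then
        1 / Real.sqrt (2 * Real.pi * lam) * (N / (2 * Real.pi)) *
          Real.exp (-(((j : ℝ) - t * N / (2 * Real.pi)) ^ 2 / (2 * lam))) else 0 := by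
  have hpi := Real.pi_pos
  have e : |t - 2 * Real.pi / N * j| = 2 * Real.pi / N * |(j : ℝ) - t * N / (2 * Real.pi)| := by
    rw [← abs_of_pos (show 0 < 2 * Real.pi / N by positivity), ← abs_mul, ← abs_neg,
      abs_of_pos (show 0 < 2 * Real.pi / N by positivity)]
    congr 1
    field_simp
    ring
  have hiff : |t - 2 * Real.pi / N * j| ≤ 2 * Real.pi * q / N ↔
      ¬ (q : ℝ) < |(j : ℝ) - t * N / (2 * Real.pi)| := by
    rw [not_lt, e, show 2 * Real.pi * q / N = 2 * Real.pi / N * q by ring]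
    exact mul_le_mul_iff_right₀ (by positivity)
  unfold truncFactor
  by_cases h : (q : ℝ) < |(j : ℝ) - t * N / (2 * Real.pi)|
  · rw [if_neg (fun h' => hiff.1 h' h), if_pos h, sub_zero]
    have := gaussFactor_grid (lam := lam) (s := 1 / N) (by positivity) hN.ne' t j
    rw [show 2 * Real.pi / N = 2 * Real.pi * (1 / N) by ring, this,
      mul_one_div_cancel hN.ne', one_pow, div_one]
    congr 5
    field_simp
  · rw [if_pos (hiff.2 h), if_neg h, sub_self]

/-- The one-dimensional NFFT of an exponential is a sum over the whole lattice. -/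
lemma nfftExp_eq_tsum {n σ q : ℕ} (hn : 0 < n) (hn2 : Even n) (hσ : 2 ≤ σ) (hq : 1 ≤ q) (k : ℤ)
    (t : ℝ) :
    nfftExp n σ q k t = ∑' j : ℤ,
      ((σ : ℂ) * n)⁻¹ * (gaussCoeff ((σ : ℝ) * n) (shape σ q) k : ℂ)⁻¹ *
      Complex.exp (2 * Real.pi * Complex.I * (k * j) / ((σ : ℂ) * n)) *
      (truncFactor ((σ : ℝ) * n) q (shape σ q) (t - 2 * Real.pi / ((σ : ℝ) * n) * j) : ℂ) := by
  obtain ⟨h, hh⟩ : ∃ h, σ * n = 2 * h := by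
    obtain ⟨c, hc⟩ := hn2
    exact ⟨σ * c, by rw [hc]; ring⟩
  have hσ0 : 0 < σ := by omega
  have hh0 : 0 < h := by
    have := Nat.mul_pos hσ0 hn
    omega
  have hN : 0 < (σ : ℝ) * n := by positivity
  have hNc : (σ : ℂ) * n ≠ 0 := by exact_mod_cast hN.ne'
  have hl := shape_pos hσ hq
  set N : ℝ := (σ : ℝ) * n with hNdef
  have hNh : ((2 * h : ℕ) : ℝ) = N := by rw [← hh]; push_cast; rfl
  set F : ℤ → ℂ := fun j => ((σ : ℂ) * n)⁻¹ * (gaussCoeff N (shape σ q) k : ℂ)⁻¹ *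
      Complex.exp (2 * Real.pi * Complex.I * (k * j) / ((σ : ℂ) * n)) *
      (truncFactor N q (shape σ q) (t - 2 * Real.pi / N * j) : ℂ) with hF
  have hnorm : ∀ j : ℤ,
      ‖Complex.exp (2 * Real.pi * Complex.I * (k * j) / ((σ : ℂ) * n))‖ = 1 := by
    intro j
    rw [show 2 * Real.pi * Complex.I * (k * j) / ((σ : ℂ) * n) =
      Complex.I * ((2 * Real.pi * (k * j) / ((σ : ℝ) * n) : ℝ) : ℂ) by push_cast; ring]
    exact Complex.norm_exp_I_mul_ofReal _
  have hFs : Summable F := by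
    have hg := (summable_gaussFactor_grid (N := N) hl (s := 1 / N) (by positivity) hN t).mul_left
      ‖((σ : ℂ) * n)⁻¹ * (gaussCoeff N (shape σ q) k : ℂ)⁻¹‖
    refine Summable.of_norm_bounded hg fun j => ?_
    rw [hF]
    simp only
    rw [norm_mul, norm_mul _ (Complex.exp _), hnorm, mul_one, Complex.norm_real,
      Real.norm_of_nonneg (truncFactor_nonneg hN q _),
      show 2 * Real.pi * (1 / N) = 2 * Real.pi / N by ring]
    gcongr
    exact truncFactor_le hN q _
  have hhalf : (((σ * n : ℕ) : ℤ) / 2) = h := by omega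
  rw [nfftExp, hhalf, ← sum_Ico_tsum_residue hh0 hFs]
  refine Finset.sum_congr rfl fun l _ => ?_
  rw [Complex.ofReal_tsum, ← tsum_mul_left]
  refine tsum_congr fun z => ?_
  rw [hF]
  simp only
  congr 1
  · congr 1
    have : Complex.exp (2 * Real.pi * Complex.I * (k * ((l + ((2 * h : ℕ) : ℤ) * z : ℤ) : ℂ)) /
        ((σ : ℂ) * n)) = Complex.exp (2 * Real.pi * Complex.I * (k * l) / ((σ : ℂ) * n)) *
          Complex.exp (((k * z : ℤ) : ℂ) * (2 * Real.pi * Complex.I)) := by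
      rw [← Complex.exp_add, ← hh]
      congr 1
      push_cast
      field_simp
      rw [mul_div_assoc, add_div, mul_div_cancel_left₀ _ hNc]
    rw [this, Complex.exp_int_mul_two_pi_mul_I, mul_one]
  · congr 2
    have : (((l + ((2 * h : ℕ) : ℤ) * z : ℤ)) : ℝ) = l + N * z := by
      rw [← hNh]; push_cast; ring
    rw [this]
    field_simp
    ring

/-- Without truncation, the NFFT of an exponential reproduces it up to aliasing. -/
lemma tsum_gaussFactor_eq {N lam : ℝ} (hN : 0 < N) (hl : 0 < lam) (k : ℤ) (t : ℝ) :
    ∑' j : ℤ, (N : ℂ)⁻¹ * (gaussCoeff N lam k : ℂ)⁻¹ *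
      Complex.exp (2 * Real.pi * Complex.I * (k * j) / N) *
      (gaussFactor N lam (t - 2 * Real.pi / N * j) : ℂ) =
    ∑' r : ℤ, (Real.exp (-(2 * Real.pi ^ 2 * lam * (((k : ℝ) / N + r) ^ 2 - (k / N) ^ 2))) : ℂ) *
      Complex.exp (Complex.I * ((k + N * r) * t : ℝ)) := by
  have hpi := Real.pi_pos
  have hpc : (Real.pi : ℂ) ≠ 0 := by exact_mod_cast hpi.ne'
  have hNc : (N : ℂ) ≠ 0 := by exact_mod_cast hN.ne'
  have hq : (Real.sqrt (2 * Real.pi * lam) : ℂ) ≠ 0 := by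
    exact_mod_cast (Real.sqrt_pos.2 (by positivity)).ne'
  have h := tsum_exp_mul_gaussian hl (k / N) (t * N / (2 * Real.pi))
  have h1 : ∀ j : ℤ, gaussFactor N lam (t - 2 * Real.pi / N * j) =
      1 / Real.sqrt (2 * Real.pi * lam) * (N / (2 * Real.pi)) *
        Real.exp (-(((j : ℝ) - t * N / (2 * Real.pi)) ^ 2 / (2 * lam))) := by
    intro j
    have := gaussFactor_grid (lam := lam) (s := 1 / N) (by positivity) hN.ne' t j
    rw [show 2 * Real.pi / N = 2 * Real.pi * (1 / N) by ring, this,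
      mul_one_div_cancel hN.ne', one_pow, div_one]
    congr 5
    field_simp
  have h2 : ∀ j : ℤ, (N : ℂ)⁻¹ * (gaussCoeff N lam k : ℂ)⁻¹ *
      Complex.exp (2 * Real.pi * Complex.I * (k * j) / N) *
      (gaussFactor N lam (t - 2 * Real.pi / N * j) : ℂ) =
      ((Real.exp (2 * Real.pi ^ 2 * lam * (k / N) ^ 2) / Real.sqrt (2 * Real.pi * lam) : ℝ) : ℂ) *
      (Complex.exp (2 * Real.pi * Complex.I * (k / N : ℝ) * j) *
        (Real.exp (-(((j : ℝ) - t * N / (2 * Real.pi)) ^ 2 / (2 * lam))) : ℂ)) := by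
    intro j
    rw [h1, gaussCoeff, Real.exp_neg]
    push_cast
    rw [show 2 * (Real.pi : ℂ) * Complex.I * (k * j) / N =
      2 * Real.pi * Complex.I * (k / N) * j by ring]
    have := Complex.exp_ne_zero (2 * (Real.pi : ℂ) ^ 2 * lam * (k / N) ^ 2)
    field_simp
  simp_rw [h2]
  rw [tsum_mul_left, h, ← mul_assoc]
  have h3 : ((Real.exp (2 * Real.pi ^ 2 * lam * (k / N) ^ 2) / Real.sqrt (2 * Real.pi * lam) : ℝ)
      : ℂ) * (Real.sqrt (2 * Real.pi * lam) : ℂ) =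
      (Real.exp (2 * Real.pi ^ 2 * lam * (k / N) ^ 2) : ℂ) := by
    push_cast; field_simp
  rw [h3, ← tsum_mul_left]
  refine tsum_congr fun r => ?_
  rw [← mul_assoc, ← Complex.ofReal_mul, ← Real.exp_add]
  congr 1
  · congr 2
    ring
  · congr 1
    push_cast
    field_simp

/-- The one-dimensional NFFT reproduces each exponential of its bandwidth up to an absolute
multiple of `e^{-qπ/2}`. -/
lemma norm_exp_sub_nfftExp_le {n σ q : ℕ} (hn : 0 < n) (hn2 : Even n) (hσ : 2 ≤ σ) (hq : 1 ≤ q)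
    {k : ℤ} (hk : |(k : ℝ)| ≤ n / 2) (t : ℝ) :
    ‖Complex.exp (Complex.I * (k * t : ℝ)) - nfftExp n σ q k t‖ ≤
      (1 + Real.exp (Real.pi / 6)) * tailConst * Real.exp (-(q * Real.pi / 2)) := by
  have hpi := Real.pi_pos
  have hl := shape_pos hσ hq
  have hσ0 : 0 < σ := by omega
  have hn0 : (0 : ℝ) < n := by exact_mod_cast hn
  have hσr : (0 : ℝ) < σ := by exact_mod_cast hσ0
  have hN : 0 < (σ : ℝ) * n := by positivity
  rw [nfftExp_eq_tsum hn hn2 hσ hq]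
  have hNc : ((σ : ℂ) * n) = (((σ : ℝ) * n : ℝ) : ℂ) := by push_cast; rfl
  rw [hNc]
  set N : ℝ := (σ : ℝ) * n with hNdef
  set lam := shape σ q with hlam
  set τ := t * N / (2 * Real.pi) with hτ
  have hx : |(k : ℝ) / N| ≤ 1 / (2 * σ) := by
    rw [abs_div, abs_of_pos hN, div_le_div_iff₀ hN (by positivity), hNdef]
    nlinarith
  have hnorm : ∀ j : ℤ, ‖Complex.exp (2 * Real.pi * Complex.I * (k * j) / N)‖ = 1 := by
    intro j
    rw [show 2 * Real.pi * Complex.I * (k * j) / N =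
      Complex.I * ((2 * Real.pi * (k * j) / N : ℝ) : ℂ) by push_cast; ring]
    exact Complex.norm_exp_I_mul_ofReal _
  -- the aliasing error
  have hA : ‖(∑' r : ℤ, (Real.exp (-(2 * Real.pi ^ 2 * lam *
      (((k : ℝ) / N + r) ^ 2 - (k / N) ^ 2))) : ℂ) *
      Complex.exp (Complex.I * ((k + N * r) * t : ℝ))) - Complex.exp (Complex.I * (k * t : ℝ))‖ ≤
      Real.exp (-(q * Real.pi / 2)) * tailConst := by
    have hb : ∀ r : ℤ, r ≠ 0 → ‖(Real.exp (-(2 * Real.pi ^ 2 * lam *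
      (((k : ℝ) / N + r) ^ 2 - (k / N) ^ 2))) : ℂ) *
      Complex.exp (Complex.I * ((k + N * r) * t : ℝ))‖ ≤
      Real.exp (-(q * Real.pi / 2)) * Real.exp (-(Real.pi / 6 * |(r : ℝ)|)) := by
      intro r hr
      rw [norm_mul, Complex.norm_exp_I_mul_ofReal, mul_one, Complex.norm_real,
        Real.norm_of_nonneg (Real.exp_pos _).le, ← Real.exp_add]
      apply Real.exp_le_exp.2
      have := aliasing_exponent hσ hq hx hr
      linarith
    have hs : Summable fun r : ℤ => (Real.exp (-(2 * Real.pi ^ 2 * lam *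
      (((k : ℝ) / N + r) ^ 2 - (k / N) ^ 2))) : ℂ) *
      Complex.exp (Complex.I * ((k + N * r) * t : ℝ)) := by
      refine Summable.of_norm_bounded_eventually
        (summable_exp_neg_abs.mul_left (Real.exp (-(q * Real.pi / 2)))) ?_
      rw [Filter.eventually_cofinite]
      refine (Set.finite_singleton (0 : ℤ)).subset fun r hr => ?_
      by_contra h0
      exact hr (hb r h0)
    rw [hs.tsum_eq_add_tsum_ite 0]
    have h0 : (Real.exp (-(2 * Real.pi ^ 2 * lam *
      (((k : ℝ) / N + (0 : ℤ)) ^ 2 - (k / N) ^ 2))) : ℂ) *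
      Complex.exp (Complex.I * ((k + N * (0 : ℤ)) * t : ℝ)) =
      Complex.exp (Complex.I * (k * t : ℝ)) := by simp
    rw [h0, add_sub_cancel_left]
    refine tsum_of_norm_bounded (summable_exp_neg_abs.hasSum.mul_left _) fun r => ?_
    split_ifs with h
    · rw [norm_zero]; positivity
    · exact hb r h
  rw [← tsum_gaussFactor_eq hN hl] at hA
  -- the truncation error
  have hpre : ∀ j : ℤ, ‖(N : ℂ)⁻¹ * (gaussCoeff N lam k : ℂ)⁻¹ *
      Complex.exp (2 * Real.pi * Complex.I * (k * j) / N)‖ = N⁻¹ * (gaussCoeff N lam k)⁻¹ := by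
    intro j
    rw [norm_mul, hnorm, mul_one, norm_mul, norm_inv, norm_inv, Complex.norm_real,
      Complex.norm_real, Real.norm_of_nonneg hN.le, Real.norm_of_nonneg (gaussCoeff_pos _ _ _).le]
  have hgs := (summable_gaussFactor_grid (N := N) hl (s := 1 / N) (by positivity) hN t).mul_left
      (N⁻¹ * (gaussCoeff N lam k)⁻¹)
  simp_rw [show 2 * Real.pi * (1 / N) = 2 * Real.pi / N by ring] at hgs
  have hG : Summable fun j : ℤ => (N : ℂ)⁻¹ * (gaussCoeff N lam k : ℂ)⁻¹ *
      Complex.exp (2 * Real.pi * Complex.I * (k * j) / N) *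
      (gaussFactor N lam (t - 2 * Real.pi / N * j) : ℂ) := by
    refine Summable.of_norm_bounded hgs fun j => ?_
    rw [norm_mul, hpre, Complex.norm_real, Real.norm_of_nonneg (gaussFactor_nonneg hN _)]
  have hT : Summable fun j : ℤ => (N : ℂ)⁻¹ * (gaussCoeff N lam k : ℂ)⁻¹ *
      Complex.exp (2 * Real.pi * Complex.I * (k * j) / N) *
      (truncFactor N q lam (t - 2 * Real.pi / N * j) : ℂ) := by
    refine Summable.of_norm_bounded hgs fun j => ?_
    rw [norm_mul, hpre, Complex.norm_real, Real.norm_of_nonneg (truncFactor_nonneg hN q _)]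
    have := gaussCoeff_pos N lam k
    gcongr
    exact truncFactor_le hN q _
  have hB : ‖(∑' j : ℤ, (N : ℂ)⁻¹ * (gaussCoeff N lam k : ℂ)⁻¹ *
      Complex.exp (2 * Real.pi * Complex.I * (k * j) / N) *
      (gaussFactor N lam (t - 2 * Real.pi / N * j) : ℂ)) -
      ∑' j : ℤ, (N : ℂ)⁻¹ * (gaussCoeff N lam k : ℂ)⁻¹ *
      Complex.exp (2 * Real.pi * Complex.I * (k * j) / N) *
      (truncFactor N q lam (t - 2 * Real.pi / N * j) : ℂ)‖ ≤
      Real.exp (-(q * Real.pi / 2)) * (Real.exp (Real.pi / 6) * tailConst) := by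
    rw [← hG.tsum_sub hT]
    refine tsum_of_norm_bounded ((hasSum_exp_neg_abs_floor τ).mul_left _) fun j => ?_
    rw [← mul_sub, norm_mul, hpre, ← Complex.ofReal_sub, Complex.norm_real,
      gaussFactor_sub_truncFactor hN]
    refine le_trans ?_ (mul_le_mul_of_nonneg_left (exp_neg_abs_shift_le τ j) (Real.exp_pos _).le)
    split_ifs with h
    · have hc : (gaussCoeff N lam k)⁻¹ =
          2 * Real.pi * Real.exp (2 * Real.pi ^ 2 * lam * (k / N) ^ 2) := by
        rw [gaussCoeff, mul_inv, inv_inv, Real.exp_neg, inv_inv]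
      rw [Real.norm_of_nonneg (by positivity), hc, ← Real.exp_add]
      have hs1 : 1 ≤ Real.sqrt (2 * Real.pi * lam) := by
        rw [Real.one_le_sqrt, hlam, shape]
        have h1 : (2 : ℝ) ≤ σ := by exact_mod_cast hσ
        have h2 : (1 : ℝ) ≤ q := by exact_mod_cast hq
        have h3 : 0 < 2 * (σ : ℝ) - 1 := by linarith
        rw [show 2 * Real.pi * ((σ : ℝ) * q / ((2 * σ - 1) * Real.pi)) =
          2 * σ * q / (2 * σ - 1) by field_simp, one_le_div h3]
        nlinarith
      have := truncation_exponent hσ hq hx h.le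
      calc _ = 1 / Real.sqrt (2 * Real.pi * lam) * (Real.exp (2 * Real.pi ^ 2 * lam * (k / N) ^ 2) *
          Real.exp (-((j - τ) ^ 2 / (2 * lam)))) := by
            rw [← hτ]; field_simp
        _ ≤ 1 * (Real.exp (2 * Real.pi ^ 2 * lam * (k / N) ^ 2) *
          Real.exp (-((j - τ) ^ 2 / (2 * lam)))) := by
            gcongr
            rw [div_le_one (by positivity)]; exact hs1
        _ ≤ _ := by
          rw [one_mul, ← Real.exp_add]
          apply Real.exp_le_exp.2
          linarith
    · rw [norm_zero, mul_zero]; positivity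
  calc _ ≤ _ := norm_sub_le_norm_sub_add_norm_sub _ _ _
    _ ≤ Real.exp (-(q * Real.pi / 2)) * tailConst +
        Real.exp (-(q * Real.pi / 2)) * (Real.exp (Real.pi / 6) * tailConst) := by
      refine add_le_add ?_ hB
      rw [norm_sub_rev]; exact hA
    _ = _ := by ring

lemma norm_prod_sub_prod_le {d : ℕ} {δ : ℝ} (a b : Fin d → ℂ) (ha : ∀ j, ‖a j‖ = 1)
    (hab : ∀ j, ‖a j - b j‖ ≤ δ) : ‖∏ j, a j - ∏ j, b j‖ ≤ (1 + δ) ^ d - 1 := by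
  induction d with
  | zero => simp
  | succ d ih =>
    have hδ : 0 ≤ δ := (norm_nonneg _).trans (hab 0)
    have ih' := ih (fun j => a j.succ) (fun j => b j.succ) (fun j => ha _) (fun j => hab _)
    have hA : ‖∏ j : Fin d, a j.succ‖ = 1 := by
      rw [norm_prod]; exact Finset.prod_eq_one fun j _ => ha _
    have hb : ‖b 0‖ ≤ 1 + δ := by
      calc ‖b 0‖ = ‖a 0 - (a 0 - b 0)‖ := by ring_nf
        _ ≤ ‖a 0‖ + ‖a 0 - b 0‖ := norm_sub_le _ _
        _ ≤ 1 + δ := by rw [ha]; gcongr; exact hab 0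
    rw [Fin.prod_univ_succ, Fin.prod_univ_succ,
      show a 0 * ∏ j : Fin d, a j.succ - b 0 * ∏ j : Fin d, b j.succ =
        (a 0 - b 0) * ∏ j : Fin d, a j.succ +
          b 0 * (∏ j : Fin d, a j.succ - ∏ j : Fin d, b j.succ) by ring]
    calc _ ≤ ‖a 0 - b 0‖ * ‖∏ j : Fin d, a j.succ‖ +
          ‖b 0‖ * ‖∏ j : Fin d, a j.succ - ∏ j : Fin d, b j.succ‖ := by
          rw [← norm_mul, ← norm_mul]; exact norm_add_le _ _
      _ ≤ δ * 1 + (1 + δ) * ((1 + δ) ^ d - 1) := by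
          rw [hA]
          gcongr
          exact hab 0
      _ = _ := by ring

/-- The absolute constant of the three-dimensional NFFT error estimate. -/
noncomputable def nfftConst : ℝ := (1 + (1 + Real.exp (Real.pi / 6)) * tailConst) ^ 3

lemma nfftConst_pos : 0 < nfftConst := by
  have := tailConst_nonneg
  unfold nfftConst; positivity

/-- The three-dimensional NFFT evaluates a trigonometric polynomial up to an absolute multiple of
`e^{-qπ/2}` times the 1-norm of its coefficients. -/
lemma norm_trigPoly_sub_nfft_le {n σ q : ℕ} (hn : 0 < n) (hn2 : Even n) (hσ : 2 ≤ σ) (hq : 1 ≤ q)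
    (ω : (Fin 3 → ℤ) → ℂ) (t : Fin 3 → ℝ) :
    ‖∑ k ∈ grid 3 n, ω k * ∏ j, Complex.exp (Complex.I * (k j * t j : ℝ)) - nfft n σ q ω t‖ ≤
      nfftConst * Real.exp (-(q * Real.pi / 2)) * ∑ k ∈ grid 3 n, ‖ω k‖ := by
  rw [nfft_eq_sum_prod hn hσ hq, ← Finset.sum_sub_distrib, Finset.mul_sum]
  refine (norm_sum_le _ _).trans (Finset.sum_le_sum fun k hk => ?_)
  rw [← mul_sub, norm_mul, mul_comm]
  refine mul_le_mul_of_nonneg_right ?_ (norm_nonneg _)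
  set K := (1 + Real.exp (Real.pi / 6)) * tailConst with hK
  set y := Real.exp (-(q * Real.pi / 2)) with hy
  have hK0 : 0 ≤ K := by have := tailConst_nonneg; positivity
  have hy0 : 0 < y := Real.exp_pos _
  have hy1 : y ≤ 1 := by
    rw [hy, Real.exp_le_one_iff]
    have := Real.pi_pos
    have : 0 ≤ q * Real.pi / 2 := by positivity
    linarith
  have h := norm_prod_sub_prod_le (δ := K * y)
    (fun j => Complex.exp (Complex.I * (k j * t j : ℝ))) (fun j => nfftExp n σ q (k j) (t j))
    (fun j => Complex.norm_exp_I_mul_ofReal _) (fun j => norm_exp_sub_nfftExp_le hn hn2 hσ hq ?_ _)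
  · refine h.trans ?_
    unfold nfftConst
    have h2 : y ^ 2 ≤ y := by nlinarith
    have h3 : y ^ 3 ≤ y := by nlinarith
    have e1 : K ^ 2 * y ^ 2 ≤ K ^ 2 * y := by gcongr
    have e2 : K ^ 3 * y ^ 3 ≤ K ^ 3 * y := by gcongr
    nlinarith
  · have hkj := (Fintype.mem_piFinset.1 hk) j
    rw [Finset.mem_Ico] at hkj
    obtain ⟨c, hc⟩ := hn2
    have h1 : |k j| ≤ (c : ℤ) := by rw [abs_le]; omega
    have h2 : |(k j : ℝ)| ≤ c := by exact_mod_cast h1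
    rw [hc]; push_cast; linarith

/-! ### A uniform bound for Laguerre polynomials -/

/-- A bound for the decaying solution of `x u'' + (α + 1) u' + (κ - x/4) u = 0`. The energy
`x u'² + (κ - x/4) u²` is nonincreasing. It controls `u` where `κ - x/4 ≥ 1/4`, and `u'` on the
remaining interval of length one before the turning point `4κ`, past which `u²` is nonincreasing. -/
lemma abs_le_of_laguerre_ode {u v w : ℝ → ℝ} {α κ : ℝ} (hα : 0 ≤ α) (hκ : 1 / 3 ≤ κ)
    (hu : ∀ x, HasDerivAt u (v x) x) (hv : ∀ x, HasDerivAt v (w x) x)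
    (hode : ∀ x, x * w x + (α + 1) * v x + (κ - x / 4) * u x = 0)
    (hlim : Filter.Tendsto (fun x => x ^ (α + 1) * (u x * v x)) Filter.atTop (nhds 0))
    {x : ℝ} (hx : 0 ≤ x) : |u x| ≤ (2 * Real.sqrt κ + 1) * |u 0| := by
  have hκ0 : 0 ≤ κ := by linarith
  have hE : Antitone fun x => x * v x ^ 2 + (κ - x / 4) * u x ^ 2 := by
    refine antitone_of_hasDerivAt_nonpos
      (f' := fun x => -(2 * α + 1) * v x ^ 2 - u x ^ 2 / 4) (fun x => ?_) (fun x => ?_)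
    · have h := ((hasDerivAt_id x).mul ((hv x).pow 2)).add
        ((((hasDerivAt_id x).div_const 4).const_sub κ).mul ((hu x).pow 2))
      refine h.congr_deriv ?_
      simp only [id, Nat.cast_ofNat, Nat.add_one_sub_one, pow_one, Pi.pow_apply]
      linear_combination 2 * v x * hode x
    · have := sq_nonneg (v x)
      have := sq_nonneg (u x)
      simp only [Pi.zero_apply]
      nlinarith
  have hE0 : ∀ x, 0 ≤ x → x * v x ^ 2 + (κ - x / 4) * u x ^ 2 ≤ κ * u 0 ^ 2 := fun x hx => by
    simpa using hE hx
  have h1 : ∀ x, 0 ≤ x → x ≤ 4 * κ - 1 → |u x| ≤ 2 * Real.sqrt κ * |u 0| := by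
    intro x hx hx1
    refine abs_le_of_sq_le_sq' ?_ (by positivity) |> abs_le.2
    rw [mul_pow, mul_pow, Real.sq_sqrt hκ0, sq_abs]
    have := hE0 x hx
    nlinarith [mul_nonneg hx (sq_nonneg (v x)), sq_nonneg (u x)]
  have h2 : ∀ x, 4 * κ - 1 ≤ x → x ≤ 4 * κ → |u x| ≤ (2 * Real.sqrt κ + 1) * |u 0| := by
    intro x hxl hxr
    have hb : ∀ y ∈ Set.Icc (4 * κ - 1) (4 * κ), ‖v y‖ ≤ |u 0| := by
      intro y hy
      rw [Real.norm_eq_abs]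
      refine sq_le_sq.1 ?_
      have := hE0 y (by linarith [hy.1])
      have hyk : κ ≤ y := by linarith [hy.1]
      have h3 : 0 ≤ (κ - y / 4) * u y ^ 2 := mul_nonneg (by linarith [hy.2]) (sq_nonneg _)
      have h4 : κ * v y ^ 2 ≤ κ * u 0 ^ 2 := by nlinarith [sq_nonneg (v y)]
      exact le_of_mul_le_mul_left h4 (by linarith)
    have h := (convex_Icc (4 * κ - 1) (4 * κ)).norm_image_sub_le_of_norm_hasDerivWithin_le
      (fun y _ => (hu y).hasDerivWithinAt) hb (x := 4 * κ - 1) (y := x)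
      ⟨le_rfl, by linarith⟩ ⟨hxl, hxr⟩
    have h5 := h1 (4 * κ - 1) (by linarith) le_rfl
    have h6 : ‖x - (4 * κ - 1)‖ ≤ 1 := by
      rw [Real.norm_eq_abs, abs_le]; constructor <;> linarith
    calc |u x| = |u (4 * κ - 1) + (u x - u (4 * κ - 1))| := by ring_nf
      _ ≤ |u (4 * κ - 1)| + |u x - u (4 * κ - 1)| := abs_add_le _ _
      _ ≤ 2 * Real.sqrt κ * |u 0| + |u 0| * 1 := by
        refine add_le_add h5 (h.trans ?_)
        gcongr
      _ = _ := by ring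
  rcases le_total x (4 * κ) with hx4 | hx4
  · rcases le_total x (4 * κ - 1) with hx3 | hx3
    · refine (h1 x hx hx3).trans ?_
      gcongr
      linarith
    · exact h2 x hx3 hx4
  -- past the turning point, `x^{α+1} u u'` increases to its limit zero
  have hpos : ∀ y ∈ Set.Ici (4 * κ), 0 < y := fun y hy => by
    have : 4 * κ ≤ y := hy
    linarith
  have hGd : ∀ y ∈ Set.Ici (4 * κ), HasDerivAt (fun x => x ^ (α + 1) * (u x * v x))
      (y ^ α * (y * v y ^ 2 - (κ - y / 4) * u y ^ 2)) y := by
    intro y hy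
    have h := (Real.hasDerivAt_rpow_const (x := y) (p := α + 1)
      (Or.inl (hpos y hy).ne')).mul ((hu y).mul (hv y))
    refine h.congr_deriv ?_
    rw [add_sub_cancel_right, Real.rpow_add_one (hpos y hy).ne', Pi.mul_apply]
    linear_combination y ^ α * u y * hode y
  have hG : MonotoneOn (fun x => x ^ (α + 1) * (u x * v x)) (Set.Ici (4 * κ)) := by
    refine monotoneOn_of_hasDerivWithinAt_nonneg (convex_Ici _)
      (fun y hy => (hGd y hy).continuousAt.continuousWithinAt)
      (fun y hy => (hGd y (interior_subset hy)).hasDerivWithinAt) (fun y hy => ?_)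
    have hy' : 4 * κ ≤ y := interior_subset hy
    have hy0 := hpos y hy'
    have h3 : 0 ≤ (y / 4 - κ) * u y ^ 2 := mul_nonneg (by linarith) (sq_nonneg _)
    have h4 : 0 ≤ y * v y ^ 2 := by positivity
    exact mul_nonneg (Real.rpow_nonneg hy0.le _) (by linarith)
  have huv : ∀ y ∈ Set.Ici (4 * κ), u y * v y ≤ 0 := by
    intro y hy
    have h : y ^ (α + 1) * (u y * v y) ≤ 0 := by
      refine ge_of_tendsto hlim ?_
      filter_upwards [Filter.eventually_ge_atTop y] with z hz
      exact hG hy (le_trans (Set.mem_Ici.1 hy) hz) hz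
    have h0 := Real.rpow_pos_of_pos (hpos y hy) (α + 1)
    by_contra hc
    push Not at hc
    exact absurd h (not_le.2 (mul_pos h0 hc))
  have hanti : AntitoneOn (fun x => u x ^ 2) (Set.Ici (4 * κ)) := by
    refine antitoneOn_of_hasDerivWithinAt_nonpos (f' := fun y => 2 * (u y * v y)) (convex_Ici _)
      (fun y _ => ((hu y).pow 2).continuousAt.continuousWithinAt)
      (fun y _ => ?_) (fun y hy => ?_)
    · refine (((hu y).pow 2).congr_deriv ?_).hasDerivWithinAt
      simp; ring
    · have := huv y (interior_subset hy)
      linarith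
  have h7 := hanti (Set.mem_Ici.2 le_rfl) hx4 hx4
  exact (sq_le_sq.1 h7).trans (h2 (4 * κ) (by linarith) le_rfl)

open Polynomial in
/-- The generalized Laguerre polynomial as an element of `ℝ[X]`. -/
noncomputable def laguerrePoly (k : ℕ) (α : ℝ) : ℝ[X] :=
  ∑ i ∈ Finset.range (k + 1), C ((-1) ^ i * Real.Gamma (k + α + 1) /
    (Real.Gamma (α + i + 1) * (Nat.factorial (k - i) : ℝ) * (Nat.factorial i : ℝ))) * X ^ i

lemma eval_laguerrePoly (k : ℕ) (α x : ℝ) : (laguerrePoly k α).eval x = laguerre k α x := by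
  unfold laguerrePoly laguerre
  rw [Polynomial.eval_finsetSum]
  refine Finset.sum_congr rfl fun i _ => ?_
  simp only [Polynomial.eval_mul, Polynomial.eval_C, Polynomial.eval_pow, Polynomial.eval_X]
  rw [neg_pow x]
  ring

lemma natDegree_laguerrePoly_le (k : ℕ) (α : ℝ) : (laguerrePoly k α).natDegree ≤ k := by
  refine Polynomial.natDegree_sum_le_of_forall_le _ _ fun i hi => ?_
  refine (Polynomial.natDegree_C_mul_X_pow_le _ _).trans ?_
  rw [Finset.mem_range] at hi; omega

lemma coeff_laguerrePoly (k : ℕ) (α : ℝ) (i : ℕ) : (laguerrePoly k α).coeff i =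
    if i ≤ k then (-1) ^ i * Real.Gamma (k + α + 1) /
      (Real.Gamma (α + i + 1) * (Nat.factorial (k - i) : ℝ) * (Nat.factorial i : ℝ)) else 0 := by
  unfold laguerrePoly
  rw [Polynomial.finsetSum_coeff]
  simp only [Polynomial.coeff_C_mul_X_pow]
  rw [Finset.sum_ite_eq]
  simp

open Polynomial in
lemma laguerrePoly_ode (k : ℕ) {α : ℝ} (hα : 0 ≤ α) :
    X * derivative (derivative (laguerrePoly k α)) +
      (C (α + 1) - X) * derivative (laguerrePoly k α) + C (k : ℝ) * laguerrePoly k α = 0 := by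
  have hrec : ∀ i : ℕ, ((i : ℝ) + 1) * (i + α + 1) * (laguerrePoly k α).coeff (i + 1) =
      ((i : ℝ) - k) * (laguerrePoly k α).coeff i := by
    intro i
    rw [coeff_laguerrePoly, coeff_laguerrePoly]
    rcases lt_trichotomy i k with h | h | h
    · rw [if_pos (by omega), if_pos (by omega)]
      obtain ⟨j, hj⟩ : ∃ j, k = i + 1 + j := ⟨k - (i + 1), by omega⟩
      have h1 : k - i = j + 1 := by omega
      have h2 : k - (i + 1) = j := by omega
      have hg : α + ((i + 1 : ℕ) : ℝ) + 1 = (α + i + 1) + 1 := by push_cast; ring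
      have hp : 0 < α + i + 1 := by positivity
      have hG := Real.Gamma_pos_of_pos hp
      rw [h1, h2, hg, Real.Gamma_add_one hp.ne', Nat.factorial_succ, Nat.factorial_succ, hj]
      have := Nat.factorial_pos i
      have := Nat.factorial_pos j
      push_cast
      field_simp
      ring
    · subst h
      simp
    · rw [if_neg (by omega), if_neg (by omega)]; simp
  ext i
  have h := hrec i
  rw [sub_mul, coeff_add, coeff_add, coeff_sub, coeff_C_mul, coeff_C_mul, coeff_zero]
  cases i with
  | zero =>
    simp only [coeff_derivative, coeff_X_mul_zero]
    simp at h ⊢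
    linarith
  | succ i =>
    simp only [coeff_derivative, coeff_X_mul]
    push_cast at h ⊢
    linarith

/-- The bound `|L_k^(α)(x)| ≤ (2√κ + 1) L_k^(α)(0) e^{x/2}` with `κ = k + (α + 1)/2`. -/
lemma abs_laguerre_le (k : ℕ) {α : ℝ} (hα : 0 ≤ α) {x : ℝ} (hx : 0 ≤ x) :
    |laguerre k α x| ≤ (2 * Real.sqrt (k + (α + 1) / 2) + 1) *
      (Real.Gamma (k + α + 1) / (Real.Gamma (α + 1) * (Nat.factorial k : ℝ))) *
        Real.exp (x / 2) := by
  set p := laguerrePoly k α with hp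
  have hd : ∀ (P : Polynomial ℝ) (x : ℝ), HasDerivAt (fun x => Real.exp (-x / 2) * P.eval x)
      (Real.exp (-x / 2) * (Polynomial.derivative P - Polynomial.C (1 / 2) * P).eval x) x := by
    intro P x
    have h := ((((hasDerivAt_id x).neg).div_const 2).exp).mul (P.hasDerivAt x)
    refine h.congr_deriv ?_
    simp
    ring
  set p1 := Polynomial.derivative p - Polynomial.C (1 / 2) * p with hp1
  have h := abs_le_of_laguerre_ode (α := α) (κ := k + (α + 1) / 2) hα
    (by have : (0 : ℝ) ≤ k := k.cast_nonneg
        linarith) (hd p) (hd p1) (fun x => ?_) ?_ hx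
  · have h0 : laguerre k α 0 =
        Real.Gamma (k + α + 1) / (Real.Gamma (α + 1) * (Nat.factorial k : ℝ)) := by
      rw [← eval_laguerrePoly, ← Polynomial.coeff_zero_eq_eval_zero, coeff_laguerrePoly]
      simp
    have hk0 : 0 ≤ (k : ℝ) + α := by positivity
    have hg1 := Real.Gamma_pos_of_pos (show 0 < (k : ℝ) + α + 1 by linarith)
    have hg2 := Real.Gamma_pos_of_pos (show 0 < α + 1 by linarith)
    rw [hp, eval_laguerrePoly, eval_laguerrePoly, h0, abs_mul, abs_mul,
      abs_of_pos (Real.exp_pos _), neg_zero, zero_div, Real.exp_zero, abs_one, one_mul,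
      abs_of_nonneg (a := Real.Gamma _ / _) (by positivity), neg_div, Real.exp_neg,
      inv_mul_le_iff₀ (Real.exp_pos _)] at h
    linarith
  · have e := congrArg (Polynomial.eval x) (laguerrePoly_ode k hα)
    simp only [hp1, Polynomial.derivative_sub, Polynomial.derivative_mul, Polynomial.derivative_C,
      Polynomial.eval_add, Polynomial.eval_sub, Polynomial.eval_mul, Polynomial.eval_C,
      Polynomial.eval_X, Polynomial.eval_zero] at e ⊢
    linear_combination Real.exp (-x / 2) * e
  · obtain ⟨m, hm⟩ := exists_nat_ge (α + 1)
    have ht := (Polynomial.X ^ m * (p * p1)).tendsto_div_exp_atTop.abs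
    rw [abs_zero] at ht
    refine squeeze_zero_norm' ?_ ht
    filter_upwards [Filter.eventually_ge_atTop 1] with y hy
    have e : Real.exp (-y / 2) * Real.exp (-y / 2) = (Real.exp y)⁻¹ := by
      rw [← Real.exp_add, ← Real.exp_neg]; ring_nf
    have e2 : Real.exp (-y / 2) * p.eval y * (Real.exp (-y / 2) * p1.eval y) =
        (p * p1).eval y / Real.exp y := by
      rw [Polynomial.eval_mul, div_eq_mul_inv (_ * _), ← e]; ring
    rw [e2, Real.norm_eq_abs, Polynomial.eval_mul (p := Polynomial.X ^ m), Polynomial.eval_pow,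
      Polynomial.eval_X, mul_div_assoc, abs_mul, abs_mul]
    have hy0 : 0 ≤ y := by linarith
    rw [abs_of_nonneg (Real.rpow_nonneg hy0 _), abs_of_nonneg (pow_nonneg hy0 m)]
    gcongr
    rw [← Real.rpow_natCast]
    exact Real.rpow_le_rpow_of_exponent_le hy hm

/-! ### The radial part -/

/-- Log-convexity of the Gamma function at half-integer steps. -/
lemma sq_Gamma_add_half_le {x : ℝ} (hx : 0 < x) :
    Real.Gamma (x + 1 / 2) ^ 2 ≤ Real.Gamma x * Real.Gamma (x + 1) := by
  have h := Real.Gamma_mul_add_mul_le_rpow_Gamma_mul_rpow_Gamma (s := x) (t := x + 1) (a := 1 / 2)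
    (b := 1 / 2) hx (by linarith) (by norm_num) (by norm_num) (by norm_num)
  have h0 := Real.Gamma_pos_of_pos hx
  have h1 := Real.Gamma_pos_of_pos (show 0 < x + 1 by linarith)
  have h2 := Real.Gamma_pos_of_pos (show 0 < x + 1 / 2 by linarith)
  rw [show 1 / 2 * x + 1 / 2 * (x + 1) = x + 1 / 2 by ring, ← Real.sqrt_eq_rpow,
    ← Real.sqrt_eq_rpow] at h
  calc Real.Gamma (x + 1 / 2) ^ 2 ≤ (Real.sqrt (Real.Gamma x) * Real.sqrt (Real.Gamma (x + 1))) ^ 2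
        := by gcongr
    _ = _ := by rw [mul_pow, Real.sq_sqrt h0.le, Real.sq_sqrt h1.le]

lemma Gamma_nat_add_half_le {n : ℕ} (hn : 1 ≤ n) :
    Real.Gamma ((n : ℝ) + 1 / 2) ≤ (Nat.factorial n : ℝ) := by
  have hn0 : (1 : ℝ) ≤ n := by exact_mod_cast hn
  have h := sq_Gamma_add_half_le (x := n) (by linarith)
  have h1 := Real.Gamma_pos_of_pos (show (0 : ℝ) < n by linarith)
  have h2 : Real.Gamma ((n : ℝ) + 1) = n * Real.Gamma n := Real.Gamma_add_one (by linarith)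
  rw [← Real.Gamma_nat_eq_factorial]
  refine (le_abs_self _).trans (abs_le_of_sq_le_sq ?_ (by rw [h2]; positivity))
  refine h.trans ?_
  rw [sq]
  refine mul_le_mul_of_nonneg_right ?_ (by rw [h2]; positivity)
  rw [h2]
  exact le_mul_of_one_le_left h1.le hn0

lemma sq_factorial_le_Gamma (L : ℕ) :
    (Nat.factorial L : ℝ) ^ 2 ≤ ((L : ℝ) + 1 / 2) * Real.Gamma ((L : ℝ) + 1 / 2) ^ 2 := by
  have hL : (0 : ℝ) < (L : ℝ) + 1 / 2 := by positivity
  have h := sq_Gamma_add_half_le hL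
  rw [Real.Gamma_add_one hL.ne', show (L : ℝ) + 1 / 2 + 1 / 2 = L + 1 by ring,
    Real.Gamma_nat_eq_factorial] at h
  linarith

/-- `X ≤ exp (X^{1/e})`, the inequality producing the exponents of the error bound. -/
lemma le_exp_rpow_inv_exp {X : ℝ} (hX : 0 ≤ X) : X ≤ Real.exp (X ^ (1 / Real.exp 1)) := by
  have he := Real.exp_pos 1
  set y := X ^ (1 / Real.exp 1) with hy
  have hy0 : 0 ≤ y := Real.rpow_nonneg hX _
  have h1 : y ≤ Real.exp (y / Real.exp 1) := by
    have h := Real.add_one_le_exp (y / Real.exp 1 - 1)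
    rw [sub_add_cancel, Real.exp_sub, div_le_div_iff_of_pos_right he] at h
    exact h
  calc X = y ^ Real.exp 1 := by
        rw [hy, ← Real.rpow_mul hX, one_div_mul_cancel he.ne', Real.rpow_one]
    _ ≤ Real.exp (y / Real.exp 1) ^ Real.exp 1 := by gcongr
    _ = Real.exp y := by rw [← Real.exp_mul, div_mul_cancel₀ _ he.ne']

/-- With `L! ≥ (L/e)^L` the left side is at most `X^L`, `X = e² s² n / L²`, and
`L X^{1/e}` is largest at `L = n`. -/
lemma pow_div_factorial_sq_le {L n : ℕ} (hL : 1 ≤ L) (hLn : L ≤ n) {s : ℝ} (hs : 0 < s) :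
    (n : ℝ) ^ L * s ^ (2 * L) / (Nat.factorial L : ℝ) ^ 2 ≤
      Real.exp (Real.exp (2 / Real.exp 1) / 2 * s ^ (2 / Real.exp 1) *
        (n : ℝ) ^ (1 - 1 / Real.exp 1)) ^ 2 := by
  have he := Real.exp_pos 1
  have hL0 : (0 : ℝ) < L := by exact_mod_cast hL
  have hLn' : (L : ℝ) ≤ n := by exact_mod_cast hLn
  have hn0 : (0 : ℝ) < n := by linarith
  set X : ℝ := Real.exp 2 * s ^ 2 * n / L ^ 2 with hX
  have hX0 : 0 < X := by positivity
  have hfac : (L : ℝ) ^ L ≤ Real.exp L * (Nat.factorial L : ℝ) := by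
    have h := Real.pow_div_factorial_le_exp (L : ℝ) hL0.le L
    rwa [div_le_iff₀ (by positivity)] at h
  have h1 : (n : ℝ) ^ L * s ^ (2 * L) / (Nat.factorial L : ℝ) ^ 2 ≤ X ^ L := by
    have e : X ^ L = (n : ℝ) ^ L * s ^ (2 * L) * (Real.exp L / L ^ L) ^ 2 := by
      rw [hX, div_pow, mul_pow, mul_pow, ← Real.exp_nat_mul, div_pow, ← Real.exp_nat_mul,
        ← pow_mul, ← pow_mul, ← pow_mul, mul_comm 2 L]
      push_cast
      rw [mul_comm (L : ℝ) 2]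
      ring
    rw [e, div_eq_mul_inv]
    gcongr
    rw [← inv_pow]
    gcongr
    rw [le_div_iff₀ (by positivity), inv_mul_le_iff₀ (by positivity)]
    linarith
  have hrp : X ^ (1 / Real.exp 1) = Real.exp (2 / Real.exp 1) * s ^ (2 / Real.exp 1) *
      (n : ℝ) ^ (1 / Real.exp 1) * (L : ℝ) ^ (-(2 / Real.exp 1)) := by
    rw [hX, Real.div_rpow (by positivity) (by positivity), Real.mul_rpow (by positivity) hn0.le,
      Real.mul_rpow (by positivity) (by positivity), ← Real.exp_mul, ← Real.rpow_natCast s 2,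
      ← Real.rpow_natCast (L : ℝ) 2, ← Real.rpow_mul hs.le, ← Real.rpow_mul hL0.le,
      Real.rpow_neg hL0.le, div_eq_mul_inv]
    push_cast
    rw [mul_one_div]
  have hexp2 : 2 / Real.exp 1 ≤ 1 := by
    rw [div_le_one he]; linarith [Real.add_one_le_exp (1 : ℝ)]
  have h2 : (L : ℝ) * X ^ (1 / Real.exp 1) ≤ Real.exp (2 / Real.exp 1) * s ^ (2 / Real.exp 1) *
      (n : ℝ) ^ (1 - 1 / Real.exp 1) := by
    calc (L : ℝ) * X ^ (1 / Real.exp 1) = Real.exp (2 / Real.exp 1) * s ^ (2 / Real.exp 1) *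
          ((n : ℝ) ^ (1 / Real.exp 1) * (L : ℝ) ^ (1 - 2 / Real.exp 1)) := by
          rw [hrp, sub_eq_add_neg, Real.rpow_add hL0, Real.rpow_one]; ring
      _ ≤ Real.exp (2 / Real.exp 1) * s ^ (2 / Real.exp 1) *
          ((n : ℝ) ^ (1 / Real.exp 1) * (n : ℝ) ^ (1 - 2 / Real.exp 1)) := by
          gcongr
      _ = _ := by rw [← Real.rpow_add hn0]; congr 2; ring
  calc _ ≤ X ^ L := h1
    _ ≤ Real.exp (X ^ (1 / Real.exp 1)) ^ L := by
      gcongr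
      exact le_exp_rpow_inv_exp hX0.le
    _ = Real.exp (L * X ^ (1 / Real.exp 1)) := by rw [Real.exp_nat_mul]
    _ ≤ Real.exp (Real.exp (2 / Real.exp 1) * s ^ (2 / Real.exp 1) *
      (n : ℝ) ^ (1 - 1 / Real.exp 1)) := Real.exp_le_exp.2 h2
    _ = _ := by
      rw [← Real.exp_nat_mul]; congr 1; push_cast; ring

/-- The bound for the normalized radial functions on `[0, ρ]`. The parameter `s` is either `ρ`, and then a factor
`t = ρ⁻¹` is gained, or `1`, and then `t = 1`. -/
lemma abs_radial_le {B n l : ℕ} (hl : l < n) (hn : n ≤ B) {r ρ s t : ℝ} (hr : 0 ≤ r) (hrρ : r ≤ ρ)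
    (hs : 0 < s) (ht : 0 ≤ t) (hrst : r ^ l ≤ s ^ (l + 1) * t) :
    |radialNorm n l * radialPart n l r| ≤ 6 * B * t *
      Real.exp (Real.exp (2 / Real.exp 1) / 2 * s ^ (2 / Real.exp 1) *
        ((B : ℝ) + 1 / 2) ^ (1 - 1 / Real.exp 1) + ρ ^ 2 / 2) := by
  have hn1 : 1 ≤ n := by omega
  have hnB : (n : ℝ) ≤ B := by exact_mod_cast hn
  have hn0 : (1 : ℝ) ≤ n := by exact_mod_cast hn1
  obtain ⟨k, hk⟩ : ∃ k, n = l + 1 + k := ⟨n - (l + 1), by omega⟩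
  have hk1 : n - l - 1 = k := by omega
  have hnk : (n : ℝ) = l + 1 + k := by rw [hk]; push_cast; ring
  have hlag := abs_laguerre_le k (α := (l : ℝ) + 1 / 2) (by positivity) (sq_nonneg r)
  have hΓn := Real.Gamma_pos_of_pos (show (0 : ℝ) < (n : ℝ) + 1 / 2 by linarith)
  have hL2 : (0 : ℝ) < ((l + 1 : ℕ) : ℝ) + 1 / 2 := by positivity
  have hΓl := Real.Gamma_pos_of_pos hL2
  have hkf : (0 : ℝ) < (Nat.factorial k : ℝ) := by positivity
  rw [show (k : ℝ) + ((l : ℝ) + 1 / 2) + 1 = n + 1 / 2 by rw [hnk]; ring,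
    show (l : ℝ) + 1 / 2 + 1 = ((l + 1 : ℕ) : ℝ) + 1 / 2 by push_cast; ring] at hlag
  have hκ : (2 * Real.sqrt (k + (((l + 1 : ℕ) : ℝ) + 1 / 2) / 2) + 1) ≤ 3 * Real.sqrt B := by
    have h1 : Real.sqrt (k + (((l + 1 : ℕ) : ℝ) + 1 / 2) / 2) ≤ Real.sqrt B := by
      apply Real.sqrt_le_sqrt
      push_cast
      have : (0 : ℝ) ≤ l := l.cast_nonneg
      linarith
    have h2 : 1 ≤ Real.sqrt B := by rw [Real.one_le_sqrt]; linarith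
    linarith
  -- the normalization constant times the value of the Laguerre polynomial at the origin
  have hcore : radialNorm n l * (Real.Gamma (n + 1 / 2) /
      (Real.Gamma (((l + 1 : ℕ) : ℝ) + 1 / 2) * (Nat.factorial k : ℝ))) * s ^ (l + 1) ≤
      2 * Real.sqrt B * Real.exp (Real.exp (2 / Real.exp 1) / 2 * s ^ (2 / Real.exp 1) *
        (n : ℝ) ^ (1 - 1 / Real.exp 1)) := by
    refine (le_abs_self _).trans (abs_le_of_sq_le_sq ?_ (by positivity))
    have hp := pow_div_factorial_sq_le (L := l + 1) (by omega) (show l + 1 ≤ n by omega) hs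
    have hG1 := Gamma_nat_add_half_le hn1
    have hG2 := sq_factorial_le_Gamma (l + 1)
    have hdesc : (Nat.factorial n : ℝ) ≤ (Nat.factorial k : ℝ) * (n : ℝ) ^ (l + 1) := by
      have h1 := Nat.factorial_mul_descFactorial (show l + 1 ≤ n by omega)
      rw [show n - (l + 1) = k by omega] at h1
      rw [← h1]
      push_cast
      gcongr
      exact_mod_cast Nat.descFactorial_le_pow n (l + 1)
    have hB : ((l + 1 : ℕ) : ℝ) + 1 / 2 ≤ 2 * B := by
      push_cast
      have : (0 : ℝ) ≤ k := k.cast_nonneg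
      linarith
    have hfl : (0 : ℝ) < (Nat.factorial (l + 1) : ℝ) := by positivity
    calc (radialNorm n l * (Real.Gamma (n + 1 / 2) /
      (Real.Gamma (((l + 1 : ℕ) : ℝ) + 1 / 2) * (Nat.factorial k : ℝ))) * s ^ (l + 1)) ^ 2
        = 2 * (Real.Gamma (n + 1 / 2) / (Nat.factorial k : ℝ)) *
          (1 / Real.Gamma (((l + 1 : ℕ) : ℝ) + 1 / 2) ^ 2) * s ^ (2 * (l + 1)) := by
          rw [radialNorm, hk1, mul_pow, mul_pow, Real.sq_sqrt (by positivity), ← pow_mul,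
            mul_comm (l + 1) 2]
          field_simp
      _ ≤ 2 * (n : ℝ) ^ (l + 1) *
          ((((l + 1 : ℕ) : ℝ) + 1 / 2) / (Nat.factorial (l + 1) : ℝ) ^ 2) *
            s ^ (2 * (l + 1)) := by
          gcongr ?_ * ?_ * _
          · gcongr
            rw [div_le_iff₀ hkf]
            linarith
          · rw [div_le_div_iff₀ (by positivity) (by positivity)]
            linarith
      _ = 2 * (((l + 1 : ℕ) : ℝ) + 1 / 2) *
          ((n : ℝ) ^ (l + 1) * s ^ (2 * (l + 1)) / (Nat.factorial (l + 1) : ℝ) ^ 2) := by ring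
      _ ≤ 2 * (2 * B) * Real.exp (Real.exp (2 / Real.exp 1) / 2 * s ^ (2 / Real.exp 1) *
        (n : ℝ) ^ (1 - 1 / Real.exp 1)) ^ 2 := by gcongr
      _ = _ := by rw [mul_pow, mul_pow, Real.sq_sqrt (by positivity)]; ring
  have hN0 : 0 ≤ radialNorm n l := Real.sqrt_nonneg _
  rw [abs_mul, radialPart, abs_mul, hk1, abs_of_nonneg hN0, abs_of_nonneg (pow_nonneg hr l)]
  calc radialNorm n l * (|laguerre k (l + 1 / 2) (r ^ 2)| * r ^ l)
      ≤ radialNorm n l * ((3 * Real.sqrt B * (Real.Gamma (n + 1 / 2) /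
        (Real.Gamma (((l + 1 : ℕ) : ℝ) + 1 / 2) * (Nat.factorial k : ℝ))) *
        Real.exp (ρ ^ 2 / 2)) * (s ^ (l + 1) * t)) := by
        gcongr
        refine hlag.trans ?_
        gcongr
    _ = (radialNorm n l * (Real.Gamma (n + 1 / 2) /
        (Real.Gamma (((l + 1 : ℕ) : ℝ) + 1 / 2) * (Nat.factorial k : ℝ))) * s ^ (l + 1)) *
        (3 * Real.sqrt B * t * Real.exp (ρ ^ 2 / 2)) := by ring
    _ ≤ (2 * Real.sqrt B * Real.exp (Real.exp (2 / Real.exp 1) / 2 * s ^ (2 / Real.exp 1) *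
        ((B : ℝ) + 1 / 2) ^ (1 - 1 / Real.exp 1))) *
        (3 * Real.sqrt B * t * Real.exp (ρ ^ 2 / 2)) := by
        refine mul_le_mul_of_nonneg_right (hcore.trans ?_) (by positivity)
        gcongr
        · rw [sub_nonneg, div_le_one (Real.exp_pos 1)]
          linarith [Real.add_one_le_exp (1 : ℝ)]
        · linarith
    _ = 6 * (Real.sqrt B * Real.sqrt B) * t *
        (Real.exp (Real.exp (2 / Real.exp 1) / 2 * s ^ (2 / Real.exp 1) *
        ((B : ℝ) + 1 / 2) ^ (1 - 1 / Real.exp 1)) * Real.exp (ρ ^ 2 / 2)) := by ring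
    _ = _ := by rw [Real.mul_self_sqrt (by positivity), ← Real.exp_add]

/-! ### Associated Legendre functions -/

open Polynomial in
/-- The `j`-th derivative of `(X² - 1)^l`. -/
noncomputable def rodrigues (l j : ℕ) : ℝ[X] := derivative^[j] ((X ^ 2 - 1 : ℝ[X]) ^ l)

open Polynomial in
lemma derivative_rodrigues (l j : ℕ) : derivative (rodrigues l j) = rodrigues l (j + 1) := by
  unfold rodrigues
  rw [Function.iterate_succ_apply']

open Polynomial in
/-- The first order equation of `(X² - 1)^l`, whose derivatives give `rodrigues_rec`. -/
lemma rodrigues_zero_rec (l : ℕ) :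
    (1 - X ^ 2) * rodrigues l 1 = -(2 * (l : ℝ[X]) * X * rodrigues l 0) := by
  simp only [rodrigues, Function.iterate_zero, id, Function.iterate_one]
  cases l with
  | zero => simp
  | succ l =>
    rw [derivative_pow_succ]
    simp only [derivative_sub, derivative_X_pow, derivative_one, map_add, map_natCast, map_one]
    push_cast
    ring

open Polynomial in
/-- The derivatives of the Legendre differential equation. -/
lemma rodrigues_rec (l j : ℕ) :
    (1 - X ^ 2) * rodrigues l (j + 2) = 2 * ((j : ℝ[X]) + 1 - (l : ℝ[X])) * X * rodrigues l (j + 1) +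
      ((j : ℝ[X]) + 1) * ((j : ℝ[X]) - 2 * (l : ℝ[X])) * rodrigues l j := by
  induction j with
  | zero =>
    have h := congrArg derivative (rodrigues_zero_rec l)
    simp only [derivative_mul, derivative_neg, derivative_sub, derivative_one, derivative_X_pow,
      derivative_X, derivative_natCast, derivative_ofNat, derivative_rodrigues] at h
    push_cast at h ⊢
    simp only [map_ofNat] at h
    linear_combination h
  | succ j ih =>
    have h := congrArg derivative ih
    simp only [derivative_mul, derivative_add, derivative_sub, derivative_one, derivative_X_pow,
      derivative_X, derivative_natCast, derivative_ofNat, derivative_rodrigues] at h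
    push_cast at h ⊢
    simp only [map_ofNat] at h
    linear_combination h

lemma natDegree_rodrigues_le (l j : ℕ) : (rodrigues l j).natDegree ≤ 2 * l - j := by
  unfold rodrigues
  refine (Polynomial.natDegree_iterate_derivative _ _).trans ?_
  refine Nat.sub_le_sub_right (Polynomial.natDegree_pow_le.trans ?_) _
  have : (Polynomial.X ^ 2 - 1 : Polynomial ℝ).natDegree = 2 := by
    have := Polynomial.natDegree_X_pow_sub_C (n := 2) (r := (1 : ℝ))
    rwa [Polynomial.C_1] at this
  rw [this, mul_comm]

lemma rodrigues_eq_zero (l : ℕ) : rodrigues l (2 * l + 1) = 0 := by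
  have h : (rodrigues l (2 * l)).natDegree = 0 := by
    have := natDegree_rodrigues_le l (2 * l)
    omega
  rw [← derivative_rodrigues, Polynomial.derivative_of_natDegree_zero h]

open Polynomial in
lemma exists_rodrigues_factor (l j : ℕ) :
    ∃ g : ℝ[X], rodrigues l j = (X ^ 2 - 1) ^ (l - j) * g :=
  pow_sub_dvd_iterate_derivative_pow (X ^ 2 - 1 : ℝ[X]) l j

/-- The `j`-th derivative of `(X² - 1)^l` divided by the power `(X² - 1)^(l - j)` it contains
(the exponent being truncated at zero). -/
noncomputable def rodriguesFactor (l j : ℕ) : Polynomial ℝ := (exists_rodrigues_factor l j).choose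

open Polynomial in
lemma rodrigues_eq_mul_factor (l j : ℕ) :
    rodrigues l j = (X ^ 2 - 1) ^ (l - j) * rodriguesFactor l j :=
  (exists_rodrigues_factor l j).choose_spec

open Polynomial in
lemma X_sq_sub_one_monic : (X ^ 2 - 1 : ℝ[X]).Monic := by
  have := monic_X_pow_sub_C (1 : ℝ) (n := 2) (by norm_num)
  rwa [C_1] at this

open Polynomial in
lemma natDegree_rodriguesFactor_le (l j : ℕ) :
    (rodriguesFactor l j).natDegree ≤ 2 * l - j - 2 * (l - j) := by
  have h := natDegree_rodrigues_le l j
  have h2 : (X ^ 2 - 1 : ℝ[X]).natDegree = 2 := by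
    have := natDegree_X_pow_sub_C (n := 2) (r := (1 : ℝ))
    rwa [C_1] at this
  by_cases h0 : rodriguesFactor l j = 0
  · rw [h0]; simp
  rw [rodrigues_eq_mul_factor, (X_sq_sub_one_monic.pow _).natDegree_mul' h0,
    X_sq_sub_one_monic.natDegree_pow, h2] at h
  omega

/-- The weight `(2l - j)!/j!`. -/
noncomputable def legendreWeight (l j : ℕ) : ℝ :=
  (Nat.factorial (2 * l - j) : ℝ) / (Nat.factorial j : ℝ)

lemma legendreWeight_succ {l j : ℕ} (hj : j < 2 * l) :
    legendreWeight l (j + 1) * ((j + 1) * (2 * l - j)) = legendreWeight l j := by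
  obtain ⟨i, hi⟩ : ∃ i, 2 * l = j + 1 + i := ⟨2 * l - (j + 1), by omega⟩
  have hi' : (2 : ℝ) * l = j + 1 + i := by exact_mod_cast hi
  unfold legendreWeight
  rw [show 2 * l - (j + 1) = i by omega, show 2 * l - j = i + 1 by omega, hi',
    Nat.factorial_succ, Nat.factorial_succ]
  push_cast
  field_simp
  ring

open Polynomial in
/-- The sum `∑_j (2l-j)!/j! (1 - X²)^j (D^j (X² - 1)^l)²`, which is `(1 - X²)^l` times the sum of
the squares of the normalized associated Legendre functions of degree `l`. -/
noncomputable def legendreSum (l : ℕ) : ℝ[X] :=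
  ∑ j ∈ Finset.range (2 * l + 1), C (legendreWeight l j) * ((1 - X ^ 2) ^ j * rodrigues l j ^ 2)

open Polynomial in
lemma legendreSum_ode (l : ℕ) :
    (1 - X ^ 2) * derivative (legendreSum l) + 2 * (l : ℝ[X]) * X * legendreSum l = 0 := by
  set A : ℕ → ℝ[X] := fun j => C (legendreWeight l j) *
    ((1 - X ^ 2) ^ (j + 1) * rodrigues l j * rodrigues l (j + 1)) with hA
  have hterm : ∀ j, (1 - X ^ 2) * derivative (C (legendreWeight l j) *
      ((1 - X ^ 2) ^ j * rodrigues l j ^ 2)) + 2 * (l : ℝ[X]) * X * (C (legendreWeight l j) *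
      ((1 - X ^ 2) ^ j * rodrigues l j ^ 2)) = C (legendreWeight l j) * ((1 - X ^ 2) ^ j *
      (2 * ((l : ℝ[X]) - (j : ℝ[X])) * X * rodrigues l j ^ 2 +
        2 * (1 - X ^ 2) * rodrigues l j * rodrigues l (j + 1))) := by
    intro j
    cases j with
    | zero =>
      simp only [derivative_mul, derivative_C, derivative_pow, derivative_rodrigues, pow_zero]
      have hC : (C (2 : ℝ) : ℝ[X]) = 2 := map_ofNat C 2
      simp
      rw [hC]
      ring
    | succ j =>
      simp only [derivative_mul, derivative_C, derivative_pow_succ, derivative_sub,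
        derivative_one, derivative_X, derivative_rodrigues, map_add, map_natCast, map_one, pow_one]
      push_cast
      ring
  have hpart : ∀ K, K ≤ 2 * l → ∑ j ∈ Finset.range (K + 1), C (legendreWeight l j) *
      ((1 - X ^ 2) ^ j * (2 * ((l : ℝ[X]) - (j : ℝ[X])) * X * rodrigues l j ^ 2 +
        2 * (1 - X ^ 2) * rodrigues l j * rodrigues l (j + 1))) = A K := by
    intro K
    induction K with
    | zero =>
      intro _
      have h := rodrigues_zero_rec l
      rw [Finset.sum_range_one, hA]
      push_cast
      linear_combination (C (legendreWeight l 0) * rodrigues l 0) * h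
    | succ K ih =>
      intro hK
      rw [Finset.sum_range_succ, ih (by omega), hA]
      have h := rodrigues_rec l K
      have hw : C (legendreWeight l K) = C (legendreWeight l (K + 1)) *
          (((K : ℝ[X]) + 1) * (2 * (l : ℝ[X]) - (K : ℝ[X]))) := by
        rw [← legendreWeight_succ (show K < 2 * l by omega)]
        simp only [map_mul, map_add, map_sub, map_natCast, map_one, map_ofNat]
      simp only
      rw [hw]
      push_cast
      linear_combination (C (legendreWeight l (K + 1)) * (1 - X ^ 2) ^ (K + 1) *
        rodrigues l (K + 1)) * h
  unfold legendreSum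
  rw [derivative_sum, Finset.mul_sum, Finset.mul_sum, ← Finset.sum_add_distrib,
    Finset.sum_congr rfl fun j _ => hterm j, hpart (2 * l) le_rfl, hA]
  simp [rodrigues_eq_zero]

open Polynomial in
/-- The sum of the squares of the normalized associated Legendre functions of degree `l`, as a
polynomial; `|j - l|` is written as `(l - j) + (j - l)` in truncated subtraction. -/
noncomputable def legendreSquareSum (l : ℕ) : ℝ[X] :=
  ∑ j ∈ Finset.range (2 * l + 1), C (legendreWeight l j) *
    ((1 - X ^ 2) ^ ((l - j) + (j - l)) * rodriguesFactor l j ^ 2)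

open Polynomial in
lemma legendreSum_eq (l : ℕ) : legendreSum l = (1 - X ^ 2) ^ l * legendreSquareSum l := by
  unfold legendreSum legendreSquareSum
  rw [Finset.mul_sum]
  refine Finset.sum_congr rfl fun j _ => ?_
  rw [rodrigues_eq_mul_factor, mul_pow, ← pow_mul, mul_comm (l - j) 2, pow_mul,
    show (X ^ 2 - 1 : ℝ[X]) ^ 2 = (1 - X ^ 2) ^ 2 by ring, ← pow_mul]
  have : (1 - X ^ 2 : ℝ[X]) ^ j * (1 - X ^ 2) ^ (2 * (l - j)) =
      (1 - X ^ 2) ^ l * (1 - X ^ 2) ^ ((l - j) + (j - l)) := by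
    rw [← pow_add, ← pow_add]
    congr 1
    omega
  linear_combination (C (legendreWeight l j) * rodriguesFactor l j ^ 2) * this

open Polynomial in
lemma derivative_legendreSquareSum (l : ℕ) : derivative (legendreSquareSum l) = 0 := by
  have h := legendreSum_ode l
  rw [legendreSum_eq, derivative_mul] at h
  have hne : (1 - X ^ 2 : ℝ[X]) ≠ 0 := by
    have := X_sq_sub_one_monic.ne_zero
    intro h0
    apply this
    linear_combination -h0
  have h2 : (1 - X ^ 2 : ℝ[X]) * derivative ((1 - X ^ 2) ^ l) =
      -(2 * (l : ℝ[X]) * X * (1 - X ^ 2) ^ l) := by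
    cases l with
    | zero => simp
    | succ l =>
      rw [derivative_pow_succ]
      simp only [derivative_sub, derivative_X_pow, derivative_one, map_add, map_natCast, map_one,
        Nat.cast_ofNat, map_ofNat, Nat.add_one_sub_one, pow_one]
      push_cast
      ring
  have h3 : (1 - X ^ 2 : ℝ[X]) ^ (l + 1) * derivative (legendreSquareSum l) = 0 := by
    linear_combination h - legendreSquareSum l * h2
  exact (mul_eq_zero.1 h3).resolve_left (pow_ne_zero _ hne)

open Polynomial in
lemma eval_iterate_derivative_X_sub_C_pow_mul (l : ℕ) (a : ℝ) (g : ℝ[X]) :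
    (derivative^[l] ((X - C a) ^ l * g)).eval a = (Nat.factorial l : ℝ) * g.eval a := by
  induction l generalizing g with
  | zero => simp
  | succ l ih =>
    rw [Function.iterate_succ_apply, show derivative ((X - C a) ^ (l + 1) * g) =
      (X - C a) ^ l * (C ((l : ℝ) + 1) * g + (X - C a) * derivative g) by
        rw [derivative_mul, derivative_X_sub_C_pow]
        simp only [map_add, map_natCast, map_one, Nat.add_one_sub_one]
        push_cast
        ring, ih, Nat.factorial_succ]
    simp
    ring

/-- The normalized associated Legendre functions of a given degree have constant square sum. -/
lemma eval_legendreSquareSum (l : ℕ) (x : ℝ) :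
    (legendreSquareSum l).eval x = (2 ^ l * (Nat.factorial l : ℝ)) ^ 2 := by
  have hc := Polynomial.eq_C_of_derivative_eq_zero (derivative_legendreSquareSum l)
  have h1 : (legendreSquareSum l).eval 1 = (2 ^ l * (Nat.factorial l : ℝ)) ^ 2 := by
    unfold legendreSquareSum
    rw [Polynomial.eval_finsetSum, Finset.sum_eq_single_of_mem l (by simp; omega)]
    · have h2 : (rodriguesFactor l l).eval 1 = 2 ^ l * (Nat.factorial l : ℝ) := by
        have h3 := rodrigues_eq_mul_factor l l
        rw [Nat.sub_self, pow_zero, one_mul] at h3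
        rw [← h3, rodrigues, show (Polynomial.X ^ 2 - 1 : Polynomial ℝ) ^ l =
          (Polynomial.X - Polynomial.C 1) ^ l * (Polynomial.X + 1) ^ l by
            rw [← mul_pow, Polynomial.C_1]; ring_nf, eval_iterate_derivative_X_sub_C_pow_mul]
        simp only [Polynomial.eval_pow, Polynomial.eval_add, Polynomial.eval_X,
          Polynomial.eval_one]
        norm_num
        ring
      have h4 : legendreWeight l l = 1 := by
        unfold legendreWeight
        rw [show 2 * l - l = l by omega]
        exact div_self (by positivity)
      simp [h2, h4]
    · intro j _ hj
      have : (l - j) + (j - l) ≠ 0 := by omega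
      rw [Polynomial.eval_mul, Polynomial.eval_mul, Polynomial.eval_pow]
      simp only [Polynomial.eval_sub, Polynomial.eval_one, Polynomial.eval_pow, Polynomial.eval_X,
        one_pow, sub_self, zero_pow this, zero_mul, mul_zero]
  rw [hc] at h1 ⊢
  simpa using h1

lemma legendreWeight_mul_sq_le {l j : ℕ} (hj : j ≤ 2 * l) {x : ℝ} (hx : x ^ 2 ≤ 1) :
    legendreWeight l j * ((1 - x ^ 2) ^ ((l - j) + (j - l)) * (rodriguesFactor l j).eval x ^ 2) ≤
      (2 ^ l * (Nat.factorial l : ℝ)) ^ 2 := by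
  rw [← eval_legendreSquareSum l x, legendreSquareSum, Polynomial.eval_finsetSum]
  have h0 : 0 ≤ 1 - x ^ 2 := by linarith
  refine le_of_eq_of_le ?_ (Finset.single_le_sum (f := fun j => Polynomial.eval x
    (Polynomial.C (legendreWeight l j) * ((1 - Polynomial.X ^ 2) ^ ((l - j) + (j - l)) *
      rodriguesFactor l j ^ 2))) (fun i _ => ?_) (Finset.mem_range.2 (Nat.lt_succ_of_le hj)))
  · simp
  · simp only [Polynomial.eval_mul, Polynomial.eval_C, Polynomial.eval_pow, Polynomial.eval_sub,
      Polynomial.eval_one, Polynomial.eval_X]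
    unfold legendreWeight
    positivity

/-- The polynomial factor of the normalized associated Legendre function, see
`sphericalNorm_mul_assocLegendre`. -/
noncomputable def polarPoly (l : ℕ) (m : ℤ) : Polynomial ℝ :=
  Polynomial.C (sphericalNorm l m * ((if 0 ≤ m then (-1) ^ m.natAbs else 1) /
    (2 ^ l * (Nat.factorial l : ℝ)))) * rodriguesFactor l ((l : ℤ) + m).toNat

lemma natDegree_polarPoly_le {l : ℕ} {m : ℤ} (hm : m.natAbs ≤ l) :
    (polarPoly l m).natDegree ≤ l - m.natAbs := by
  refine (Polynomial.natDegree_C_mul_le _ _).trans ((natDegree_rodriguesFactor_le _ _).trans ?_)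
  omega

lemma sphericalNorm_mul_assocLegendre {l : ℕ} {m : ℤ} (hm : m.natAbs ≤ l) {ω : ℝ}
    (hω : ω ∈ Set.Icc 0 Real.pi) :
    sphericalNorm l m * assocLegendre l m (Real.cos ω) =
      Real.sin ω ^ m.natAbs * (polarPoly l m).eval (Real.cos ω) := by
  have hs : 0 ≤ Real.sin ω := Real.sin_nonneg_of_mem_Icc hω
  have hsq : 1 - Real.cos ω ^ 2 = Real.sin ω ^ 2 := by linarith [Real.sin_sq_add_cos_sq ω]
  have hr : (Polynomial.derivative^[((l : ℤ) + m).toNat]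
      ((Polynomial.X ^ 2 - 1 : Polynomial ℝ) ^ l)) = rodrigues l ((l : ℤ) + m).toNat := rfl
  unfold assocLegendre polarPoly
  rw [hr, rodrigues_eq_mul_factor]
  simp only [Polynomial.eval_mul, Polynomial.eval_C, Polynomial.eval_pow, Polynomial.eval_sub,
    Polynomial.eval_one, Polynomial.eval_X]
  rw [hsq, show Real.cos ω ^ 2 - 1 = -Real.sin ω ^ 2 by rw [← hsq]; ring]
  rcases le_or_gt 0 m with h | h
  · obtain ⟨μ, rfl⟩ := Int.eq_ofNat_of_zero_le h
    have e : l - ((l : ℤ) + (μ : ℤ)).toNat = 0 := by omega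
    have hp : (Real.sin ω ^ 2) ^ (((μ : ℤ) : ℝ) / 2) = Real.sin ω ^ μ := by
      rw [← Real.rpow_natCast (Real.sin ω) 2, ← Real.rpow_mul hs]
      push_cast
      rw [mul_div_cancel₀ _ (two_ne_zero), Real.rpow_natCast]
    rw [e, hp, if_pos h]
    simp only [pow_zero, one_mul, Int.natAbs_natCast, zpow_natCast]
    ring
  · obtain ⟨μ, hμ⟩ := Int.eq_ofNat_of_zero_le (show 0 ≤ -m by omega)
    obtain rfl : m = -(μ : ℤ) := by omega
    have hμ0 : μ ≠ 0 := by omega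
    have e : l - ((l : ℤ) + -(μ : ℤ)).toNat = μ := by omega
    have hp : (Real.sin ω ^ 2) ^ (((-(μ : ℤ) : ℤ) : ℝ) / 2) * (-Real.sin ω ^ 2) ^ μ =
        (-1) ^ μ * Real.sin ω ^ μ := by
      -- at `sin ω = 0` the negative power on the left is the junk value `0`, as is the right side
      rcases hs.eq_or_lt with h0 | h0
      · rw [← h0]; simp [hμ0]
      · have : (Real.sin ω ^ 2) ^ (((-(μ : ℤ) : ℤ) : ℝ) / 2) = (Real.sin ω ^ μ)⁻¹ := by
          rw [← Real.rpow_natCast (Real.sin ω) 2, ← Real.rpow_mul hs]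
          push_cast
          rw [mul_div_cancel₀ _ (two_ne_zero), Real.rpow_neg hs, Real.rpow_natCast]
        rw [this, neg_pow, ← pow_mul, mul_comm 2 μ, pow_mul]
        field_simp
    have hsign : ((-1 : ℝ) ^ (-(μ : ℤ))) * (-1) ^ μ = 1 := by
      rw [zpow_neg, zpow_natCast]
      exact inv_mul_cancel₀ (pow_ne_zero _ (by norm_num))
    rw [e, if_neg (by omega), show (-(μ : ℤ)).natAbs = μ by omega]
    linear_combination (sphericalNorm l (-(μ : ℤ)) * ((-1 : ℝ) ^ (-(μ : ℤ)) /
      (2 ^ l * (Nat.factorial l : ℝ))) *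
      Polynomial.eval (Real.cos ω) (rodriguesFactor l ((l : ℤ) + -(μ : ℤ)).toNat)) * hp +
      (sphericalNorm l (-(μ : ℤ)) * (1 / (2 ^ l * (Nat.factorial l : ℝ))) * Real.sin ω ^ μ *
      Polynomial.eval (Real.cos ω) (rodriguesFactor l ((l : ℤ) + -(μ : ℤ)).toNat)) * hsign

/-- The bound `|Y_{lm}| ≤ √((2l + 1)/(4π))`, for the extension to all real angles. -/
lemma abs_sin_pow_mul_polarPoly_le {l : ℕ} {m : ℤ} (hm : m.natAbs ≤ l) (ω : ℝ) :
    |Real.sin ω ^ m.natAbs * (polarPoly l m).eval (Real.cos ω)| ≤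
      Real.sqrt ((2 * l + 1) / (4 * Real.pi)) := by
  have hpi := Real.pi_pos
  have hsq : 1 - Real.cos ω ^ 2 = Real.sin ω ^ 2 := by linarith [Real.sin_sq_add_cos_sq ω]
  set j := ((l : ℤ) + m).toNat with hj
  have hj2 : (l - j) + (j - l) = m.natAbs := by omega
  have h := legendreWeight_mul_sq_le (l := l) (j := j) (by omega) (x := Real.cos ω)
    (by nlinarith [Real.sin_sq_add_cos_sq ω, sq_nonneg (Real.sin ω)])
  rw [hj2, hsq] at h
  apply Real.abs_le_sqrt
  have hw : sphericalNorm l m ^ 2 = (2 * l + 1) / (4 * Real.pi) * legendreWeight l j := by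
    rw [sphericalNorm, Real.sq_sqrt (by positivity), legendreWeight, hj]
    congr 4
    omega
  have hsgn : ((if 0 ≤ m then (-1) ^ m.natAbs else 1 : ℝ)) ^ 2 = 1 := by
    split_ifs
    · rw [← pow_mul, mul_comm, pow_mul]; norm_num
    · norm_num
  have hF : (0 : ℝ) < (2 ^ l * (Nat.factorial l : ℝ)) ^ 2 := by positivity
  rw [polarPoly, Polynomial.eval_mul, Polynomial.eval_C]
  calc _ = sphericalNorm l m ^ 2 * ((if 0 ≤ m then (-1) ^ m.natAbs else 1 : ℝ)) ^ 2 *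
        ((Real.sin ω ^ 2) ^ m.natAbs * (rodriguesFactor l j).eval (Real.cos ω) ^ 2) /
          (2 ^ l * (Nat.factorial l : ℝ)) ^ 2 := by
        rw [← pow_mul, mul_comm 2 m.natAbs, pow_mul]; ring
    _ = (2 * l + 1) / (4 * Real.pi) * (legendreWeight l j *
        ((Real.sin ω ^ 2) ^ m.natAbs * (rodriguesFactor l j).eval (Real.cos ω) ^ 2) /
          (2 ^ l * (Nat.factorial l : ℝ)) ^ 2) := by rw [hw, hsgn]; ring
    _ ≤ (2 * l + 1) / (4 * Real.pi) * 1 := by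
        gcongr
        rw [div_le_one hF]; exact h
    _ = _ := mul_one _

/-! ### Exactness of the discrete cosine transform -/

lemma chebNode_eq (N j : ℕ) :
    chebNode N j = (2 * (j : ℝ) + 1) * (Real.pi / (2 * N)) := by
  unfold chebNode; ring

lemma chebNode_mem_Ioo {N j : ℕ} (hj : j < N) : chebNode N j ∈ Set.Ioo 0 Real.pi := by
  have hpi := Real.pi_pos
  have hN : (0 : ℝ) < N := by exact_mod_cast (by omega : 0 < N)
  have hj' : (j : ℝ) + 1 ≤ N := by exact_mod_cast hj
  unfold chebNode
  refine ⟨by positivity, ?_⟩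
  rw [div_lt_iff₀ (by positivity)]
  nlinarith

/-- The sum of a cosine over the Chebyshev nodes telescopes after multiplication by a sine. -/
lemma sum_cos_chebNode {N : ℕ} {a : ℤ} (ha0 : a ≠ 0) (ha : |a| < 2 * N) :
    ∑ j ∈ Finset.range N, Real.cos (a * chebNode N j) = 0 := by
  have hN0 : 0 < N := by
    have := abs_nonneg a
    omega
  have hN : (0 : ℝ) < N := by exact_mod_cast hN0
  have hpi := Real.pi_pos
  set θ : ℝ := a * (Real.pi / (2 * N)) with hθ
  have hsin : Real.sin θ ≠ 0 := by
    intro h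
    obtain ⟨n, hn⟩ := Real.sin_eq_zero_iff.1 h
    have h1 : (n : ℝ) * (2 * N) = a := by
      have : (n : ℝ) * Real.pi * (2 * N) = a * Real.pi := by rw [hn, hθ]; field_simp
      have h2 : ((n : ℝ) * (2 * N)) * Real.pi = a * Real.pi := by linarith
      exact mul_right_cancel₀ hpi.ne' h2
    have h2 : n * (2 * (N : ℤ)) = a := by exact_mod_cast h1
    have hn0 : n ≠ 0 := by rintro rfl; apply ha0; rw [← h2]; simp
    have h3 : 1 ≤ |n| := Int.one_le_abs hn0
    rw [← h2, abs_mul, abs_of_nonneg (show (0 : ℤ) ≤ 2 * N by omega)] at ha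
    nlinarith
  have hterm : ∀ j ∈ Finset.range N, 2 * Real.sin θ * Real.cos (a * chebNode N j) =
      Real.sin (2 * ((j + 1 : ℕ) : ℝ) * θ) - Real.sin (2 * (j : ℝ) * θ) := by
    intro j _
    rw [Real.sin_sub_sin, chebNode_eq]
    congr 2
    · congr 1; push_cast; ring
    · rw [hθ]; push_cast; ring
  have h : 2 * Real.sin θ * ∑ j ∈ Finset.range N, Real.cos (a * chebNode N j) = 0 := by
    rw [Finset.mul_sum, Finset.sum_congr rfl hterm,
      Finset.sum_range_sub (fun j : ℕ => Real.sin (2 * (j : ℝ) * θ)),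
      show 2 * (N : ℝ) * θ = a * Real.pi by rw [hθ]; field_simp, Real.sin_int_mul_pi]
    simp
  exact (mul_eq_zero.1 h).resolve_left (mul_ne_zero two_ne_zero hsin)

lemma sum_cos_mul_cos_chebNode {N k k' : ℕ} (hk : k < N) (hk' : k' < N) :
    ∑ j ∈ Finset.range N, Real.cos (k * chebNode N j) * Real.cos (k' * chebNode N j) =
      if k = k' then (if k = 0 then (N : ℝ) else N / 2) else 0 := by
  have hterm : ∀ j ∈ Finset.range N,
      Real.cos (k * chebNode N j) * Real.cos (k' * chebNode N j) =
      (Real.cos (((k - k' : ℤ) : ℝ) * chebNode N j) +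
        Real.cos (((k + k' : ℤ) : ℝ) * chebNode N j)) / 2 := by
    intro j _
    push_cast
    rw [sub_mul, add_mul, Real.cos_sub, Real.cos_add]; ring
  rw [Finset.sum_congr rfl hterm, ← Finset.sum_div, Finset.sum_add_distrib]
  split_ifs with h h0
  · subst h; subst h0; simp
  · subst h
    rw [sum_cos_chebNode (a := (k + k : ℤ)) (by omega) (by rw [abs_lt]; omega)]
    simp
  · rw [sum_cos_chebNode (a := (k + k' : ℤ)) (by omega) (by rw [abs_lt]; omega),
      sum_cos_chebNode (a := (k - k' : ℤ)) (by omega) (by rw [abs_lt]; omega)]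
    simp

lemma dctDiag_mul_self {N : ℕ} (k : ℕ) :
    dctDiag N k * dctDiag N k = if k = 0 then 1 / (N : ℝ) else 2 / N := by
  unfold dctDiag
  split_ifs
  · rw [div_mul_div_comm, Real.mul_self_sqrt (by positivity), one_mul]
  · rw [Real.mul_self_sqrt (by positivity)]

lemma chebCoeff_sum {ι : Type*} (N : ℕ) (s : Finset ι) (c : ι → ℂ) (x : ι → ℕ → ℂ) :
    (chebCoeff N fun j => ∑ i ∈ s, c i * x i j) = fun k => ∑ i ∈ s, c i * chebCoeff N (x i) k := by
  ext k
  unfold chebCoeff dct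
  simp_rw [Finset.mul_sum]
  rw [Finset.sum_comm]
  refine Finset.sum_congr rfl fun i _ => Finset.sum_congr rfl fun j _ => by ring

lemma chebCoeff_congr {N : ℕ} {x y : ℕ → ℂ} (h : ∀ j < N, x j = y j) :
    chebCoeff N x = chebCoeff N y := by
  ext k
  unfold chebCoeff dct
  rw [Finset.sum_congr rfl fun j hj => by rw [h j (Finset.mem_range.1 hj)]]

lemma chebCoeff_cos {N k k' : ℕ} (hk : k < N) (hk' : k' < N) :
    chebCoeff N (fun j => (Real.cos (k' * chebNode N j) : ℂ)) k = if k = k' then 1 else 0 := by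
  have hN : (N : ℝ) ≠ 0 := by exact_mod_cast (by omega : N ≠ 0)
  have h := sum_cos_mul_cos_chebNode hk hk'
  have e : chebCoeff N (fun j => (Real.cos (k' * chebNode N j) : ℂ)) k =
      ((dctDiag N k * dctDiag N k * ∑ j ∈ Finset.range N,
        Real.cos (k * chebNode N j) * Real.cos (k' * chebNode N j) : ℝ) : ℂ) := by
    unfold chebCoeff dct
    push_cast
    ring
  rw [e, h, dctDiag_mul_self]
  by_cases hkk : k = k'
  · rw [if_pos hkk, if_pos hkk]
    split_ifs
    · rw [one_div_mul_cancel hN, Complex.ofReal_one]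
    · rw [show 2 / (N : ℝ) * (N / 2) = 1 by field_simp, Complex.ofReal_one]
  · rw [if_neg hkk, if_neg hkk, mul_zero, Complex.ofReal_zero]

/-- The span of `cos(k ·)`, `k < N`. -/
def cosSpan (N : ℕ) : Submodule ℂ (ℝ → ℂ) :=
  Submodule.span ℂ (Set.range fun (k : Fin N) (ω : ℝ) => (Real.cos ((k : ℕ) * ω) : ℂ))

lemma exists_of_mem_cosSpan {N : ℕ} {h : ℝ → ℂ} (hh : h ∈ cosSpan N) :
    ∃ c : Fin N → ℂ, h = fun ω => ∑ i, c i * (Real.cos ((i : ℕ) * ω) : ℂ) := by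
  obtain ⟨c, hc⟩ := (Submodule.mem_span_range_iff_exists_fun ℂ).1 hh
  refine ⟨c, ?_⟩
  rw [← hc]
  ext ω
  simp

lemma cos_mem_cosSpan {N k : ℕ} (hk : k < N) :
    (fun ω : ℝ => (Real.cos (k * ω) : ℂ)) ∈ cosSpan N :=
  Submodule.subset_span ⟨⟨k, hk⟩, rfl⟩

lemma cosSpan_mono {N K : ℕ} (h : N ≤ K) : cosSpan N ≤ cosSpan K := by
  refine Submodule.span_le.2 ?_
  rintro _ ⟨k, rfl⟩
  exact cos_mem_cosSpan (k.2.trans_le h)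

/-- The discrete cosine transform recovers the coefficients of a cosine polynomial. -/
lemma sum_chebCoeff_mul_cos {N : ℕ} {h : ℝ → ℂ} (hh : h ∈ cosSpan N) (ω : ℝ) :
    ∑ k ∈ Finset.range N, chebCoeff N (fun j => h (chebNode N j)) k * (Real.cos (k * ω) : ℂ) =
      h ω := by
  obtain ⟨c, rfl⟩ := exists_of_mem_cosSpan hh
  rw [chebCoeff_sum N Finset.univ c (fun i j => (Real.cos ((i : ℕ) * chebNode N j) : ℂ))]
  simp_rw [Finset.sum_mul]
  rw [Finset.sum_comm]
  refine Finset.sum_congr rfl fun i _ => ?_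
  rw [Finset.sum_eq_single_of_mem (i : ℕ) (Finset.mem_range.2 i.2)]
  · rw [chebCoeff_cos i.2 i.2, if_pos rfl, mul_one]
  · intro k hk hki
    rw [chebCoeff_cos (Finset.mem_range.1 hk) i.2, if_neg hki]; simp

lemma chebCoeff_eq_zero {N K k : ℕ} {h : ℝ → ℂ} (hh : h ∈ cosSpan K) (hKk : K ≤ k) (hkN : k < N) :
    chebCoeff N (fun j => h (chebNode N j)) k = 0 := by
  obtain ⟨c, rfl⟩ := exists_of_mem_cosSpan hh
  rw [chebCoeff_sum N Finset.univ c (fun i j => (Real.cos ((i : ℕ) * chebNode N j) : ℂ))]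
  refine Finset.sum_eq_zero fun i _ => ?_
  have hi := i.2
  rw [chebCoeff_cos hkN (by omega), if_neg (by omega), mul_zero]

lemma cos_mul_mem_cosSpan {N : ℕ} {h : ℝ → ℂ} (hh : h ∈ cosSpan N) :
    (fun ω => (Real.cos ω : ℂ) * h ω) ∈ cosSpan (N + 1) := by
  obtain ⟨c, rfl⟩ := exists_of_mem_cosSpan hh
  have e : (fun ω : ℝ => (Real.cos ω : ℂ) * ∑ i, c i * (Real.cos ((i : ℕ) * ω) : ℂ)) =
      ∑ i, c i • fun ω : ℝ => ((Real.cos ω * Real.cos ((i : ℕ) * ω) : ℝ) : ℂ) := by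
    ext ω
    simp only [Finset.sum_apply, Pi.smul_apply, smul_eq_mul, Finset.mul_sum]
    refine Finset.sum_congr rfl fun i _ => ?_
    push_cast; ring
  rw [e]
  refine Submodule.sum_mem _ fun i _ => Submodule.smul_mem _ _ ?_
  rcases Nat.eq_zero_or_pos (i : ℕ) with h0 | h0
  · rw [h0]
    have := cos_mem_cosSpan (N := N + 1) (k := 1) (by have := i.2; omega)
    simpa using this
  · obtain ⟨k, hk⟩ : ∃ k, (i : ℕ) = k + 1 := ⟨i - 1, by omega⟩
    have hi := i.2
    have e2 : (fun ω : ℝ => ((Real.cos ω * Real.cos ((i : ℕ) * ω) : ℝ) : ℂ)) =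
        (1 / 2 : ℂ) • (fun ω : ℝ => (Real.cos ((k + 2 : ℕ) * ω) : ℂ)) +
        (1 / 2 : ℂ) • (fun ω : ℝ => (Real.cos (k * ω) : ℂ)) := by
      ext ω
      have h1 : Real.cos ω * Real.cos ((i : ℕ) * ω) =
          1 / 2 * Real.cos ((k + 2 : ℕ) * ω) + 1 / 2 * Real.cos (k * ω) := by
        rw [show ((k + 2 : ℕ) : ℝ) * ω = (i : ℕ) * ω + ω by rw [hk]; push_cast; ring,
          show (k : ℝ) * ω = (i : ℕ) * ω - ω by rw [hk]; push_cast; ring,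
          Real.cos_add, Real.cos_sub]
        ring
      rw [h1]
      simp
    rw [e2]
    exact Submodule.add_mem _ (Submodule.smul_mem _ _ (cos_mem_cosSpan (by omega)))
      (Submodule.smul_mem _ _ (cos_mem_cosSpan (by omega)))

lemma cos_pow_mem_cosSpan (d : ℕ) : (fun ω => (Real.cos ω : ℂ) ^ d) ∈ cosSpan (d + 1) := by
  induction d with
  | zero => simpa using cos_mem_cosSpan (N := 1) (k := 0) (by omega)
  | succ d ih =>
    have := cos_mul_mem_cosSpan ih
    simp_rw [pow_succ']
    exact this

lemma polynomial_mem_cosSpan {N : ℕ} {p : Polynomial ℝ} (hp : p.natDegree < N) :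
    (fun ω => ((p.eval (Real.cos ω) : ℝ) : ℂ)) ∈ cosSpan N := by
  have e : (fun ω : ℝ => ((p.eval (Real.cos ω) : ℝ) : ℂ)) =
      ∑ d ∈ Finset.range (p.natDegree + 1), (p.coeff d : ℂ) • fun ω => (Real.cos ω : ℂ) ^ d := by
    ext ω
    rw [Polynomial.eval_eq_sum_range]
    simp [Finset.sum_apply]
  rw [e]
  refine Submodule.sum_mem _ fun d hd => Submodule.smul_mem _ _ ?_
  rw [Finset.mem_range] at hd
  exact cosSpan_mono (by omega) (cos_pow_mem_cosSpan d)

/-! ### From cosine to exponential coefficients -/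

lemma sum_Ico_neg_succ (K : ℕ) (F : ℤ → ℂ) :
    ∑ κ ∈ Finset.Ico (-((K + 1 : ℕ) : ℤ)) ((K + 1 : ℕ) : ℤ), F κ =
      F (-((K + 1 : ℕ) : ℤ)) + F 0 +
        ∑ k ∈ Finset.range K, (F ((k + 1 : ℕ) : ℤ) + F (-((k + 1 : ℕ) : ℤ))) := by
  induction K with
  | zero =>
    rw [show Finset.Ico (-((0 + 1 : ℕ) : ℤ)) ((0 + 1 : ℕ) : ℤ) = {-1, 0} by rfl]
    simp
  | succ K ih =>
    have e : Finset.Ico (-((K + 1 + 1 : ℕ) : ℤ)) ((K + 1 + 1 : ℕ) : ℤ) =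
        insert (-((K + 1 + 1 : ℕ) : ℤ)) (insert ((K + 1 : ℕ) : ℤ)
          (Finset.Ico (-((K + 1 : ℕ) : ℤ)) ((K + 1 : ℕ) : ℤ))) := by
      ext x
      simp only [Finset.mem_Ico, Finset.mem_insert]
      omega
    rw [e, Finset.sum_insert (by simp only [Finset.mem_insert, Finset.mem_Ico]; omega),
      Finset.sum_insert (by simp), ih, Finset.sum_range_succ]
    ring

lemma exp_add_exp_neg (k : ℕ) (ω : ℝ) :
    Complex.exp (Complex.I * ((k : ℤ) : ℂ) * ω) + Complex.exp (Complex.I * ((-(k : ℤ) : ℤ) : ℂ) * ω)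
      = 2 * (Real.cos (k * ω) : ℂ) := by
  push_cast
  rw [Complex.two_cos]
  congr 2 <;> ring

lemma exp_sub_exp_neg (k : ℕ) (ω : ℝ) :
    Complex.exp (Complex.I * ((k : ℤ) : ℂ) * ω) - Complex.exp (Complex.I * ((-(k : ℤ) : ℤ) : ℂ) * ω)
      = 2 * Complex.I * (Real.sin (k * ω) : ℂ) := by
  push_cast
  have h := Complex.two_sin (k * ω : ℂ)
  rw [show Complex.I * (k : ℂ) * ω = k * ω * Complex.I by ring,
    show Complex.I * (-(k : ℂ)) * ω = -(k * ω) * Complex.I by ring]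
  linear_combination (-Complex.I) * h + (Complex.exp (k * ω * Complex.I) -
    Complex.exp (-(k * ω) * Complex.I)) * Complex.I_sq

lemma sum_cosToExp {B : ℕ} (hB : 1 ≤ B) (a : ℕ → ℂ) (ω : ℝ) :
    ∑ κ ∈ Finset.Ico (-((2 * B : ℕ) : ℤ)) ((2 * B : ℕ) : ℤ),
      cosToExp B a κ * Complex.exp (Complex.I * κ * ω) =
      ∑ k ∈ Finset.range (2 * B), a k * (Real.cos (k * ω) : ℂ) := by
  obtain ⟨K, hK⟩ : ∃ K, 2 * B = K + 1 := ⟨2 * B - 1, by omega⟩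
  have h0 : cosToExp B a (-((K + 1 : ℕ) : ℤ)) = 0 := by
    unfold cosToExp
    rw [if_neg (by omega), if_neg (by omega)]
  rw [hK, sum_Ico_neg_succ, Finset.sum_range_succ', h0]
  have h1 : ∀ k ∈ Finset.range K, cosToExp B a ((k + 1 : ℕ) : ℤ) *
      Complex.exp (Complex.I * (((k + 1 : ℕ) : ℤ) : ℂ) * ω) +
      cosToExp B a (-((k + 1 : ℕ) : ℤ)) *
      Complex.exp (Complex.I * ((-((k + 1 : ℕ) : ℤ) : ℤ) : ℂ) * ω) =
      a (k + 1) * (Real.cos ((k + 1 : ℕ) * ω) : ℂ) := by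
    intro k hk
    rw [Finset.mem_range] at hk
    have e1 : cosToExp B a ((k + 1 : ℕ) : ℤ) = a (k + 1) / 2 := by
      unfold cosToExp
      rw [if_neg (by omega), if_pos (by omega), Int.natAbs_natCast]
    have e2 : cosToExp B a (-((k + 1 : ℕ) : ℤ)) = a (k + 1) / 2 := by
      unfold cosToExp
      rw [if_neg (by omega), if_pos (by omega), Int.natAbs_neg, Int.natAbs_natCast]
    rw [e1, e2, ← mul_add, exp_add_exp_neg]
    ring
  rw [Finset.sum_congr rfl h1]
  have e0 : cosToExp B a 0 = a 0 := by unfold cosToExp; rw [if_pos rfl]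
  rw [e0]
  simp
  ring

lemma sin_mul_sum_cos (K : ℕ) (a : ℕ → ℂ) (ω : ℝ) :
    2 * ((Real.sin ω : ℂ) * ∑ k ∈ Finset.range (K + 1), a k * (Real.cos (k * ω) : ℂ)) =
      a 0 * (Real.sin ω : ℂ) + (∑ k ∈ Finset.range (K + 1), a k * (Real.sin ((k + 1 : ℕ) * ω) : ℂ)) -
        ∑ k ∈ Finset.range K, a (k + 1) * (Real.sin (k * ω) : ℂ) := by
  have h : ∀ k ∈ Finset.range K, 2 * ((Real.sin ω : ℂ) * (a (k + 1) *
      (Real.cos ((k + 1 : ℕ) * ω) : ℂ))) = a (k + 1) * (Real.sin ((k + 1 + 1 : ℕ) * ω) : ℂ) -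
        a (k + 1) * (Real.sin (k * ω) : ℂ) := by
    intro k _
    have e : 2 * (Real.sin ω * Real.cos ((k + 1 : ℕ) * ω)) =
        Real.sin ((k + 1 + 1 : ℕ) * ω) - Real.sin (k * ω) := by
      rw [show ((k + 1 + 1 : ℕ) : ℝ) * ω = (k + 1 : ℕ) * ω + ω by push_cast; ring,
        show (k : ℝ) * ω = (k + 1 : ℕ) * ω - ω by push_cast; ring, Real.sin_add, Real.sin_sub]
      ring
    have e' : (2 : ℂ) * ((Real.sin ω : ℂ) * (Real.cos ((k + 1 : ℕ) * ω) : ℂ)) =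
        (Real.sin ((k + 1 + 1 : ℕ) * ω) : ℂ) - (Real.sin (k * ω) : ℂ) := by exact_mod_cast e
    linear_combination a (k + 1) * e'
  rw [Finset.sum_range_succ', Finset.sum_range_succ' _ K, mul_add, mul_add, Finset.mul_sum,
    Finset.mul_sum, Finset.sum_congr rfl h, Finset.sum_sub_distrib]
  simp
  ring

/-- The top coefficient has to vanish, since `sin ω cos((2B - 1)ω)` has a frequency `2B`. -/
lemma sum_sinCosToExp {B : ℕ} (hB : 2 ≤ B) (a : ℕ → ℂ) (ha : a (2 * B - 1) = 0) (ω : ℝ) :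
    ∑ κ ∈ Finset.Ico (-((2 * B : ℕ) : ℤ)) ((2 * B : ℕ) : ℤ),
      sinCosToExp B a κ * Complex.exp (Complex.I * κ * ω) =
      (Real.sin ω : ℂ) * ∑ k ∈ Finset.range (2 * B), a k * (Real.cos (k * ω) : ℂ) := by
  obtain ⟨K, hK⟩ : ∃ K, 2 * B = K + 3 := ⟨2 * B - 3, by omega⟩
  rw [hK, show K + 3 - 1 = K + 2 by omega] at ha
  have hI := Complex.I_ne_zero
  -- twice the coefficient of `sin((k + 1)ω)` in the product
  set d : ℕ → ℂ := fun k => if k = 0 then 2 * a 0 - a 2 else if k < K then a k - a (k + 2) else a k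
    with hd
  have h0 : ∀ κ : ℤ, κ = 0 ∨ 2 * B ≤ κ.natAbs → sinCosToExp B a κ = 0 := by
    intro κ hκ
    unfold sinCosToExp
    rcases hκ with rfl | hκ
    · simp
    · rw [if_neg (by omega), if_neg (by omega), if_neg (by omega), if_neg (by omega), mul_zero]
  have hval : ∀ (κ : ℤ) (k : ℕ), κ.natAbs = k + 1 → k < K + 2 →
      sinCosToExp B a κ = ((Int.sign κ : ℤ) : ℂ) / (4 * Complex.I) * d k := by
    intro κ k hκ hk
    unfold sinCosToExp
    rw [if_neg (by omega), hκ, hd]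
    simp only
    congr 1
    by_cases hk0 : k = 0
    · rw [if_pos (by omega), if_pos hk0]
    · rw [if_neg (by omega), if_neg hk0]
      by_cases hk1 : k < K
      · rw [if_pos (by omega), if_pos hk1, show k + 1 - 1 = k by omega]
      · rw [if_neg (by omega), if_pos (by omega), if_neg hk1, show k + 1 - 1 = k by omega]
  have h1 : ∀ k ∈ Finset.range (K + 2), sinCosToExp B a ((k + 1 : ℕ) : ℤ) *
      Complex.exp (Complex.I * (((k + 1 : ℕ) : ℤ) : ℂ) * ω) +
      sinCosToExp B a (-((k + 1 : ℕ) : ℤ)) *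
      Complex.exp (Complex.I * ((-((k + 1 : ℕ) : ℤ) : ℤ) : ℂ) * ω) =
      d k / 2 * (Real.sin ((k + 1 : ℕ) * ω) : ℂ) := by
    intro k hk
    rw [Finset.mem_range] at hk
    rw [hval _ k (by omega) hk, hval _ k (by omega) hk, Int.sign_neg,
      Int.sign_eq_one_of_pos (by omega)]
    have e := exp_sub_exp_neg (k + 1) ω
    rw [show (((1 : ℤ)) : ℂ) = 1 by simp, show ((-1 : ℤ) : ℂ) = -1 by simp]
    calc _ = d k / (4 * Complex.I) * (Complex.exp (Complex.I * (((k + 1 : ℕ) : ℤ) : ℂ) * ω) -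
          Complex.exp (Complex.I * ((-((k + 1 : ℕ) : ℤ) : ℤ) : ℂ) * ω)) := by ring
      _ = _ := by
        rw [e]
        field_simp
        ring
  have hsum : ∑ k ∈ Finset.range (K + 2), d k * (Real.sin ((k + 1 : ℕ) * ω) : ℂ) =
      2 * ((Real.sin ω : ℂ) * ∑ k ∈ Finset.range (K + 3), a k * (Real.cos (k * ω) : ℂ)) := by
    obtain ⟨J, rfl⟩ : ∃ J, K = J + 1 := ⟨K - 1, by omega⟩
    have hd0 : d 0 = 2 * a 0 - a 2 := rfl
    have hd1 : ∀ k ∈ Finset.range J, d (k + 1) * (Real.sin ((k + 1 + 1 : ℕ) * ω) : ℂ) =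
        a (k + 1) * (Real.sin ((k + 1 + 1 : ℕ) * ω) : ℂ) -
          a (k + 1 + 1 + 1) * (Real.sin ((k + 1 + 1 : ℕ) * ω) : ℂ) := by
      intro k hk
      rw [Finset.mem_range] at hk
      rw [hd]
      simp only
      rw [if_neg (by omega), if_pos (by omega), sub_mul]
    have hd2 : d (J + 1) = a (J + 1) := by
      rw [hd]
      simp
    have hd3 : d (J + 1 + 1) = a (J + 1 + 1) := by
      rw [hd]
      simp
    rw [sin_mul_sum_cos, Finset.sum_range_succ _ (J + 1 + 2), ha, Finset.sum_range_succ,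
      Finset.sum_range_succ, Finset.sum_range_succ', Finset.sum_congr rfl hd1,
      Finset.sum_sub_distrib, Finset.sum_range_succ _ (J + 1 + 1), Finset.sum_range_succ _ (J + 1),
      Finset.sum_range_succ' _ J, Finset.sum_range_succ' _ (J + 1 + 1),
      Finset.sum_range_succ _ (J + 1), Finset.sum_range_succ' _ J, hd0, hd2, hd3, ha]
    simp only [Nat.cast_zero, Nat.cast_one, zero_mul, one_mul, zero_add, Real.sin_zero,
      Complex.ofReal_zero, mul_zero, add_zero]
    ring
  rw [hK, sum_Ico_neg_succ, h0 _ (Or.inr (by omega)), h0 _ (Or.inl rfl),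
    Finset.sum_congr rfl h1]
  simp_rw [div_mul_eq_mul_div]
  rw [← Finset.sum_div, hsum]
  ring

lemma cosToExp_sum {ι : Type*} (B : ℕ) (s : Finset ι) (c : ι → ℂ) (a : ι → ℕ → ℂ) (κ : ℤ) :
    cosToExp B (fun k => ∑ i ∈ s, c i * a i k) κ = ∑ i ∈ s, c i * cosToExp B (a i) κ := by
  unfold cosToExp
  split_ifs
  · rfl
  · rw [Finset.sum_div]; exact Finset.sum_congr rfl fun i _ => by ring
  · simp

lemma sinCosToExp_sum {ι : Type*} (B : ℕ) (s : Finset ι) (c : ι → ℂ) (a : ι → ℕ → ℂ) (κ : ℤ) :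
    sinCosToExp B (fun k => ∑ i ∈ s, c i * a i k) κ = ∑ i ∈ s, c i * sinCosToExp B (a i) κ := by
  unfold sinCosToExp
  split_ifs
  · simp
  · rw [Finset.mul_sum, ← Finset.sum_sub_distrib, Finset.mul_sum]
    exact Finset.sum_congr rfl fun i _ => by ring
  · rw [← Finset.sum_sub_distrib, Finset.mul_sum]
    exact Finset.sum_congr rfl fun i _ => by ring
  · rw [Finset.mul_sum]
    exact Finset.sum_congr rfl fun i _ => by ring
  · simp

/-- The coefficients of a trigonometric polynomial are bounded by its supremum. -/
lemma norm_coeff_le_of_trigPoly_le {s : Finset ℤ} {c : ℤ → ℂ} {M : ℝ}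
    (h : ∀ ω : ℝ, ‖∑ κ ∈ s, c κ * Complex.exp (Complex.I * κ * ω)‖ ≤ M) {κ : ℤ} (hκ : κ ∈ s) :
    ‖c κ‖ ≤ M := by
  have hpi := Real.pi_pos
  have e : ∫ ω in (0 : ℝ)..2 * Real.pi, (∑ κ' ∈ s, c κ' * Complex.exp (Complex.I * κ' * ω)) *
      Complex.exp (-(Complex.I * κ * ω)) = 2 * Real.pi * c κ := by
    have h1 : ∀ ω : ℝ, (∑ κ' ∈ s, c κ' * Complex.exp (Complex.I * κ' * ω)) *
      Complex.exp (-(Complex.I * κ * ω)) =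
      ∑ κ' ∈ s, c κ' * Complex.exp (Complex.I * (κ' - κ : ℤ) * ω) := by
      intro ω
      rw [Finset.sum_mul]
      refine Finset.sum_congr rfl fun κ' _ => ?_
      rw [mul_assoc, ← Complex.exp_add]
      congr 2
      push_cast; ring
    simp_rw [h1]
    rw [intervalIntegral.integral_finsetSum
      (fun κ' _ => (by fun_prop : Continuous _).intervalIntegrable _ _)]
    simp_rw [intervalIntegral.integral_const_mul, integral_exp_int]
    rw [Finset.sum_eq_single_of_mem κ hκ]
    · simp; ring
    · intro κ' _ hne
      rw [if_neg (by omega), Complex.ofReal_zero, mul_zero]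
  have h2 := intervalIntegral.norm_integral_le_of_norm_le_const (a := 0) (b := 2 * Real.pi)
    (f := fun ω : ℝ => (∑ κ' ∈ s, c κ' * Complex.exp (Complex.I * κ' * ω)) *
      Complex.exp (-(Complex.I * κ * ω))) (C := M) (fun ω _ => by
        rw [norm_mul, show -(Complex.I * κ * ω) = Complex.I * ((-(κ * ω) : ℝ) : ℂ) by
          push_cast; ring, Complex.norm_exp_I_mul_ofReal, mul_one]
        exact h ω)
  rw [e, norm_mul, norm_mul, sub_zero, abs_of_pos (by positivity), Complex.norm_real,
    Real.norm_of_nonneg hpi.le, Complex.norm_ofNat, mul_comm M] at h2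
  exact le_of_mul_le_mul_left h2 (by positivity)

/-! ### The trigonometric polynomial handed to the NFFT -/

open Polynomial in
/-- The normalized radial function as a polynomial in `ξ`, after substituting `r = ρ(1 + ξ)/2`. -/
noncomputable def radialPoly (ρ : ℝ) (n l : ℕ) : ℝ[X] :=
  C (radialNorm n l) * ((laguerrePoly (n - l - 1) ((l : ℝ) + 1 / 2)).comp
    ((C (ρ / 2) * (1 + X)) ^ 2) * (C (ρ / 2) * (1 + X)) ^ l)

lemma eval_radialPoly (ρ : ℝ) (n l : ℕ) (ξ : ℝ) :
    (radialPoly ρ n l).eval ξ = radialNorm n l * radialPart n l (ρ / 2 * (1 + ξ)) := by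
  simp [radialPoly, radialPart, eval_laguerrePoly]

open Polynomial in
lemma natDegree_radialPoly_lt {B n l : ℕ} (ρ : ℝ) (hl : l < n) (hn : n ≤ B) :
    (radialPoly ρ n l).natDegree < 2 * B := by
  have h1 : (C (ρ / 2) * (1 + X) : ℝ[X]).natDegree ≤ 1 := by
    refine (natDegree_C_mul_le _ _).trans ?_
    rw [add_comm, ← C_1, natDegree_X_add_C]
  have h2 : ((laguerrePoly (n - l - 1) ((l : ℝ) + 1 / 2)).comp
      ((C (ρ / 2) * (1 + X)) ^ 2)).natDegree ≤ (n - l - 1) * 2 := by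
    refine natDegree_comp_le.trans (Nat.mul_le_mul (natDegree_laguerrePoly_le _ _) ?_)
    refine natDegree_pow_le.trans ?_
    omega
  have h3 : ((C (ρ / 2) * (1 + X) : ℝ[X]) ^ l).natDegree ≤ l := by
    refine natDegree_pow_le.trans ?_
    nlinarith
  have h4 : (radialPoly ρ n l).natDegree ≤ (n - l - 1) * 2 + l :=
    (natDegree_C_mul_le _ _).trans (natDegree_mul_le.trans (Nat.add_le_add h2 h3))
  omega

open Polynomial in
/-- The normalized associated Legendre function of `cos ω`, divided by `sin ω` if `m` is odd, as a
polynomial in `cos ω`. -/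
noncomputable def evenPolarPoly (l : ℕ) (m : ℤ) : ℝ[X] :=
  (1 - X ^ 2) ^ (m.natAbs / 2) * polarPoly l m

open Polynomial in
lemma natDegree_evenPolarPoly_le {l : ℕ} {m : ℤ} (hm : m.natAbs ≤ l) :
    (evenPolarPoly l m).natDegree ≤ l := by
  have h1 : ((1 - X ^ 2 : ℝ[X]) ^ (m.natAbs / 2)).natDegree ≤ (m.natAbs / 2) * 2 := by
    refine natDegree_pow_le.trans (Nat.mul_le_mul_left _ ?_)
    rw [← natDegree_neg, neg_sub, ← C_1, natDegree_X_pow_sub_C]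
  have h2 := natDegree_polarPoly_le hm
  refine natDegree_mul_le.trans ?_
  omega

lemma sin_pow_mul_polarPoly (l : ℕ) (m : ℤ) (ω : ℝ) :
    Real.sin ω ^ m.natAbs * (polarPoly l m).eval (Real.cos ω) =
      Real.sin ω ^ (m.natAbs % 2) * (evenPolarPoly l m).eval (Real.cos ω) := by
  have hsq : 1 - Real.cos ω ^ 2 = Real.sin ω ^ 2 := by linarith [Real.sin_sq_add_cos_sq ω]
  rw [evenPolarPoly, Polynomial.eval_mul, Polynomial.eval_pow]
  simp only [Polynomial.eval_sub, Polynomial.eval_one, Polynomial.eval_pow, Polynomial.eval_X]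
  rw [hsq, ← pow_mul, ← mul_assoc, ← pow_add, Nat.mod_add_div]

/-- The exponential coefficients of the radial factor of a single basis function. -/
noncomputable def radialExp (B : ℕ) (ρ : ℝ) (n l : ℕ) : ℤ → ℂ :=
  cosToExp B (chebCoeff (2 * B) fun j =>
    (((radialPoly ρ n l).eval (Real.cos (chebNode (2 * B) j)) : ℝ) : ℂ))

/-- The exponential coefficients of the polar factor of a single basis function. -/
noncomputable def polarExp (B l : ℕ) (m : ℤ) (κ : ℤ) : ℂ :=
  if Even m then cosToExp B (chebCoeff (2 * B) fun j =>
    (((evenPolarPoly l m).eval (Real.cos (chebNode (2 * B) j)) : ℝ) : ℂ)) κ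
  else sinCosToExp B (chebCoeff (2 * B) fun j =>
    (((evenPolarPoly l m).eval (Real.cos (chebNode (2 * B) j)) : ℝ) : ℂ)) κ

lemma sum_radialExp {B n l : ℕ} (ρ : ℝ) (hl : l < n) (hn : n ≤ B) (ω : ℝ) :
    ∑ κ ∈ Finset.Ico (-((2 * B : ℕ) : ℤ)) ((2 * B : ℕ) : ℤ),
      radialExp B ρ n l κ * Complex.exp (Complex.I * κ * ω) =
      (((radialPoly ρ n l).eval (Real.cos ω) : ℝ) : ℂ) := by
  unfold radialExp
  rw [sum_cosToExp (by omega)]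
  have hmem := polynomial_mem_cosSpan (N := 2 * B) (p := radialPoly ρ n l)
    (natDegree_radialPoly_lt ρ hl hn)
  rw [sum_chebCoeff_mul_cos hmem ω]

lemma sum_polarExp {B l : ℕ} {m : ℤ} (hB : 2 ≤ B) (hm : m.natAbs ≤ l) (hl : l < B) (ω : ℝ) :
    ∑ κ ∈ Finset.Ico (-((2 * B : ℕ) : ℤ)) ((2 * B : ℕ) : ℤ),
      polarExp B l m κ * Complex.exp (Complex.I * κ * ω) =
      ((Real.sin ω ^ m.natAbs * (polarPoly l m).eval (Real.cos ω) : ℝ) : ℂ) := by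
  have hdeg := natDegree_evenPolarPoly_le hm
  have hmem := polynomial_mem_cosSpan (N := 2 * B) (p := evenPolarPoly l m) (by omega)
  rw [sin_pow_mul_polarPoly]
  unfold polarExp
  by_cases h : Even m
  · simp only [if_pos h]
    rw [sum_cosToExp (by omega), sum_chebCoeff_mul_cos hmem ω,
      Nat.even_iff.1 (Int.natAbs_even.2 h), pow_zero, one_mul]
  · simp only [if_neg h]
    rw [sum_sinCosToExp hB, sum_chebCoeff_mul_cos hmem ω,
      Nat.odd_iff.1 (Int.natAbs_odd.2 (Int.not_even_iff_odd.1 h)), pow_one]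
    · push_cast; rfl
    · have hmem' := polynomial_mem_cosSpan (N := 2 * B - 1) (p := evenPolarPoly l m) (by omega)
      have hz := chebCoeff_eq_zero (N := 2 * B) hmem' le_rfl (by omega)
      exact hz

lemma radialCoeff_eq (B : ℕ) (ρ : ℝ) (fhat : ℕ → ℕ → ℤ → ℂ) (κ : ℤ) (l : ℕ) (m : ℤ) :
    radialCoeff B ρ fhat κ l m =
      ∑ n ∈ Finset.Icc (l + 1) B, fhat n l m * radialExp B ρ n l κ := by
  unfold radialCoeff radialExp
  rw [← cosToExp_sum, ← chebCoeff_sum]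
  simp only [eval_radialPoly]
  rfl

lemma polarCoeff_eq (B : ℕ) (ρ : ℝ) (fhat : ℕ → ℕ → ℤ → ℂ) (κ₀ κ₁ m : ℤ) :
    polarCoeff B ρ fhat κ₀ κ₁ m =
      ∑ l ∈ Finset.Ico m.natAbs B, radialCoeff B ρ fhat κ₀ l m * polarExp B l m κ₁ := by
  have hval : ∀ l ∈ Finset.Ico m.natAbs B, ∀ j < 2 * B,
      sphericalNorm l m * assocLegendre l m (Real.cos (chebNode (2 * B) j)) =
      Real.sin (chebNode (2 * B) j) ^ (m.natAbs % 2) *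
        (evenPolarPoly l m).eval (Real.cos (chebNode (2 * B) j)) := by
    intro l hl j hj
    rw [sphericalNorm_mul_assocLegendre (Finset.mem_Ico.1 hl).1
      (Set.Ioo_subset_Icc_self (chebNode_mem_Ioo hj)), sin_pow_mul_polarPoly]
  unfold polarCoeff polarExp
  by_cases h : Even m
  · simp only [if_pos h]
    rw [← cosToExp_sum, ← chebCoeff_sum]
    congr 1
    refine chebCoeff_congr fun j hj => ?_
    refine Finset.sum_congr rfl fun l hl => ?_
    rw [hval l hl j hj, Nat.even_iff.1 (Int.natAbs_even.2 h), pow_zero, one_mul]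
  · simp only [if_neg h]
    rw [← sinCosToExp_sum, ← chebCoeff_sum]
    congr 1
    refine chebCoeff_congr fun j hj => ?_
    have hs : (Real.sin (chebNode (2 * B) j) : ℂ) ≠ 0 := by
      exact_mod_cast (Real.sin_pos_of_mem_Ioo (chebNode_mem_Ioo hj)).ne'
    rw [polarSample, Finset.mul_sum]
    refine Finset.sum_congr rfl fun l hl => ?_
    rw [hval l hl j hj, Nat.odd_iff.1 (Int.natAbs_odd.2 (Int.not_even_iff_odd.1 h)), pow_one,
      Complex.ofReal_mul]
    field_simp

lemma sum_grid_three {E : Type*} [AddCommMonoid E] (B : ℕ) (F : ℤ → ℤ → ℤ → E) :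
    ∑ k ∈ grid 3 (4 * B), F (k 0) (k 1) (k 2) =
      ∑ a ∈ Finset.Ico (-((2 * B : ℕ) : ℤ)) ((2 * B : ℕ) : ℤ),
      ∑ b ∈ Finset.Ico (-((2 * B : ℕ) : ℤ)) ((2 * B : ℕ) : ℤ),
      ∑ c ∈ Finset.Ico (-((2 * B : ℕ) : ℤ)) ((2 * B : ℕ) : ℤ), F a b c := by
  have hhalf : ((4 * B : ℕ) : ℤ) / 2 = ((2 * B : ℕ) : ℤ) := by omega
  unfold grid
  rw [hhalf]
  set s := Finset.Ico (-((2 * B : ℕ) : ℤ)) ((2 * B : ℕ) : ℤ)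
  simp_rw [← Finset.sum_product']
  rw [Finset.sum_product' (f := fun a (p : ℤ × ℤ) => F a p.1 p.2), ← Finset.sum_product']
  refine Finset.sum_nbij' (fun k => (k 0, k 1, k 2)) (fun p => ![p.1, p.2.1, p.2.2])
    (fun k hk => ?_) (fun p hp => ?_) (fun k _ => ?_) (fun p _ => ?_) (fun k _ => ?_)
  · rw [Fintype.mem_piFinset] at hk
    simp [hk]
  · simp only [Finset.mem_product] at hp
    rw [Fintype.mem_piFinset]
    intro j
    fin_cases j <;> simp [hp]
  · ext j
    fin_cases j <;> rfl
  · rfl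
  · rfl

/-- The two orders of summation over `|m| ≤ l < n ≤ B`. -/
lemma sum_index_comm {E : Type*} [AddCommMonoid E] (B : ℕ) (F : ℕ → ℕ → ℤ → E) :
    ∑ n ∈ Finset.Icc 1 B, ∑ l ∈ Finset.range n, ∑ m ∈ Finset.Icc (-(l : ℤ)) l, F n l m =
      ∑ m ∈ Finset.Ioo (-(B : ℤ)) B, ∑ l ∈ Finset.Ico m.natAbs B,
        ∑ n ∈ Finset.Icc (l + 1) B, F n l m := by
  rw [Finset.sum_comm' (t' := Finset.range B) (s' := fun l => Finset.Icc (l + 1) B)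
    (fun n l => by simp only [Finset.mem_Icc, Finset.mem_range]; omega)]
  rw [Finset.sum_congr rfl fun l _ => Finset.sum_comm]
  rw [Finset.sum_comm' (t' := Finset.Ioo (-(B : ℤ)) B) (s' := fun m => Finset.Ico m.natAbs B)
    (fun l m => by simp only [Finset.mem_Icc, Finset.mem_range, Finset.mem_Ioo, Finset.mem_Ico]
                   omega)]

lemma nfftInput_eq (B : ℕ) (ρ : ℝ) (fhat : ℕ → ℕ → ℤ → ℂ) (k : Fin 3 → ℤ) :
    nfftInput B ρ fhat k = if (k 2).natAbs < B then
      ∑ l ∈ Finset.Ico (k 2).natAbs B, ∑ n ∈ Finset.Icc (l + 1) B,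
        fhat n l (k 2) * radialExp B ρ n l (k 0) * polarExp B l (k 2) (k 1) else 0 := by
  unfold nfftInput
  rw [polarCoeff_eq]
  simp_rw [radialCoeff_eq, Finset.sum_mul]

lemma sum_ite_natAbs_lt {E : Type*} [AddCommMonoid E] (B : ℕ) (F : ℤ → E) :
    ∑ c ∈ Finset.Ico (-((2 * B : ℕ) : ℤ)) ((2 * B : ℕ) : ℤ), (if c.natAbs < B then F c else 0) =
      ∑ c ∈ Finset.Ioo (-(B : ℤ)) B, F c := by
  rw [← Finset.sum_filter]
  refine Finset.sum_congr ?_ fun _ _ => rfl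
  ext c
  simp only [Finset.mem_filter, Finset.mem_Ico, Finset.mem_Ioo]
  omega

lemma sum_comm_index {E : Type*} [AddCommMonoid E] (s : Finset ℤ) (B : ℕ)
    (F : ℤ → ℤ → ℕ → ℕ → ℤ → E) :
    ∑ a ∈ s, ∑ b ∈ s, ∑ m ∈ Finset.Ioo (-(B : ℤ)) B, ∑ l ∈ Finset.Ico m.natAbs B,
      ∑ n ∈ Finset.Icc (l + 1) B, F a b n l m =
    ∑ n ∈ Finset.Icc 1 B, ∑ l ∈ Finset.range n, ∑ m ∈ Finset.Icc (-(l : ℤ)) l,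
      ∑ a ∈ s, ∑ b ∈ s, F a b n l m := by
  rw [sum_index_comm, ← Finset.sum_product' s s (fun a b => ∑ m ∈ Finset.Ioo (-(B : ℤ)) B,
    ∑ l ∈ Finset.Ico m.natAbs B, ∑ n ∈ Finset.Icc (l + 1) B, F a b n l m), Finset.sum_comm]
  refine Finset.sum_congr rfl fun m _ => ?_
  rw [Finset.sum_comm]
  refine Finset.sum_congr rfl fun l _ => ?_
  rw [Finset.sum_comm]
  exact Finset.sum_congr rfl fun n _ => Finset.sum_product' s s fun a b => F a b n l m

/-- Before the NFFT all steps of the algorithm are exact. -/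
lemma sum_nfftInput_eq_bandlimited {B : ℕ} (hB : 2 ≤ B) {ρ : ℝ} (hρ : 0 < ρ)
    (fhat : ℕ → ℕ → ℤ → ℂ) (x : SphericalPoint) (hx : x.r ≤ ρ) :
    ∑ k ∈ grid 3 (4 * B), nfftInput B ρ fhat k *
      ∏ j, Complex.exp (Complex.I * (k j * transformedPoint ρ x j : ℝ)) =
      bandlimited B fhat x := by
  set t0 := Real.arccos ((2 * x.r - ρ) / ρ) with ht0
  have hcos : ρ / 2 * (1 + Real.cos t0) = x.r := by
    have hr := x.r_nonneg
    rw [ht0, Real.cos_arccos]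
    · field_simp; ring
    · rw [le_div_iff₀ hρ]; linarith
    · rw [div_le_iff₀ hρ]; linarith
  set F : ℤ → ℤ → ℤ → ℂ := fun a b c => if c.natAbs < B then ∑ l ∈ Finset.Ico c.natAbs B,
        ∑ n ∈ Finset.Icc (l + 1) B, fhat n l c *
          ((radialExp B ρ n l a * Complex.exp (Complex.I * a * t0)) *
          (polarExp B l c b * Complex.exp (Complex.I * b * x.θ))) *
          Complex.exp (Complex.I * c * x.φ) else 0 with hF
  have e : ∀ k ∈ grid 3 (4 * B), nfftInput B ρ fhat k *
      ∏ j, Complex.exp (Complex.I * (k j * transformedPoint ρ x j : ℝ)) =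
      F (k 0) (k 1) (k 2) := by
    intro k _
    rw [nfftInput_eq, Fin.prod_univ_three, hF]
    simp only [transformedPoint, Matrix.cons_val_zero, Matrix.cons_val_one, Matrix.cons_val]
    rw [ite_mul, zero_mul]
    congr 1
    simp_rw [Finset.sum_mul]
    refine Finset.sum_congr rfl fun l _ => Finset.sum_congr rfl fun n _ => ?_
    push_cast
    rw [← mul_assoc Complex.I, ← mul_assoc Complex.I, ← mul_assoc Complex.I]
    ring
  rw [Finset.sum_congr rfl e, sum_grid_three B F, hF]
  simp only [sum_ite_natAbs_lt]
  rw [sum_comm_index (F := fun a b n l m => fhat n l m *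
          ((radialExp B ρ n l a * Complex.exp (Complex.I * a * t0)) *
          (polarExp B l m b * Complex.exp (Complex.I * b * x.θ))) *
          Complex.exp (Complex.I * m * x.φ))]
  unfold bandlimited
  refine Finset.sum_congr rfl fun n hn => Finset.sum_congr rfl fun l hl =>
    Finset.sum_congr rfl fun m hm => ?_
  rw [Finset.mem_Icc] at hn hm
  rw [Finset.mem_range] at hl
  simp_rw [← Finset.sum_mul, ← Finset.mul_sum]
  rw [← Finset.sum_mul, sum_polarExp hB (by omega) (by omega), sum_radialExp ρ hl hn.2,
    ← sphericalNorm_mul_assocLegendre (by omega) x.θ_mem, eval_radialPoly, hcos, sglBasis,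
    sphericalHarmonic]
  push_cast
  ring

lemma norm_radialExp_le {B n l : ℕ} {ρ M : ℝ} (hl : l < n) (hn : n ≤ B)
    (hM : ∀ r, 0 ≤ r → r ≤ ρ → |radialNorm n l * radialPart n l r| ≤ M) (hρ : 0 < ρ) {κ : ℤ}
    (hκ : κ ∈ Finset.Ico (-((2 * B : ℕ) : ℤ)) ((2 * B : ℕ) : ℤ)) :
    ‖radialExp B ρ n l κ‖ ≤ M := by
  refine norm_coeff_le_of_trigPoly_le (fun ω => ?_) hκ
  rw [sum_radialExp ρ hl hn, Complex.norm_real, Real.norm_eq_abs, eval_radialPoly]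
  have h1 := Real.neg_one_le_cos ω
  have h2 := Real.cos_le_one ω
  exact hM _ (by have : 0 ≤ 1 + Real.cos ω := by linarith
                 positivity) (by nlinarith)

lemma norm_polarExp_le {B l : ℕ} {m : ℤ} (hB : 2 ≤ B) (hm : m.natAbs ≤ l) (hl : l < B) {κ : ℤ}
    (hκ : κ ∈ Finset.Ico (-((2 * B : ℕ) : ℤ)) ((2 * B : ℕ) : ℤ)) :
    ‖polarExp B l m κ‖ ≤ Real.sqrt B := by
  refine norm_coeff_le_of_trigPoly_le (fun ω => ?_) hκ
  rw [sum_polarExp hB hm hl, Complex.norm_real, Real.norm_eq_abs]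
  refine (abs_sin_pow_mul_polarPoly_le hm ω).trans (Real.sqrt_le_sqrt ?_)
  have hl' : (l : ℝ) + 1 ≤ B := by exact_mod_cast hl
  have h0 : (0 : ℝ) ≤ l := l.cast_nonneg
  rw [div_le_iff₀ (by positivity)]
  nlinarith [Real.pi_gt_three]

/-- The 1-norm of the coefficients handed to the NFFT. -/
lemma sum_norm_nfftInput_le {B : ℕ} (hB : 2 ≤ B) {ρ M : ℝ} (hρ : 0 < ρ)
    (hM : ∀ n l, l < n → n ≤ B → ∀ r, 0 ≤ r → r ≤ ρ → |radialNorm n l * radialPart n l r| ≤ M)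
    (fhat : ℕ → ℕ → ℤ → ℂ) :
    ∑ k ∈ grid 3 (4 * B), ‖nfftInput B ρ fhat k‖ ≤
      16 * B ^ 2 * Real.sqrt B * M * coeffNorm B fhat := by
  set s := Finset.Ico (-((2 * B : ℕ) : ℤ)) ((2 * B : ℕ) : ℤ) with hs
  have hcard : (s.card : ℝ) = 4 * B := by
    rw [hs, Int.card_Ico, show ((((2 * B : ℕ) : ℤ)) - (-((2 * B : ℕ) : ℤ))).toNat = 4 * B by omega]
    push_cast; ring
  set F : ℤ → ℤ → ℤ → ℝ := fun a b c => if c.natAbs < B then ∑ l ∈ Finset.Ico c.natAbs B,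
        ∑ n ∈ Finset.Icc (l + 1) B,
          ‖fhat n l c‖ * (‖radialExp B ρ n l a‖ * ‖polarExp B l c b‖) else 0 with hF
  have e : ∀ k ∈ grid 3 (4 * B), ‖nfftInput B ρ fhat k‖ ≤ F (k 0) (k 1) (k 2) := by
    intro k _
    rw [nfftInput_eq, hF]
    simp only
    split_ifs
    · refine (norm_sum_le _ _).trans (Finset.sum_le_sum fun l _ =>
        (norm_sum_le _ _).trans (Finset.sum_le_sum fun n _ => ?_))
      rw [norm_mul, norm_mul, mul_assoc]
    · rw [norm_zero]
  refine (Finset.sum_le_sum e).trans ?_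
  rw [sum_grid_three B F, hF]
  simp only [sum_ite_natAbs_lt]
  rw [sum_comm_index (F := fun a b n l m =>
    ‖fhat n l m‖ * (‖radialExp B ρ n l a‖ * ‖polarExp B l m b‖))]
  unfold coeffNorm
  simp_rw [Finset.mul_sum]
  refine Finset.sum_le_sum fun n hn => Finset.sum_le_sum fun l hl =>
    Finset.sum_le_sum fun m hm => ?_
  rw [Finset.mem_Icc] at hn hm
  rw [Finset.mem_range] at hl
  have hM0 : 0 ≤ M := (abs_nonneg _).trans (hM n l hl hn.2 0 le_rfl hρ.le)
  calc ∑ a ∈ s, ∑ b ∈ s, ‖fhat n l m‖ * (‖radialExp B ρ n l a‖ * ‖polarExp B l m b‖)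
      ≤ ∑ a ∈ s, ∑ b ∈ s, ‖fhat n l m‖ * (M * Real.sqrt B) := by
        refine Finset.sum_le_sum fun a ha => Finset.sum_le_sum fun b hb => ?_
        gcongr
        · exact norm_radialExp_le hl hn.2 (hM n l hl hn.2) hρ ha
        · exact norm_polarExp_le hB (by omega) (by omega) hb
    _ = 16 * B ^ 2 * Real.sqrt B * M * ‖fhat n l m‖ := by
        simp only [Finset.sum_const, nsmul_eq_mul, hcard]
        ring

/-! ### The error estimates -/

lemma coeffNorm_nonneg (B : ℕ) (fhat : ℕ → ℕ → ℤ → ℂ) : 0 ≤ coeffNorm B fhat :=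
  Finset.sum_nonneg fun _ _ => Finset.sum_nonneg fun _ _ => Finset.sum_nonneg fun _ _ =>
    norm_nonneg _

lemma errorFactor_nonneg (B q : ℕ) (ρ : ℝ) {a : ℝ} (b : ℝ) (ha : 0 ≤ a) :
    0 ≤ errorFactor B q ρ a b := by
  unfold errorFactor; positivity

/-- The error estimate for a general pair `(s, t)`, to be used with `(ρ, ρ⁻¹)` and `(1, 1)`. -/
lemma maxError_le {B σ q : ℕ} {ρ s t : ℝ} (hB : 2 ≤ B) (hσ : 2 ≤ σ) (hq : 1 ≤ q) (hρ : 0 < ρ)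
    (hs : 0 < s) (ht : 0 ≤ t)
    (hst : ∀ (l : ℕ) (r : ℝ), 0 ≤ r → r ≤ ρ → r ^ l ≤ s ^ (l + 1) * t)
    {M : ℕ} (x : Fin M → SphericalPoint) (hx : ∀ i, (x i).r ≤ ρ) (fhat : ℕ → ℕ → ℤ → ℂ) :
    maxError B σ q ρ x fhat ≤ 96 * nfftConst *
      errorFactor B q ρ t (Real.exp (2 / Real.exp 1) / 2 * s ^ (2 / Real.exp 1)) *
        coeffNorm B fhat := by
  have hc := coeffNorm_nonneg B fhat
  have hk := nfftConst_pos
  have hef := errorFactor_nonneg B q ρ (Real.exp (2 / Real.exp 1) / 2 * s ^ (2 / Real.exp 1)) ht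
  have hB0 : (0 : ℝ) < B := by exact_mod_cast (by omega : 0 < B)
  refine Real.iSup_le (fun i => ?_) (by positivity)
  rw [nfsglft, ← sum_nfftInput_eq_bandlimited hB hρ fhat (x i) (hx i)]
  refine (norm_trigPoly_sub_nfft_le (by omega) ⟨2 * B, by ring⟩ hσ hq _ _).trans ?_
  have h := sum_norm_nfftInput_le hB hρ (fun n l hl hn r hr hrρ =>
    abs_radial_le hl hn hr hrρ hs ht (hst l r hr hrρ)) fhat
  have hpow : (B : ℝ) ^ (7 / 2 : ℝ) = B ^ 3 * Real.sqrt B := by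
    rw [Real.sqrt_eq_rpow, ← Real.rpow_natCast, ← Real.rpow_add hB0]
    norm_num
  refine (mul_le_mul_of_nonneg_left h (by positivity)).trans_eq ?_
  calc _ = 96 * nfftConst * (B ^ 3 * Real.sqrt B * t * (Real.exp (Real.exp (2 / Real.exp 1) / 2 *
          s ^ (2 / Real.exp 1) * ((B : ℝ) + 1 / 2) ^ (1 - 1 / Real.exp 1) + ρ ^ 2 / 2) *
          Real.exp (-(q * Real.pi / 2)))) * coeffNorm B fhat := by ring
    _ = _ := by
      rw [← Real.exp_add, errorFactor, hpow, ← sub_eq_add_neg]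

lemma maxError_le_of_lt_one {B σ q : ℕ} {ρ : ℝ} (hB : 2 ≤ B) (hσ : 2 ≤ σ) (hq : 1 ≤ q)
    (hρ : 0 < ρ) (hρ1 : ρ < 1) {M : ℕ} (x : Fin M → SphericalPoint) (hx : ∀ i, (x i).r ≤ ρ)
    (fhat : ℕ → ℕ → ℤ → ℂ) :
    maxError B σ q ρ x fhat ≤ 96 * nfftConst *
      errorFactor B q ρ 1 (Real.exp (2 / Real.exp 1) / 2) * coeffNorm B fhat := by
  have h := maxError_le hB hσ hq hρ one_pos zero_le_one (fun l r hr hrρ => by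
    rw [one_pow, one_mul]; exact pow_le_one₀ hr (hrρ.trans hρ1.le)) x hx fhat
  rwa [Real.one_rpow, mul_one] at h

/-- The error estimate with the constants `a_{ρ,B}` and `b_{ρ,B}`. -/
lemma maxError_le_aCoeff_bCoeff {B σ q : ℕ} {ρ : ℝ} (hB : 2 ≤ B) (hσ : 2 ≤ σ) (hq : 1 ≤ q)
    (hρ : 0 < ρ) {M : ℕ} (x : Fin M → SphericalPoint) (hx : ∀ i, (x i).r ≤ ρ)
    (fhat : ℕ → ℕ → ℤ → ℂ) :
    maxError B σ q ρ x fhat ≤ 96 * nfftConst *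
      errorFactor B q ρ (aCoeff ρ B) (bCoeff ρ B) * coeffNorm B fhat := by
  unfold aCoeff bCoeff
  by_cases h : ρ < 1 ∧ (B : ℝ) ≤ Ω ρ
  · simp only [if_pos h, mul_one]
    exact maxError_le_of_lt_one hB hσ hq hρ h.1 x hx fhat
  · simp only [if_neg h]
    refine maxError_le hB hσ hq hρ hρ (inv_nonneg.2 hρ.le) (fun l r hr hrρ => ?_) x hx fhat
    rw [pow_succ, mul_assoc, mul_inv_cancel₀ hρ.ne', mul_one]
    gcongr

lemma aCoeff_nonneg {ρ : ℝ} (hρ : 0 < ρ) (B : ℕ) : 0 ≤ aCoeff ρ B := by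
  unfold aCoeff; split_ifs <;> positivity

lemma aCoeff_le (ρ : ℝ) (B : ℕ) : aCoeff ρ B ≤ max 1 ρ⁻¹ := by
  unfold aCoeff; split_ifs
  exacts [le_max_left _ _, le_max_right _ _]

lemma bCoeff_le (ρ : ℝ) (B : ℕ) :
    bCoeff ρ B ≤ Real.exp (2 / Real.exp 1) / 2 * max 1 (ρ ^ (2 / Real.exp 1)) := by
  unfold bCoeff
  gcongr
  split_ifs
  exacts [le_max_left _ _, le_max_right _ _]

/-- A power with exponent less than one is dominated by every linear function. -/
lemma exists_mul_rpow_le_linear {b δ γ : ℝ} (hb : 0 < b) (hδ : 0 < δ) (hγ0 : 0 ≤ γ) (hγ : γ < 1) :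
    ∃ D : ℝ, ∀ y : ℝ, 0 ≤ y → b * y ^ γ ≤ δ * y + D := by
  have hg : 0 < 1 - γ := by linarith
  -- the point where `b y^γ = δ y`
  set y₀ := (b / δ) ^ (1 / (1 - γ)) with hy₀
  have hy0 : 0 < y₀ := Real.rpow_pos_of_pos (by positivity) _
  refine ⟨b * y₀ ^ γ, fun y hy => ?_⟩
  have hD : 0 ≤ b * y₀ ^ γ := by positivity
  rcases le_total y y₀ with h | h
  · have : b * y ^ γ ≤ b * y₀ ^ γ := by gcongr
    have : 0 ≤ δ * y := by positivity
    linarith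
  · have hyp : 0 < y := hy0.trans_le h
    have h1 : b / δ ≤ y ^ (1 - γ) := by
      calc b / δ = y₀ ^ (1 - γ) := by
            rw [hy₀, ← Real.rpow_mul (by positivity), one_div_mul_cancel hg.ne', Real.rpow_one]
        _ ≤ y ^ (1 - γ) := by gcongr
    have h2 : b ≤ y ^ (1 - γ) * δ := (div_le_iff₀ hδ).1 h1
    have h3 : b * y ^ γ ≤ δ * y := by
      calc b * y ^ γ ≤ y ^ (1 - γ) * δ * y ^ γ := by gcongr
        _ = δ * (y ^ (1 - γ) * y ^ γ) := by ring
        _ = δ * y := by rw [← Real.rpow_add hyp, sub_add_cancel, Real.rpow_one]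
    linarith

lemma exists_errorFactor_le_exp {ρ ε : ℝ} (hρ : 0 < ρ) (hε : 0 < ε) :
    ∃ K : ℝ, 0 < K ∧ ∀ B q : ℕ, 2 ≤ B →
      errorFactor B q ρ (aCoeff ρ B) (bCoeff ρ B) ≤ K * Real.exp (ε * B) := by
  have he := Real.exp_pos 1
  have he1 : 1 / Real.exp 1 ≤ 1 := by
    rw [div_le_one he]; linarith [Real.add_one_le_exp (1 : ℝ)]
  set b := Real.exp (2 / Real.exp 1) / 2 * max 1 (ρ ^ (2 / Real.exp 1)) with hb
  set a := max 1 ρ⁻¹ with ha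
  have ha0 : 0 < a := lt_max_of_lt_left one_pos
  have hb0 : 0 < b := mul_pos (by positivity) (lt_max_of_lt_left one_pos)
  obtain ⟨D, hD⟩ := exists_mul_rpow_le_linear (γ := 1 - 1 / Real.exp 1) hb0 (half_pos hε)
    (by linarith) (by have : 0 < 1 / Real.exp 1 := by positivity
                      linarith)
  refine ⟨24 / (ε / 2) ^ 4 * a * Real.exp (ε / 4 + D + ρ ^ 2 / 2), by positivity,
    fun B q hB => ?_⟩
  have hB1 : (1 : ℝ) ≤ B := by exact_mod_cast (by omega : 1 ≤ B)
  have h1 : (B : ℝ) ^ (7 / 2 : ℝ) ≤ 24 / (ε / 2) ^ 4 * Real.exp (ε / 2 * B) := by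
    have h := Real.pow_div_factorial_le_exp (ε / 2 * B) (by positivity) 4
    have h4 : (B : ℝ) ^ (7 / 2 : ℝ) ≤ (B : ℝ) ^ 4 := by
      rw [← Real.rpow_natCast]
      exact Real.rpow_le_rpow_of_exponent_le hB1 (by norm_num)
    refine h4.trans ?_
    rw [show ((Nat.factorial 4 : ℕ) : ℝ) = 24 by norm_num [Nat.factorial],
      div_le_iff₀ (by norm_num), mul_pow] at h
    rw [div_mul_eq_mul_div, le_div_iff₀ (by positivity)]
    linarith
  have h2 : bCoeff ρ B * ((B : ℝ) + 1 / 2) ^ (1 - 1 / Real.exp 1) + ρ ^ 2 / 2 -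
      q * Real.pi / 2 ≤ ε / 2 * B + (ε / 4 + D + ρ ^ 2 / 2) := by
    have h := hD ((B : ℝ) + 1 / 2) (by positivity)
    have h3 : bCoeff ρ B * ((B : ℝ) + 1 / 2) ^ (1 - 1 / Real.exp 1) ≤
        b * ((B : ℝ) + 1 / 2) ^ (1 - 1 / Real.exp 1) := by
      gcongr
      exact bCoeff_le ρ B
    have hq : 0 ≤ q * Real.pi / 2 := by have := Real.pi_pos; positivity
    linarith
  unfold errorFactor
  have := aCoeff_nonneg hρ B
  calc _ ≤ (24 / (ε / 2) ^ 4 * Real.exp (ε / 2 * B)) * a *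
        Real.exp (ε / 2 * B + (ε / 4 + D + ρ ^ 2 / 2)) := by
        gcongr
        exact aCoeff_le ρ B
    _ = 24 / (ε / 2) ^ 4 * a * Real.exp (ε / 4 + D + ρ ^ 2 / 2) *
        (Real.exp (ε / 2 * B) * Real.exp (ε / 2 * B)) := by rw [Real.exp_add]; ring
    _ = _ := by rw [← Real.exp_add]; ring_nf

/-- The dependence of the error bound on the cutoff parameter. -/
lemma errorFactor_eq (B q : ℕ) (ρ a b : ℝ) :
    errorFactor B q ρ a b = errorFactor B 0 ρ a b * Real.exp (-(q * Real.pi / 2)) := by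
  unfold errorFactor
  rw [mul_assoc _ (Real.exp _), ← Real.exp_add]
  congr 2
  push_cast
  ring

end SGL

theorem mainTheorem4 :
    -- the error estimate, with an absolute constant
    (∃ C : ℝ, 0 < C ∧ ∀ (B σ q : ℕ) (ρ : ℝ), 2 ≤ B → 2 ≤ σ → 1 ≤ q → 0 < ρ →
      ∀ (M : ℕ) (x : Fin M → SGL.SphericalPoint), (∀ i, (x i).r ≤ ρ) →
      ∀ fhat : ℕ → ℕ → ℤ → ℂ,
        SGL.maxError B σ q ρ x fhat ≤
            C * SGL.errorFactor B q ρ (SGL.aCoeff ρ B) (SGL.bCoeff ρ B) * SGL.coeffNorm B fhat ∧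
        -- for `ρ < 1`, the values of the first case are admissible for every bandwidth
        (ρ < 1 → SGL.maxError B σ q ρ x fhat ≤
            C * SGL.errorFactor B q ρ 1 (Real.exp (2 / Real.exp 1) / 2) *
              SGL.coeffNorm B fhat)) ∧
    -- exponential decay in the cutoff parameter
    (∀ (B : ℕ) (ρ : ℝ), 2 ≤ B → 0 < ρ → ∃ K : ℝ, 0 < K ∧
      ∀ (σ q : ℕ), 2 ≤ σ → 1 ≤ q →
      ∀ (M : ℕ) (x : Fin M → SGL.SphericalPoint), (∀ i, (x i).r ≤ ρ) →
      ∀ fhat : ℕ → ℕ → ℤ → ℂ,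
        SGL.maxError B σ q ρ x fhat ≤
          K * Real.exp (-(q * Real.pi / 2)) * SGL.coeffNorm B fhat) ∧
    -- at most subexponential growth in the bandwidth
    (∀ (ρ ε : ℝ), 0 < ρ → 0 < ε → ∃ K : ℝ, 0 < K ∧
      ∀ (B σ q : ℕ), 2 ≤ B → 2 ≤ σ → 1 ≤ q →
      ∀ (M : ℕ) (x : Fin M → SGL.SphericalPoint), (∀ i, (x i).r ≤ ρ) →
      ∀ fhat : ℕ → ℕ → ℤ → ℂ,
        SGL.maxError B σ q ρ x fhat ≤
          K * Real.exp (ε * B) * SGL.coeffNorm B fhat) := by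
  have hC : 0 < 96 * SGL.nfftConst := mul_pos (by norm_num) SGL.nfftConst_pos
  refine ⟨⟨96 * SGL.nfftConst, hC, ?_⟩, ?_, ?_⟩
  · intro B σ q ρ hB hσ hq hρ M x hx fhat
    exact ⟨SGL.maxError_le_aCoeff_bCoeff hB hσ hq hρ x hx fhat,
      fun hρ1 => SGL.maxError_le_of_lt_one hB hσ hq hρ hρ1 x hx fhat⟩
  · intro B ρ hB hρ
    have hE := SGL.errorFactor_nonneg B 0 ρ (SGL.bCoeff ρ B) (SGL.aCoeff_nonneg hρ B)
    refine ⟨96 * SGL.nfftConst * SGL.errorFactor B 0 ρ (SGL.aCoeff ρ B) (SGL.bCoeff ρ B) + 1,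
      by positivity, fun σ q hσ hq M x hx fhat => ?_⟩
    refine (SGL.maxError_le_aCoeff_bCoeff hB hσ hq hρ x hx fhat).trans ?_
    rw [SGL.errorFactor_eq, ← mul_assoc]
    have := SGL.coeffNorm_nonneg B fhat
    gcongr
    linarith
  · intro ρ ε hρ hε
    obtain ⟨K, hK, h⟩ := SGL.exists_errorFactor_le_exp hρ hε
    refine ⟨96 * SGL.nfftConst * K, by positivity, fun B σ q hB hσ hq M x hx fhat => ?_⟩
    refine (SGL.maxError_le_aCoeff_bCoeff hB hσ hq hρ x hx fhat).trans ?_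
    have := SGL.coeffNorm_nonneg B fhat
    calc _ ≤ 96 * SGL.nfftConst * (K * Real.exp (ε * B)) * SGL.coeffNorm B fhat := by
          gcongr
          exact h B q hB
      _ = _ := by ring
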